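/- Let $n\ge 0$ be an integer and $\lambda\in\mathbb R$. Put $e(t)=e^{2\pi i t}$, $\bar e(t)=e^{-2\pi i t}$, $\eta_\lambda(r)=\frac{e^{2\lambda r}-1}{2\lambda}$ (with $\eta_0(r)=r$), and let $\beta$ be the usual inner product on $\mathbb R^n$. Let ${\mathcal H}=L^2(\mathbb R^n\times\mathbb R^n\times\mathbb R)$ with variables $(x,y,r)$, and let $\Sigma$ be the flip on ${\mathcal H}\otimes{\mathcal H}$. Define unitaries $U_A$ on ${\mathcal H}\otimes{\mathcal H}$ and $j$ on ${\mathcal H}$ by $$U_A\xi(x,y,r;x',y',r')=(e^{-\lambda r'})^n\,\bar e\bigl[\eta_\lambda(r')\beta(e^{-\lambda r'}x,\,y'-e^{-\lambda r'}y)\bigr]\,\xi(e^{-\lambda r'}x,e^{-\lambda r'}y,r+r';\,x'-e^{-\lambda r'}x,\,y'-e^{-\lambda r'}y,\,r'),$$ $$j\xi(x,y,r)=(e^{\lambda r})^n\,\bar e\bigl[\eta_\lambda(r)\beta(x,y)\bigr]\,\xi(-e^{\lambda r}x,-e^{\lambda r}y,-r).$$ Put $Y=\Sigma(j\otimes1)U_A(j\otimes1)\Sigma$,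 $X=\Sigma Y^*\Sigma$, $Z=Y^*(j\otimes j)Y(j\otimes j)$ on ${\mathcal H}\otimes{\mathcal H}$, and, in leg-numbering notation on ${\mathcal H}^{\otimes4}$, $V_D=Z_{12}Y_{24}Z_{12}^*X_{13}$. With ${\mathcal B}(\cdot)_*$ denoting the normal linear functionals, let $$A=\overline{\{(\omega\otimes{\rm id})(U_A):\omega\in{\mathcal B}({\mathcal H})_*\}},\qquad \hat A^{\rm op}=\overline{\{({\rm id}\otimes\omega)(X):\omega\in{\mathcal B}({\mathcal H})_*\}},$$ $$A_D=\overline{\{({\rm id}\otimes{\rm id}\otimes\Omega)(V_D):\Omega\in{\mathcal B}({\mathcal H}\otimes{\mathcal H})_*\}}\subseteq{\mathcal B}({\mathcal H}\otimes{\mathcal H})$$ (norm closures), and put $\Delta_D(x)=V_D^*(1\otimes1\otimes x)V_D$ and $\Delta_D^{\rm cop}(x)=\chi(\Delta_D(x))$ for $x\in A_D$, where $\chi$ interchanges the legs $1\leftrightarrow3$ and $2\leftrightarrow4$. Put $\pi(a)=Z(1\otimes a)Z^*$ for $a\in A$ and $\pi'(b)=b\otimes1$ for $b\in\hat A^{\rm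 op}$. Tensor products of $C^*$-algebras are spatial, and $M(B)$ is the multiplier algebra of a concrete $C^*$-algebra $B$, i.e. the operators $T$ with $TB\subseteq B$ and $BT\subseteq B$. Let ${\mathcal R}=Z_{34}X_{14}Z_{34}^*\in{\mathcal B}({\mathcal H}^{\otimes4})$. Then the following hold. (0) ${\mathcal R}$ is unitary, $X\in M(\hat A^{\rm op}\otimes A)$, and ${\mathcal R}=(\pi'\otimes\pi)(X)$, where $\pi'\otimes\pi$ is the unique unital $*$-homomorphism $M(\hat A^{\rm op}\otimes A)\to{\mathcal B}({\mathcal H}^{\otimes4})$ with $b\otimes a\mapsto\pi'(b)\otimes\pi(a)$. (1) ${\mathcal R}\in M(A_D\otimes A_D)$. (2) $(\Delta_D\otimes{\rm id})({\mathcal R})={\mathcal R}_{13}{\mathcal R}_{23}$ and $({\rm id}\otimes\Delta_D)({\mathcal R})={\mathcal R}_{13}{\mathcal R}_{12}$, where $\Delta_D\otimes{\rm id}$ and ${\rm id}\otimes\Delta_D$ are the unique unital $*$-homomorphisms $M(A_D\otimes A_D)\to{\mathcal B}({\mathcal H}^{\otimes6})$ with $x\otimes y\mapsto\Delta_D(x)\otimes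 y$ and $x\otimes y\mapsto x\otimes\Delta_D(y)$, respectively. (3) ${\mathcal R}\,\Delta_D(x)\,{\mathcal R}^*=\Delta_D^{\rm cop}(x)$ for every $x\in A_D$. (4) ${\mathcal R}_{12}{\mathcal R}_{13}{\mathcal R}_{23}={\mathcal R}_{23}{\mathcal R}_{13}{\mathcal R}_{12}$. In (2) and (4), ${\mathcal R}$ is viewed as an operator on $({\mathcal H}\otimes{\mathcal H})\otimes({\mathcal H}\otimes{\mathcal H})$, and the leg numbers of ${\mathcal R}$ refer to the three copies of ${\mathcal H}\otimes{\mathcal H}$. -/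

import Mathlib

open MeasureTheory Complex
open scoped ENNReal TensorProduct InnerProductSpace

noncomputable section

namespace QDouble

/-! ## The Hilbert spaces -/

/-- The space of the variables `(x, y, r)`, with `x, y ∈ ℝⁿ` and `r ∈ ℝ`, with Lebesgue measure. -/
abbrev Pt (n : ℕ) : Type := (Fin n → ℝ) × (Fin n → ℝ) × ℝ

/-- The Hilbert tensor power of `L²(Pt n)` over the finite index set `ι`, realised as the space of
square integrable functions of one variable in `Pt n` for each leg `i : ι`. -/
abbrev HS (n : ℕ) (ι : Type) [Fintype ι] : Type :=
  Lp ℂ 2 (volume : Measure (ι → Pt n))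

/-- `𝓗^{⊗ k}`; the legs are numbered `0, …, k - 1`. -/
abbrev HT (n k : ℕ) : Type := HS n (Fin k)

theorem sigmaFinite_pt (n : ℕ) : SigmaFinite (volume : Measure (Pt n)) :=
  inferInstanceAs (SigmaFinite ((volume : Measure (Fin n → ℝ)).prod
    ((volume : Measure (Fin n → ℝ)).prod (volume : Measure ℝ))))

instance sigmaFinite_legs (n : ℕ) (ι : Type) [Fintype ι] :
    SigmaFinite (volume : Measure (ι → Pt n)) :=
  haveI := sigmaFinite_pt n
  inferInstanceAs (SigmaFinite (Measure.pi fun _ : ι => (volume : Measure (Pt n))))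

/-- Bounded operators on `𝓗^{⊗ k}`. -/
abbrev Op (n k : ℕ) : Type := HT n k →L[ℂ] HT n k

/-! ## Elementary tensors and leg numbering -/

section Legs

variable {n : ℕ} {ι κ κ' : Type} [Fintype ι] [Fintype κ] [Fintype κ']

/-- Split the variables along a decomposition `κ ⊕ κ' ≃ ι` of the set of legs. -/
def split (n : ℕ) (e : κ ⊕ κ' ≃ ι) (p : ι → Pt n) : (κ → Pt n) × (κ' → Pt n) :=
  (fun i => p (e (Sum.inl i)), fun i => p (e (Sum.inr i)))

def splitEquiv (n : ℕ) (e : κ ⊕ κ' ≃ ι) : (ι → Pt n) ≃ᵐ (κ → Pt n) × (κ' → Pt n) :=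
  (MeasurableEquiv.piCongrLeft (fun _ : ι => Pt n) e).symm.trans
    (MeasurableEquiv.sumPiEquivProdPi (fun _ : κ ⊕ κ' => Pt n))

theorem measurePreserving_split (e : κ ⊕ κ' ≃ ι) :
    MeasurePreserving (split n e) volume volume := by
  have h1 := (volume_measurePreserving_piCongrLeft (fun _ : ι => Pt n) e).symm
  have h2 := volume_measurePreserving_sumPiEquivProdPi (fun _ : κ ⊕ κ' => Pt n)
  exact h2.comp h1

theorem memLp_mul {α β : Type*} [MeasureSpace α] [MeasureSpace β]
    [SigmaFinite (volume : Measure α)] [SigmaFinite (volume : Measure β)]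
    (f : Lp ℂ 2 (volume : Measure α)) (g : Lp ℂ 2 (volume : Measure β)) :
    MemLp (fun z : α × β => f z.1 * g z.2) 2 volume := by
  have hf := Lp.memLp f
  have hg := Lp.memLp g
  have hm : AEStronglyMeasurable (fun z : α × β => f z.1 * g z.2) volume :=
    (hf.1.comp_fst).mul (hg.1.comp_snd)
  rw [← integrable_norm_rpow_iff hm (by norm_num) (by norm_num)]
  have := (hf.integrable_norm_rpow (by norm_num) (by norm_num)).mul_prod
    (hg.integrable_norm_rpow (by norm_num) (by norm_num))
  refine this.congr (Filter.Eventually.of_forall fun z => ?_)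
  simp [mul_pow]

theorem memLp_tmul (e : κ ⊕ κ' ≃ ι) (ξ : HS n κ) (ζ : HS n κ') :
    MemLp (fun p : ι → Pt n => ξ (split n e p).1 * ζ (split n e p).2) 2 volume :=
  (memLp_mul ξ ζ).comp_measurePreserving (measurePreserving_split e)

/-- The elementary tensor `ξ ⊗ ζ`, with `ξ` on the legs `κ` and `ζ` on the legs `κ'`: the function
`p ↦ ξ (p|κ) ζ (p|κ')`. -/
def tmul (e : κ ⊕ κ' ≃ ι) (ξ : HS n κ) (ζ : HS n κ') : HS n ι :=
  (memLp_tmul e ξ ζ).toLp _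

theorem coeFn_tmul (e : κ ⊕ κ' ≃ ι) (ξ : HS n κ) (ζ : HS n κ') :
    tmul e ξ ζ =ᵐ[volume] fun p => ξ (split n e p).1 * ζ (split n e p).2 :=
  MemLp.coeFn_toLp _

theorem ae_split_fst (e : κ ⊕ κ' ≃ ι) {P : (κ → Pt n) → Prop} (h : ∀ᵐ x, P x) :
    ∀ᵐ p : ι → Pt n, P (split n e p).1 :=
  (measurePreserving_split e).quasiMeasurePreserving.ae
    (Measure.quasiMeasurePreserving_fst.ae h)

theorem ae_split_snd (e : κ ⊕ κ' ≃ ι) {P : (κ' → Pt n) → Prop} (h : ∀ᵐ x, P x) :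
    ∀ᵐ p : ι → Pt n, P (split n e p).2 :=
  (measurePreserving_split e).quasiMeasurePreserving.ae
    (Measure.quasiMeasurePreserving_snd.ae h)

theorem inner_tmul (e : κ ⊕ κ' ≃ ι) (ξ ξ' : HS n κ) (ζ ζ' : HS n κ') :
    inner ℂ (tmul e ξ ζ) (tmul e ξ' ζ') = inner ℂ ξ ξ' * inner ℂ ζ ζ' := by
  have h1 : inner ℂ (tmul e ξ ζ) (tmul e ξ' ζ') =
      ∫ p : ι → Pt n, (fun z : (κ → Pt n) × (κ' → Pt n) =>
        inner ℂ (ξ z.1) (ξ' z.1) * inner ℂ (ζ z.2) (ζ' z.2)) (split n e p) := by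
    rw [L2.inner_def]
    apply integral_congr_ae
    filter_upwards [coeFn_tmul e ξ ζ, coeFn_tmul e ξ' ζ'] with p h h'
    rw [h, h']
    simp only [RCLike.inner_apply, map_mul]
    ring
  have h2 := (measurePreserving_split (n := n) e).integral_comp
    (splitEquiv n e).measurableEmbedding (fun z : (κ → Pt n) × (κ' → Pt n) =>
        inner ℂ (ξ z.1) (ξ' z.1) * inner ℂ (ζ z.2) (ζ' z.2))
  rw [h1, h2, L2.inner_def, L2.inner_def]
  exact integral_prod_mul (fun x => inner ℂ (ξ x) (ξ' x)) (fun y => inner ℂ (ζ y) (ζ' y))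

/-- The algebraic tensor product of the two Hilbert spaces inside the space on all legs. -/
def tmulLin (n : ℕ) (e : κ ⊕ κ' ≃ ι) : HS n κ ⊗[ℂ] HS n κ' →ₗ[ℂ] HS n ι :=
  TensorProduct.lift (LinearMap.mk₂ ℂ (tmul e)
    (by
      intro a b c
      apply Lp.ext
      filter_upwards [coeFn_tmul e (a + b) c, coeFn_tmul e a c, coeFn_tmul e b c,
        Lp.coeFn_add (tmul e a c) (tmul e b c), ae_split_fst e (Lp.coeFn_add a b)] with p h1 h2 h3 h4 h5
      rw [h1, h4, Pi.add_apply, h2, h3, h5, Pi.add_apply, add_mul])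
    (by
      intro r a c
      apply Lp.ext
      filter_upwards [coeFn_tmul e (r • a) c, coeFn_tmul e a c,
        Lp.coeFn_smul r (tmul e a c), ae_split_fst e (Lp.coeFn_smul r a)] with p h1 h2 h4 h5
      rw [h1, h4, Pi.smul_apply, h2, h5, Pi.smul_apply, smul_mul_assoc])
    (by
      intro c a b
      apply Lp.ext
      filter_upwards [coeFn_tmul e c (a + b), coeFn_tmul e c a, coeFn_tmul e c b,
        Lp.coeFn_add (tmul e c a) (tmul e c b), ae_split_snd e (Lp.coeFn_add a b)] with p h1 h2 h3 h4 h5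
      rw [h1, h4, Pi.add_apply, h2, h3, h5, Pi.add_apply, mul_add])
    (by
      intro r c a
      apply Lp.ext
      filter_upwards [coeFn_tmul e c (r • a), coeFn_tmul e c a,
        Lp.coeFn_smul r (tmul e c a), ae_split_snd e (Lp.coeFn_smul r a)] with p h1 h2 h4 h5
      rw [h1, h4, Pi.smul_apply, h2, h5, Pi.smul_apply, mul_smul_comm]))

theorem inner_tmulLin (e : κ ⊕ κ' ≃ ι) (u v : HS n κ ⊗[ℂ] HS n κ') :
    inner ℂ (tmulLin n e u) (tmulLin n e v) = inner ℂ u v := by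
  induction u using TensorProduct.induction_on with
  | zero => simp
  | add a b ha hb => simp only [map_add, inner_add_left, ha, hb]
  | tmul a b =>
    induction v using TensorProduct.induction_on with
    | zero => simp
    | add c d hc hd => simp only [map_add, inner_add_right, hc, hd]
    | tmul c d => simpa [tmulLin] using inner_tmul e a c b d

def tmulIso (n : ℕ) (e : κ ⊕ κ' ≃ ι) : HS n κ ⊗[ℂ] HS n κ' →ₗᵢ[ℂ] HS n ι :=
  (tmulLin n e).isometryOfInner (inner_tmulLin e)

open UniformSpace in
/-- The canonical unitary from the Hilbert tensor product (the completion of the algebraic tensor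
product) onto the space on all legs. -/
def tensorMap (n : ℕ) (e : κ ⊕ κ' ≃ ι) :
    Completion (HS n κ ⊗[ℂ] HS n κ') →L[ℂ] HS n ι :=
  (tmulIso n e).toContinuousLinearMap.extend Completion.toComplL

open UniformSpace in
/-- `T ⊗ 1` on the Hilbert tensor product. -/
def amplify (κ' : Type) [Fintype κ'] (T : HS n κ →L[ℂ] HS n κ) :
    Completion (HS n κ ⊗[ℂ] HS n κ') →L[ℂ] Completion (HS n κ ⊗[ℂ] HS n κ') :=
  ((Completion.toComplL (𝕜 := ℂ)).comp (T.rTensor (HS n κ'))).extend Completion.toComplL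

/-- The operator `T ⊗ 1`, acting as `T` on the legs `κ` and as the identity on the legs `κ'`. -/
def ampl (e : κ ⊕ κ' ≃ ι) (T : HS n κ →L[ℂ] HS n κ) : HS n ι →L[ℂ] HS n ι :=
  (tensorMap n e).comp ((amplify κ' T).comp (ContinuousLinearMap.adjoint (tensorMap n e)))

open UniformSpace in
theorem isUniformInducing_compl (E : Type*) [NormedAddCommGroup E] [InnerProductSpace ℂ E] :
    IsUniformInducing (Completion.toComplL : E →L[ℂ] Completion E) :=
  Completion.isUniformInducing_coe E

theorem tensorMap_coe (e : κ ⊕ κ' ≃ ι) (u : HS n κ ⊗[ℂ] HS n κ') :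
    tensorMap n e (u : UniformSpace.Completion (HS n κ ⊗[ℂ] HS n κ')) = tmulIso n e u :=
  ContinuousLinearMap.extend_eq _ UniformSpace.Completion.denseRange_coe
    (isUniformInducing_compl _) u

theorem amplify_coe (T : HS n κ →L[ℂ] HS n κ) (u : HS n κ ⊗[ℂ] HS n κ') :
    amplify κ' T (u : UniformSpace.Completion (HS n κ ⊗[ℂ] HS n κ')) =
      (T.rTensor (HS n κ') u : UniformSpace.Completion (HS n κ ⊗[ℂ] HS n κ')) :=
  ContinuousLinearMap.extend_eq _ UniformSpace.Completion.denseRange_coe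
    (isUniformInducing_compl _) u

theorem inner_tensorMap (e : κ ⊕ κ' ≃ ι) (u v : UniformSpace.Completion (HS n κ ⊗[ℂ] HS n κ')) :
    inner ℂ (tensorMap n e u) (tensorMap n e v) = inner ℂ u v := by
  induction u, v using UniformSpace.Completion.induction_on₂ with
  | hp => exact isClosed_eq (by fun_prop) (by fun_prop)
  | ih a b => rw [tensorMap_coe, tensorMap_coe, LinearIsometry.inner_map_map,
      UniformSpace.Completion.inner_coe]

/-- The operator `T ⊗ 1` acts as expected on elementary tensors. -/
theorem ampl_tmul (e : κ ⊕ κ' ≃ ι) (T : HS n κ →L[ℂ] HS n κ) (ξ : HS n κ) (ζ : HS n κ') :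
    ampl e T (tmul e ξ ζ) = tmul e (T ξ) ζ := by
  have h : ∀ (ξ : HS n κ), tensorMap n e
      ((ξ ⊗ₜ[ℂ] ζ : HS n κ ⊗[ℂ] HS n κ') : UniformSpace.Completion (HS n κ ⊗[ℂ] HS n κ')) =
      tmul e ξ ζ := fun ξ => by rw [tensorMap_coe]; rfl
  have h' : ∀ u, ContinuousLinearMap.adjoint (tensorMap n e) (tensorMap n e u) = u := fun u =>
    ext_inner_left ℂ fun v => by
      rw [ContinuousLinearMap.adjoint_inner_right, inner_tensorMap]
  simp only [ampl, ContinuousLinearMap.comp_apply]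
  rw [← h ξ, h', amplify_coe, ContinuousLinearMap.rTensor_tmul, h]

/-- Decomposition of the legs into those in the range of `f` and the others. -/
def legEquiv (f : κ → ι) (hf : Function.Injective f) : κ ⊕ {i // i ∉ Set.range f} ≃ ι :=
  letI := Classical.decPred (· ∈ Set.range f)
  (Equiv.sumCongr (Equiv.ofInjective f hf) (Equiv.refl _)).trans
    (Equiv.sumCompl (· ∈ Set.range f))

/-- Leg numbering: `leg f T` is the operator on `𝓗^{⊗ m}` which acts as `T` on the legs
`f 0, f 1, …` (in this order) and trivially on the others. For instance, with legs counted from `0`,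
`leg ![0, 2] T` is what is usually written `T₁₃`. -/
def leg {n k m : ℕ} (f : Fin k → Fin m) (T : Op n k)
    (hf : Function.Injective f := by decide) : Op n m :=
  ampl (legEquiv f hf) T

end Legs

/-! ## Weighted composition operators -/

section Weighted

variable {α : Type*} [MeasureSpace α] {c : α → ℂ} {θ : α → α}

/-- The weight `c` compensates for the change of variables `θ`. -/
structure IsWeight (c : α → ℂ) (θ : α → α) : Prop where
  measurable_weight : Measurable c
  measurable_map : Measurable θ
  ne_zero : ∀ p, c p ≠ 0
  lintegral_eq : ∀ f : α → ℝ≥0∞, Measurable f →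
    ∫⁻ p, ‖c p‖ₑ ^ 2 * f (θ p) = ∫⁻ p, f p

theorem IsWeight.quasi (h : IsWeight c θ) :
    Measure.QuasiMeasurePreserving θ (volume : Measure α) volume := by
  refine ⟨h.measurable_map, Measure.AbsolutelyContinuous.mk fun s hs h0 => ?_⟩
  rw [Measure.map_apply h.measurable_map hs]
  have h1 := h.lintegral_eq (s.indicator 1) (measurable_one.indicator hs)
  rw [lintegral_indicator_one hs, h0, lintegral_eq_zero_iff (by
    exact ((h.measurable_weight.enorm).pow_const 2).mul
      ((measurable_one.indicator hs).comp h.measurable_map))] at h1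
  rw [measure_eq_zero_iff_ae_notMem]
  filter_upwards [h1] with p hp hps
  have : (s.indicator (1 : α → ℝ≥0∞)) (θ p) = 1 := Set.indicator_of_mem (s := s) hps _
  simp [this, h.ne_zero p] at hp

theorem IsWeight.eLpNorm_eq (h : IsWeight c θ) (ξ : Lp ℂ 2 (volume : Measure α)) :
    eLpNorm (fun p => c p * ξ (θ p)) 2 volume = eLpNorm ξ 2 volume := by
  rw [eLpNorm_eq_lintegral_rpow_enorm_toReal (by norm_num) (by norm_num),
    eLpNorm_eq_lintegral_rpow_enorm_toReal (by norm_num) (by norm_num)]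
  congr 1
  have hm := (Lp.stronglyMeasurable ξ).measurable.enorm.pow_const (2 : ℝ)
  have h1 := h.lintegral_eq (fun p => ‖ξ p‖ₑ ^ (2 : ℝ)) hm
  simpa [enorm_mul, mul_pow] using h1

theorem IsWeight.memLp (h : IsWeight c θ) (ξ : Lp ℂ 2 (volume : Measure α)) :
    MemLp (fun p => c p * ξ (θ p)) 2 volume := by
  refine ⟨?_, ?_⟩
  · exact (h.measurable_weight.mul
      ((Lp.stronglyMeasurable ξ).measurable.comp h.measurable_map)).aestronglyMeasurable
  · rw [h.eLpNorm_eq]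
    exact (Lp.memLp ξ).2

/-- The operator `(T ξ)(p) = c(p) ξ(θ(p))` on `L²`. -/
def weightedComp (h : IsWeight c θ) :
    Lp ℂ 2 (volume : Measure α) →L[ℂ] Lp ℂ 2 (volume : Measure α) :=
  LinearMap.mkContinuous
    { toFun := fun ξ => (h.memLp ξ).toLp _
      map_add' := fun a b => by
        rw [← MemLp.toLp_add]
        apply MemLp.toLp_congr
        filter_upwards [h.quasi.ae (Lp.coeFn_add a b)] with p hp
        simp only [hp, Pi.add_apply, mul_add]
      map_smul' := fun r a => by
        rw [RingHom.id_apply, ← MemLp.toLp_const_smul]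
        apply MemLp.toLp_congr
        filter_upwards [h.quasi.ae (Lp.coeFn_smul r a)] with p hp
        simp only [hp, Pi.smul_apply, mul_smul_comm] } 1
    (fun ξ => by
      simp only [LinearMap.coe_mk, AddHom.coe_mk, one_mul]
      rw [Lp.norm_toLp, h.eLpNorm_eq, Lp.norm_def])

end Weighted

/-! ## The multiplicative unitary -/

/-- `e[t] = exp(2πit)`. -/
def expTwoPiI (t : ℝ) : ℂ := Complex.exp (2 * Real.pi * t * Complex.I)

/-- `η_λ(r) = (exp(2λr) - 1) / (2λ)`, and `η_0(r) = r`. -/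
def eta (lam r : ℝ) : ℝ :=
  if lam = 0 then r else (Real.exp (2 * lam * r) - 1) / (2 * lam)

/-- The inner product on `ℝⁿ`. -/
def beta {n : ℕ} (x y : Fin n → ℝ) : ℝ := ∑ i, x i * y i

/-- The weight of `U_A`, at `(x, y, r; x', y', r') = (p 0; p 1)`:
`exp(-λr')ⁿ ē[η_λ(r') β(exp(-λr') x, y' - exp(-λr') y)]`. -/
def weightU (n : ℕ) (lam : ℝ) (p : Fin 2 → Pt n) : ℂ :=
  match p 0, p 1 with
  | (x, y, _), (_, y', r') =>
    ((Real.exp (-lam * r') ^ n : ℝ) : ℂ) *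
      expTwoPiI (-(eta lam r' * beta (Real.exp (-lam * r') • x) (y' - Real.exp (-lam * r') • y)))

/-- The change of variables of `U_A`. -/
def mapU (n : ℕ) (lam : ℝ) (p : Fin 2 → Pt n) : Fin 2 → Pt n :=
  match p 0, p 1 with
  | (x, y, r), (x', y', r') =>
    ![(Real.exp (-lam * r') • x, Real.exp (-lam * r') • y, r + r'),
      (x' - Real.exp (-lam * r') • x, y' - Real.exp (-lam * r') • y, r')]

/-- The weight of `j`, at `(x, y, r) = p 0`: `exp(λr)ⁿ ē[η_λ(r) β(x, y)]`. -/
def weightJ (n : ℕ) (lam : ℝ) (p : Fin 1 → Pt n) : ℂ :=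
  match p 0 with
  | (x, y, r) => ((Real.exp (lam * r) ^ n : ℝ) : ℂ) * expTwoPiI (-(eta lam r * beta x y))

/-- The change of variables of `j`. -/
def mapJ (n : ℕ) (lam : ℝ) (p : Fin 1 → Pt n) : Fin 1 → Pt n :=
  match p 0 with
  | (x, y, r) => ![(-(Real.exp (lam * r) • x), -(Real.exp (lam * r) • y), -r)]

theorem enorm_expTwoPiI (t : ℝ) : ‖expTwoPiI t‖ₑ = 1 := by
  have : ‖expTwoPiI t‖ = 1 := by
    have h := Complex.norm_exp_ofReal_mul_I (2 * Real.pi * t)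
    push_cast at h
    exact h
  rw [← ofReal_norm, this, ENNReal.ofReal_one]

theorem expTwoPiI_ne_zero (t : ℝ) : expTwoPiI t ≠ 0 := Complex.exp_ne_zero _

theorem measurable_expTwoPiI : Measurable expTwoPiI := by
  unfold expTwoPiI; fun_prop

theorem measurable_eta (lam : ℝ) : Measurable (eta lam) := by
  by_cases h : lam = 0
  · have : eta lam = fun r => r := by
      ext r; simp [eta, h]
    rw [this]; fun_prop
  · have : eta lam = fun r => (Real.exp (2 * lam * r) - 1) / (2 * lam) := by
      ext r; simp [eta, h]
    rw [this]; fun_prop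

/-- Scaling of the `x` and `y` variables at fixed `r`. -/
theorem lintegral_scale (n : ℕ) (a : ℝ) (ha : a ≠ 0) (f : (Fin n → ℝ) → ℝ≥0∞)
    (hf : Measurable f) :
    ∫⁻ x, ENNReal.ofReal (|a| ^ n) * f (a • x) = ∫⁻ x, f x := by
  have h := Measure.map_addHaar_smul (volume : Measure (Fin n → ℝ)) ha
  have h1 : ∫⁻ x, f (a • x) = ∫⁻ x, f x ∂(Measure.map (a • ·) volume) :=
    (lintegral_map hf (measurable_const_smul a)).symm
  rw [lintegral_const_mul _ (f := fun x => f (a • x)) (hf.comp (measurable_const_smul a)), h1, h, lintegral_smul_measure,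
    smul_eq_mul, ← mul_assoc, ← ENNReal.ofReal_mul (by positivity)]
  have : |a| ^ n * |(a ^ Module.finrank ℝ (Fin n → ℝ))⁻¹| = 1 := by
    rw [Module.finrank_fin_fun, abs_inv, abs_pow]
    exact mul_inv_cancel₀ (by positivity)
  rw [this]; simp

theorem lintegral_pt (n : ℕ) (f : Pt n → ℝ≥0∞) (hf : Measurable f) :
    ∫⁻ p, f p = ∫⁻ r, ∫⁻ y, ∫⁻ x, f (x, y, r) := by
  have h1 : ∫⁻ p, f p = ∫⁻ z : (Fin n → ℝ) × ℝ, ∫⁻ x, f (x, z) :=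
    lintegral_prod_symm' f hf
  rw [h1]
  exact lintegral_prod_symm' (fun z : (Fin n → ℝ) × ℝ => ∫⁻ x, f (x, z))
    (Measurable.lintegral_prod_left' hf)

theorem lintegral_scale_pt (n : ℕ) (a : ℝ → ℝ) (hm : Measurable a) (ha : ∀ r, a r ≠ 0)
    (f : Pt n → ℝ≥0∞) (hf : Measurable f) :
    ∫⁻ p : Pt n, ENNReal.ofReal (|a p.2.2| ^ n) ^ 2 * f (a p.2.2 • p.1, a p.2.2 • p.2.1, p.2.2) =
      ∫⁻ p, f p := by
  rw [lintegral_pt n _ (by fun_prop), lintegral_pt n f hf]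
  congr 1; ext r
  have h1 : ∀ y : Fin n → ℝ,
      ∫⁻ x, ENNReal.ofReal (|a r| ^ n) ^ 2 * f (a r • x, a r • y, r) =
      ENNReal.ofReal (|a r| ^ n) * ∫⁻ x, f (x, a r • y, r) := fun y => by
    rw [← lintegral_scale n (a r) (ha r) (fun x => f (x, a r • y, r)) (by fun_prop),
      ← lintegral_const_mul _ (by fun_prop)]
    simp only [pow_two, mul_assoc]
  simp only [h1]
  exact lintegral_scale n (a r) (ha r) (fun y => ∫⁻ x, f (x, y, r))
    (Measurable.lintegral_prod_left' (f := fun z : (Fin n → ℝ) × (Fin n → ℝ) => f (z.1, z.2, r))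
      (by fun_prop))

theorem enorm_weight (a b : ℝ) (ha : 0 ≤ a) :
    ‖(a : ℂ) * expTwoPiI b‖ₑ = ENNReal.ofReal a := by
  rw [enorm_mul, enorm_expTwoPiI, mul_one, ← ofReal_norm, Complex.norm_real, Real.norm_eq_abs,
    abs_of_nonneg ha]

theorem weightJ_eq (n : ℕ) (lam : ℝ) (p : Fin 1 → Pt n) : weightJ n lam p =
    ((Real.exp (lam * (p 0).2.2) ^ n : ℝ) : ℂ) *
      expTwoPiI (-(eta lam (p 0).2.2 * beta (p 0).1 (p 0).2.1)) := rfl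

theorem mapJ_eq (n : ℕ) (lam : ℝ) (p : Fin 1 → Pt n) : mapJ n lam p = fun _ =>
    (-(Real.exp (lam * (p 0).2.2) • (p 0).1), -(Real.exp (lam * (p 0).2.2) • (p 0).2.1),
      -(p 0).2.2) := by
  ext i : 1
  fin_cases i
  rfl

theorem weightU_eq (n : ℕ) (lam : ℝ) (p : Fin 2 → Pt n) : weightU n lam p =
    ((Real.exp (-lam * (p 1).2.2) ^ n : ℝ) : ℂ) *
      expTwoPiI (-(eta lam (p 1).2.2 * beta (Real.exp (-lam * (p 1).2.2) • (p 0).1)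
        ((p 1).2.1 - Real.exp (-lam * (p 1).2.2) • (p 0).2.1))) := rfl

theorem mapU_eq (n : ℕ) (lam : ℝ) (p : Fin 2 → Pt n) : mapU n lam p =
    ![(Real.exp (-lam * (p 1).2.2) • (p 0).1, Real.exp (-lam * (p 1).2.2) • (p 0).2.1,
        (p 0).2.2 + (p 1).2.2),
      ((p 1).1 - Real.exp (-lam * (p 1).2.2) • (p 0).1,
        (p 1).2.1 - Real.exp (-lam * (p 1).2.2) • (p 0).2.1, (p 1).2.2)] := rfl

theorem measurable_beta {n : ℕ} {α : Type*} [MeasurableSpace α] {f g : α → Fin n → ℝ}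
    (hf : Measurable f) (hg : Measurable g) : Measurable fun x => beta (f x) (g x) := by
  unfold beta; fun_prop

theorem measurable_vecPair {n : ℕ} {α : Type*} [MeasurableSpace α] {f g : α → Pt n}
    (hf : Measurable f) (hg : Measurable g) : Measurable fun x => (![f x, g x] : Fin 2 → Pt n) := by
  refine measurable_pi_iff.2 fun i => ?_
  fin_cases i
  · exact hf
  · exact hg

theorem lintegral_add_pt (n : ℕ) (f : Pt n → ℝ≥0∞) (hf : Measurable f) (v : Pt n) :
    ∫⁻ p : Pt n, f (p.1 + v.1, p.2.1 + v.2.1, p.2.2 + v.2.2) = ∫⁻ p, f p :=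
  ((measurePreserving_add_right (volume : Measure (Fin n → ℝ)) v.1).prod
    ((measurePreserving_add_right (volume : Measure (Fin n → ℝ)) v.2.1).prod
      (measurePreserving_add_right (volume : Measure ℝ) v.2.2))).lintegral_comp hf

theorem isWeight_j (n : ℕ) (lam : ℝ) : IsWeight (weightJ n lam) (mapJ n lam) where
  measurable_weight := by
    simp only [funext (weightJ_eq n lam)]
    have h1 := measurable_expTwoPiI
    have h2 := measurable_eta lam
    have h3 : Measurable fun p : Fin 1 → Pt n => beta (p 0).1 (p 0).2.1 :=
      measurable_beta (by fun_prop) (by fun_prop)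
    fun_prop
  measurable_map := by
    simp only [funext (mapJ_eq n lam)]
    fun_prop
  ne_zero p := by
    rw [weightJ_eq]
    exact mul_ne_zero (by exact_mod_cast (pow_pos (Real.exp_pos _) n).ne') (expTwoPiI_ne_zero _)
  lintegral_eq f hf := by
    have hu := volume_preserving_funUnique (Fin 1) (Pt n)
    have key : ∀ g : (Fin 1 → Pt n) → ℝ≥0∞, ∫⁻ p, g p = ∫⁻ q : Pt n, g (fun _ => q) := fun g => by
      exact ((hu.symm _).lintegral_comp_emb (MeasurableEquiv.measurableEmbedding _) g).symm
    rw [key, key f]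
    have hf' : Measurable fun q : Pt n => f (fun _ => q) := hf.comp (by fun_prop)
    have h1 := lintegral_scale_pt n (fun r => -Real.exp (lam * r)) (by fun_prop)
      (fun r => neg_ne_zero.2 (Real.exp_pos _).ne')
      (fun q => f (fun _ => (q.1, q.2.1, -q.2.2))) (hf.comp (by fun_prop))
    have h2 : ∫⁻ q : Pt n, f (fun _ => (q.1, q.2.1, -q.2.2)) = ∫⁻ q : Pt n, f (fun _ => q) := by
      rw [lintegral_pt n (fun q => f (fun _ => (q.1, q.2.1, -q.2.2))) (hf.comp (by fun_prop)),
        lintegral_pt n _ hf']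
      exact lintegral_neg_eq_self (fun r => ∫⁻ y, ∫⁻ x, f (fun _ => (x, y, r)))
    rw [← h2, ← h1]
    congr 1; ext q
    rw [weightJ_eq, mapJ_eq, enorm_weight _ _ (by positivity)]
    simp [abs_of_pos (Real.exp_pos _)]

theorem measurable_weightU (n : ℕ) (lam : ℝ) : Measurable (weightU n lam) := by
  simp only [funext (weightU_eq n lam)]
  have h1 := measurable_expTwoPiI
  have h2 := measurable_eta lam
  have h3 : Measurable fun p : Fin 2 → Pt n => beta (Real.exp (-lam * (p 1).2.2) • (p 0).1)
      ((p 1).2.1 - Real.exp (-lam * (p 1).2.2) • (p 0).2.1) :=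
    measurable_beta (by fun_prop) (by fun_prop)
  fun_prop

theorem measurable_mapU (n : ℕ) (lam : ℝ) : Measurable (mapU n lam) := by
  simp only [funext (mapU_eq n lam)]
  exact measurable_vecPair (by fun_prop) (by fun_prop)

theorem isWeight_U (n : ℕ) (lam : ℝ) : IsWeight (weightU n lam) (mapU n lam) where
  measurable_weight := measurable_weightU n lam
  measurable_map := measurable_mapU n lam
  ne_zero p := by
    rw [weightU_eq]
    exact mul_ne_zero (by exact_mod_cast (pow_pos (Real.exp_pos _) n).ne') (expTwoPiI_ne_zero _)
  lintegral_eq f hf := by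
    have := sigmaFinite_pt n
    have key : ∀ g : (Fin 2 → Pt n) → ℝ≥0∞,
        ∫⁻ p, g p = ∫⁻ q : Pt n × Pt n, g ![q.1, q.2] := fun g => by
      exact (((volume_preserving_finTwoArrow (Pt n)).symm _).lintegral_comp_emb
        (MeasurableEquiv.measurableEmbedding _) g).symm
    rw [key, key f]
    have hpair : Measurable fun q : Pt n × Pt n => (![q.1, q.2] : Fin 2 → Pt n) :=
      measurable_vecPair measurable_fst measurable_snd
    have hf' : Measurable fun q : Pt n × Pt n => f ![q.1, q.2] := hf.comp hpair
    have hF : Measurable fun q : Pt n × Pt n =>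
        f ![q.1, (q.2.1 - q.1.1, q.2.2.1 - q.1.2.1, q.2.2.2)] :=
      hf.comp (measurable_vecPair (by fun_prop) (by fun_prop))
    have step1 : ∫⁻ q : Pt n × Pt n, ‖weightU n lam ![q.1, q.2]‖ₑ ^ 2 *
        f (mapU n lam ![q.1, q.2]) =
        ∫⁻ p1 : Pt n, ∫⁻ p0 : Pt n, f ![p0, (p1.1 - p0.1, p1.2.1 - p0.2.1, p1.2.2)] := by
      rw [Measure.volume_eq_prod, lintegral_prod_symm' _ ?_]
      · congr 1; ext p1
        have h1 := lintegral_scale_pt n (fun _ => Real.exp (-lam * p1.2.2)) (by fun_prop)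
          (fun r => (Real.exp_pos _).ne')
          (fun q => f ![(q.1, q.2.1, q.2.2 + p1.2.2),
            (p1.1 - q.1, p1.2.1 - q.2.1, p1.2.2)])
          (hf.comp (measurable_vecPair (by fun_prop) (by fun_prop)))
        have h2 := lintegral_add_pt n
          (fun q => f ![q, (p1.1 - q.1, p1.2.1 - q.2.1, p1.2.2)])
          (hf.comp (measurable_vecPair (by fun_prop) (by fun_prop))) (0, 0, p1.2.2)
        rw [← h2]
        simp only [add_zero]
        refine Eq.trans ?_ (h1.trans ?_)
        · congr 1; ext p0
          rw [weightU_eq, mapU_eq, enorm_weight _ _ (by positivity)]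
          simp [abs_of_pos (Real.exp_pos _)]
        · rfl
      · exact (((measurable_weightU n lam).comp hpair).enorm.pow_const 2).mul
          (hf.comp ((measurable_mapU n lam).comp hpair))
    have step2 : ∫⁻ q : Pt n × Pt n, f ![q.1, q.2] = ∫⁻ p0 : Pt n, ∫⁻ p1 : Pt n, f ![p0, p1] :=
      lintegral_prod _ hf'.aemeasurable
    rw [step1, step2,
      lintegral_lintegral_swap (f := fun p1 p0 : Pt n =>
        f ![p0, (p1.1 - p0.1, p1.2.1 - p0.2.1, p1.2.2)])
        (hF.comp measurable_swap).aemeasurable]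
    congr 1; ext p0
    have h3 := lintegral_add_pt n (fun q => f ![p0, q])
      (hf.comp (measurable_vecPair (by fun_prop) (by fun_prop))) (-p0.1, -p0.2.1, 0)
    rw [← h3]
    congr 1; ext p1
    simp [sub_eq_add_neg]

/-- The multiplicative unitary `U_A`:
`U_A ξ (x, y, r; x', y', r') = exp(-λr')ⁿ ē[η_λ(r') β(exp(-λr') x, y' - exp(-λr') y)]
  ξ (exp(-λr') x, exp(-λr') y, r + r'; x' - exp(-λr') x, y' - exp(-λr') y, r')`. -/
def UA (n : ℕ) (lam : ℝ) : Op n 2 := weightedComp (isWeight_U n lam)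

/-- `j ξ (x, y, r) = exp(λr)ⁿ ē[η_λ(r) β(x, y)] ξ (-exp(λr) x, -exp(λr) y, -r)`. -/
def jop (n : ℕ) (lam : ℝ) : Op n 1 := weightedComp (isWeight_j n lam)

/-- `Y = Σ (j ⊗ 1) U_A (j ⊗ 1) Σ`; conjugation by the flip `Σ` is `leg ![1, 0]`. -/
def Yop (n : ℕ) (lam : ℝ) : Op n 2 :=
  leg ![1, 0] (leg ![0] (jop n lam) * UA n lam * leg ![0] (jop n lam))

/-- `X = Σ Y^* Σ`. -/
def Xop (n : ℕ) (lam : ℝ) : Op n 2 := leg ![1, 0] (star (Yop n lam))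

/-- `j ⊗ j`. -/
def jj (n : ℕ) (lam : ℝ) : Op n 2 := leg ![0] (jop n lam) * leg ![1] (jop n lam)

/-- `Z = Y^* (j ⊗ j) Y (j ⊗ j)`. -/
def Zop (n : ℕ) (lam : ℝ) : Op n 2 :=
  star (Yop n lam) * (jj n lam * Yop n lam * jj n lam)

/-- `V_D = Z₁₂ Y₂₄ Z₁₂^* X₁₃`. -/
def VD (n : ℕ) (lam : ℝ) : Op n 4 :=
  leg ![0, 1] (Zop n lam) * leg ![1, 3] (Yop n lam) * star (leg ![0, 1] (Zop n lam)) *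
    leg ![0, 2] (Xop n lam)

/-! ## Slices, tensor products and multipliers -/

section Slices

variable {n k l : ℕ}

/-- The first `k` legs followed by the last `l` legs. -/
abbrev firstLast (k l : ℕ) : Fin k ⊕ Fin l ≃ Fin (k + l) := finSumFinEquiv

/-- The last `l` legs followed by the first `k` legs. -/
abbrev lastFirst (k l : ℕ) : Fin l ⊕ Fin k ≃ Fin (k + l) :=
  (Equiv.sumComm (Fin l) (Fin k)).trans finSumFinEquiv

/-- A normal functional `ω = ∑ᵢ ω_{ξᵢ, ηᵢ}` on the bounded operators on `𝓗^{⊗ l}`, i.e.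
`ω(T) = ∑ᵢ ⟨T ξᵢ, ηᵢ⟩` (linear in the first variable), where `∑ᵢ ‖ξᵢ‖² < ∞` and `∑ᵢ ‖ηᵢ‖² < ∞`.
Every element of the predual is of this form. -/
structure NormalFunctional (n l : ℕ) where
  ξ : ℕ → HT n l
  η : ℕ → HT n l
  summable_ξ : Summable fun i => ‖ξ i‖ ^ 2
  summable_η : Summable fun i => ‖η i‖ ^ 2

/-- The operator `ξ ↦ ξ ⊗ ζ`. -/
def tmulRight {m : ℕ} (d : Fin k ⊕ Fin l ≃ Fin m) (ζ : HT n l) : HT n k →L[ℂ] HT n m :=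
  (tmulIso n d).toContinuousLinearMap.comp ((TensorProduct.mkL ℂ (HT n k) (HT n l)).flip ζ)

/-- The slice of `T` by `ω`, applied to the legs in the second part of the decomposition `d`:
`∑ᵢ V_{ηᵢ}^* T V_{ξᵢ}`, where `V_ζ ξ = ξ ⊗ ζ` (a norm convergent series). -/
def slice {m : ℕ} (d : Fin k ⊕ Fin l ≃ Fin m) (ω : NormalFunctional n l) (T : Op n m) : Op n k :=
  ∑' i, (ContinuousLinearMap.adjoint (tmulRight d (ω.η i))).comp (T.comp (tmulRight d (ω.ξ i)))

/-- `(id ⊗ ω)(T)`, with `ω` applied to the last `l` legs. -/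
def rightSlice (ω : NormalFunctional n l) (T : Op n (k + l)) : Op n k := slice (firstLast k l) ω T

/-- `(ω ⊗ id)(T)`, with `ω` applied to the first `k` legs. -/
def leftSlice (ω : NormalFunctional n k) (T : Op n (k + l)) : Op n l := slice (lastFirst k l) ω T

/-- `S ⊗ T`. -/
def opTensor (S : Op n k) (T : Op n l) : Op n (k + l) :=
  ampl (firstLast k l) S * ampl (lastFirst k l) T

/-- The spatial (minimal) `C^*`-tensor product `B ⊗ C` of two concrete `C^*`-algebras: the norm
closed linear span of the operators `b ⊗ c`. -/
def cstarTensor (B : Set (Op n k)) (C : Set (Op n l)) : Submodule ℂ (Op n (k + l)) :=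
  (Submodule.span ℂ {T | ∃ b ∈ B, ∃ c ∈ C, T = opTensor b c}).topologicalClosure

/-- The multiplier algebra `M(B)` of a concrete nondegenerate `C^*`-algebra `B` of operators: the
operators `T` with `T B ⊆ B` and `B T ⊆ B`. The same is asked of `T^*`, which is automatic when `B`
is closed under the involution. -/
def multiplierAlgebra (B : Submodule ℂ (Op n k)) : StarSubalgebra ℂ (Op n k) where
  carrier := {T | (∀ b ∈ B, T * b ∈ B ∧ b * T ∈ B) ∧ ∀ b ∈ B, star T * b ∈ B ∧ b * star T ∈ B}
  mul_mem' {S T} hS hT := by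
    refine ⟨fun b hb => ⟨?_, ?_⟩, fun b hb => ⟨?_, ?_⟩⟩
    · rw [mul_assoc]; exact (hS.1 _ (hT.1 b hb).1).1
    · rw [← mul_assoc]; exact (hT.1 _ (hS.1 b hb).2).2
    · rw [star_mul, mul_assoc]; exact (hT.2 _ (hS.2 b hb).1).1
    · rw [star_mul, ← mul_assoc]; exact (hS.2 _ (hT.2 b hb).2).2
  add_mem' {S T} hS hT := by
    refine ⟨fun b hb => ⟨?_, ?_⟩, fun b hb => ⟨?_, ?_⟩⟩
    · rw [add_mul]; exact B.add_mem (hS.1 b hb).1 (hT.1 b hb).1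
    · rw [mul_add]; exact B.add_mem (hS.1 b hb).2 (hT.1 b hb).2
    · rw [star_add, add_mul]; exact B.add_mem (hS.2 b hb).1 (hT.2 b hb).1
    · rw [star_add, mul_add]; exact B.add_mem (hS.2 b hb).2 (hT.2 b hb).2
  algebraMap_mem' r := by
    refine ⟨fun b hb => ⟨?_, ?_⟩, fun b hb => ⟨?_, ?_⟩⟩
    · rw [Algebra.algebraMap_eq_smul_one, smul_one_mul]; exact B.smul_mem r hb
    · rw [Algebra.algebraMap_eq_smul_one, mul_smul_one]; exact B.smul_mem r hb
    · rw [Algebra.algebraMap_eq_smul_one, star_smul, star_one, smul_one_mul]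
      exact B.smul_mem _ hb
    · rw [Algebra.algebraMap_eq_smul_one, star_smul, star_one, mul_smul_one]
      exact B.smul_mem _ hb
  star_mem' {T} hT := ⟨hT.2, fun b hb => by rw [star_star]; exact hT.1 b hb⟩

/-- `Φ` is an extension of `φ ⊗ ψ : B ⊗ C → 𝓑(𝓗^{⊗ (k' + l')})` to a unital `*`-homomorphism on
the multiplier algebra `M(B ⊗ C)`. -/
def IsTensorExtension {k' l' : ℕ} (B : Set (Op n k)) (C : Set (Op n l))
    (φ : Op n k → Op n k') (ψ : Op n l → Op n l')
    (Φ : multiplierAlgebra (cstarTensor B C) →⋆ₐ[ℂ] Op n (k' + l')) : Prop :=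
  ∀ b ∈ B, ∀ c ∈ C, ∃ h : opTensor b c ∈ multiplierAlgebra (cstarTensor B C),
    Φ ⟨opTensor b c, h⟩ = opTensor (φ b) (ψ c)

/-- `T` is the value at `m ∈ M(B ⊗ C)` of the canonical extension of `φ ⊗ ψ` to `M(B ⊗ C)`: there
is exactly one extension to a unital `*`-homomorphism, and it maps `m` to `T`. -/
def IsTensorValue {k' l' : ℕ} (B : Set (Op n k)) (C : Set (Op n l))
    (φ : Op n k → Op n k') (ψ : Op n l → Op n l')
    (m : multiplierAlgebra (cstarTensor B C)) (T : Op n (k' + l')) : Prop :=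
  ∃ Φ : multiplierAlgebra (cstarTensor B C) →⋆ₐ[ℂ] Op n (k' + l'),
    IsTensorExtension B C φ ψ Φ ∧ (∀ Ψ, IsTensorExtension B C φ ψ Ψ → Ψ = Φ) ∧ Φ m = T

end Slices

/-! ## The algebras, the quantum double and the R-matrix -/

/-- `A`: the norm closure of the left slices of `U_A`. -/
def algA (n : ℕ) (lam : ℝ) : Set (Op n 1) :=
  closure {a | ∃ ω : NormalFunctional n 1, a = leftSlice (k := 1) (l := 1) ω (UA n lam)}

/-- `Â^op`: the norm closure of the right slices of `X`. -/
def algAhatOp (n : ℕ) (lam : ℝ) : Set (Op n 1) :=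
  closure {b | ∃ ω : NormalFunctional n 1, b = rightSlice (k := 1) (l := 1) ω (Xop n lam)}

/-- `A_D`: the norm closure of the right slices of `V_D`. -/
def algAD (n : ℕ) (lam : ℝ) : Set (Op n 2) :=
  closure {x | ∃ Ω : NormalFunctional n 2, x = rightSlice (k := 2) (l := 2) Ω (VD n lam)}

/-- `Δ_D(x) = V_D^* (1 ⊗ 1 ⊗ x) V_D`. -/
def DeltaD (n : ℕ) (lam : ℝ) (x : Op n 2) : Op n 4 :=
  star (VD n lam) * leg ![2, 3] x * VD n lam

/-- `Δ_D^cop`: the comultiplication followed by the flip of the legs `1 ↔ 3`, `2 ↔ 4`. -/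
def DeltaDcop (n : ℕ) (lam : ℝ) (x : Op n 2) : Op n 4 := leg ![2, 3, 0, 1] (DeltaD n lam x)

/-- `π'(b) = b ⊗ 1`. -/
def piHat (n : ℕ) (b : Op n 1) : Op n 2 := leg ![0] b

/-- `π(a) = Z (1 ⊗ a) Z^*`. -/
def piA (n : ℕ) (lam : ℝ) (a : Op n 1) : Op n 2 :=
  Zop n lam * leg ![1] a * star (Zop n lam)

/-- `𝓡 = Z₃₄ X₁₄ Z₃₄^*`. -/
def Rmat (n : ℕ) (lam : ℝ) : Op n 4 :=
  leg ![2, 3] (Zop n lam) * leg ![0, 3] (Xop n lam) * star (leg ![2, 3] (Zop n lam))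

end QDouble

end

open QDouble

noncomputable section

namespace QDouble

/-! ## Density of elementary tensors -/

/-! Legs of 𝓗 are counted from 0 here and below; copies of 𝓗 ⊗ 𝓗 are counted from 1.

Identities. Every unitary involved acts by (Tξ)(p) = exp(L p)ⁿ e[φ p] ξ(θ p). This class (`Acts`) is
stable under products, adjoints and leg numbering, so an equality of operators follows from
pointwise equalities of L, φ and θ, which are algebra in the exponentials exp(λ rᵢ). Besides closed
forms and j² = 1, only four relations are checked in this way: the pentagon equation for X
(`pentagon_X`) and three relations between X, Y, Z, Ỹ = Z₀₁Y₁₂Z₀₁^* and X̃ = Z₁₂X₀₂Z₁₂^*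
(`X_Yt_star_Z`, `X_Yt_Y`, `Xt_X_X`). Since V_D = Ỹ₀₁₃X₀₂ and 𝓡 = X̃₀₂₃, the rest is manipulation of
words in a monoid: the pentagon equation for V = V_D (`pentagon_VD`), the relation 𝓡₁₂V₁₃V₂₃ =
V₂₃V₁₃𝓡₁₂ (`Rmat_VD_VD`), the formulas for 𝓡 conjugated by V (`Rmat_VD_left`, `Rmat_VD_right`) and
the Yang-Baxter equation (`yang_baxter`). If x is a slice of V, then by the pentagon equation Δ_D(x)
is a slice of V₁₃V₂₃ and Δ_D^cop(x) is the same slice of V₂₃V₁₃, so `Rmat_VD_VD` yields the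
intertwining property (`Rmat_DeltaD_sl`, `Rmat_mul_DeltaD`).

Algebras. Spaces of operators are multiplied in the quotient by equality up to closure. Compressing
a leg between finite rank operators K replaces an operator by its slices, a unitary next to K on all
of its legs is absorbed, and spectator legs carrying K can be removed (`FR_mul_mul_FR`,
`cle_of_FR_mul`). The pentagon equation then makes the slices of X closed under products, and
explicit antiunitaries make them selfadjoint. X is regular because its partial transpose is unitary
(`regular_X`), and regularity gives X(Â^op ⊗ A) = Â^op ⊗ A (`X_mul_slices`). Compressing V_D shows
that A_D is the closure of π(A)(Â^op ⊗ 1); it is a *-algebra because the two factors may be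
interchanged (`SL_VD`, `rightX_mul_piLeftX`). Hence 𝓡 is a multiplier of A_D ⊗ A_D
(`Rmat_mul_doubleTensor`).

Extensions. Each of π' ⊗ π, Δ_D ⊗ id and id ⊗ Δ_D is the restriction of a map T ↦ U T_f U^* defined
on all bounded operators, with U unitary. This gives existence and the values at once; uniqueness on
multipliers follows from nondegeneracy (`isTensorValue_of_hom`, `isTensorValue_conjLeg`). -/

theorem ae_eq_zero_of_forall_setIntegral_prod_eq_zero {α β : Type*} [MeasureSpace α]
    [MeasureSpace β] [SigmaFinite (volume : Measure α)] [SigmaFinite (volume : Measure β)]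
    (f : Lp ℂ 2 (volume : Measure (α × β)))
    (h : ∀ s : Set α, ∀ t : Set β, MeasurableSet s → MeasurableSet t → volume s ≠ ∞ →
      volume t ≠ ∞ → ∫ z in s ×ˢ t, f z = 0) : f =ᵐ[volume] 0 := by
  let S := spanningSets (volume : Measure α)
  let T := spanningSets (volume : Measure β)
  have hS : ∀ N, MeasurableSet (S N) := fun N => measurableSet_spanningSets _ N
  have hT : ∀ N, MeasurableSet (T N) := fun N => measurableSet_spanningSets _ N
  have key : ∀ N, ∀ᵐ z ∂volume.restrict (S N ×ˢ T N), f z = 0 := by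
    intro N
    have hfin : (volume : Measure (α × β)) (S N ×ˢ T N) ≠ ∞ := by
      rw [Measure.volume_eq_prod, Measure.prod_prod]
      exact ENNReal.mul_ne_top (measure_spanningSets_lt_top _ N).ne
        (measure_spanningSets_lt_top _ N).ne
    have hint : Integrable f (volume.restrict (S N ×ˢ T N)) :=
      integrableOn_Lp_of_measure_ne_top f (by norm_num) hfin
    have : IsFiniteMeasure ((volume : Measure (α × β)).restrict (S N ×ˢ T N)) :=
      ⟨by simpa using hfin.lt_top⟩
    -- Dynkin's argument: measurable rectangles form a π-system generating the product σ-algebra.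
    -- Restricting to a box of finite measure makes f integrable, so complements can be treated by
    -- subtraction from the integral over the box.
    refine hint.ae_eq_zero_of_forall_setIntegral_eq_zero fun E hE _ => ?_
    induction E, hE using MeasurableSpace.induction_on_inter generateFrom_prod.symm
      isPiSystem_prod with
    | empty => simp
    | basic E hE =>
      obtain ⟨s, hs, t, ht, rfl⟩ := hE
      rw [Measure.restrict_restrict (hs.prod ht), Set.prod_inter_prod]
      exact h _ _ (hs.inter (hS N)) (ht.inter (hT N))
        (measure_ne_top_of_subset Set.inter_subset_right (measure_spanningSets_lt_top _ N).ne)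
        (measure_ne_top_of_subset Set.inter_subset_right (measure_spanningSets_lt_top _ N).ne)
    | compl E hE ih =>
      have := integral_add_compl hE hint
      rw [ih (measure_lt_top _ _), zero_add] at this
      rw [this]
      exact h _ _ (hS N) (hT N) (measure_spanningSets_lt_top _ N).ne
        (measure_spanningSets_lt_top _ N).ne
    | iUnion g hd hg ih =>
      rw [integral_iUnion hg hd hint.integrableOn]
      simp only [fun i => ih i (measure_lt_top _ _), tsum_zero]
  have hmono : Monotone fun N => S N ×ˢ T N := fun a b hab =>
    Set.prod_mono (monotone_spanningSets _ hab) (monotone_spanningSets _ hab)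
  have hU : (⋃ N, S N ×ˢ T N) = Set.univ := by
    rw [Set.iUnion_prod_of_monotone (monotone_spanningSets _) (monotone_spanningSets _)]
    rw [iUnion_spanningSets, iUnion_spanningSets, Set.univ_prod_univ]
  have := (ae_restrict_iUnion_iff (μ := (volume : Measure (α × β))) (fun N => S N ×ˢ T N)
    (fun z => f z = 0)).2 key
  rwa [hU, Measure.restrict_univ] at this

section Density

variable {n : ℕ} {ι κ κ' : Type} [Fintype ι] [Fintype κ] [Fintype κ']

/-- Testing against products of indicator functions of sets of finite measure makes all integrals of
f over rectangles vanish, once f is transported to the product of the two groups of variables. -/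
theorem eq_zero_of_forall_inner_tmul (e : κ ⊕ κ' ≃ ι) (f : HS n ι)
    (h : ∀ a b, inner ℂ (tmul e a b) f = 0) : f = 0 := by
  have hmp := measurePreserving_split (n := n) e
  have hmps : MeasurePreserving (splitEquiv n e).symm volume volume :=
    MeasurePreserving.symm (splitEquiv n e) hmp
  let g : Lp ℂ 2 (volume : Measure ((κ → Pt n) × (κ' → Pt n))) :=
    Lp.compMeasurePreserving (splitEquiv n e).symm hmps f
  have hg : g =ᵐ[volume] f ∘ (splitEquiv n e).symm := Lp.coeFn_compMeasurePreserving f hmps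
  have hg0 : g =ᵐ[volume] 0 := by
    refine ae_eq_zero_of_forall_setIntegral_prod_eq_zero g fun s t hs ht hsf htf => ?_
    have h1 := h (indicatorConstLp 2 hs hsf 1) (indicatorConstLp 2 ht htf 1)
    rw [L2.inner_def] at h1
    rw [setIntegral_congr_ae (g := f ∘ (splitEquiv n e).symm) (hs.prod ht)
      (hg.mono fun z hz _ => hz), ← integral_indicator (hs.prod ht),
      ← hmp.integral_comp (splitEquiv n e).measurableEmbedding, ← h1]
    apply integral_congr_ae
    filter_upwards [coeFn_tmul e (indicatorConstLp 2 hs hsf (1 : ℂ))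
      (indicatorConstLp 2 ht htf (1 : ℂ)),
      ae_split_fst e (indicatorConstLp_coeFn (hs := hs) (hμs := hsf) (c := (1 : ℂ)) (p := 2)),
      ae_split_snd e (indicatorConstLp_coeFn (hs := ht) (hμs := htf) (c := (1 : ℂ)) (p := 2))]
      with p h2 h3 h4
    have h5 : (splitEquiv n e).symm (split n e p) = p := (splitEquiv n e).symm_apply_apply p
    rw [h2, h3, h4]
    by_cases hp1 : (split n e p).1 ∈ s <;> by_cases hp2 : (split n e p).2 ∈ t <;>
      simp [Set.indicator, hp1, hp2, h5]
  apply Lp.ext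
  have h6 := hmp.quasiMeasurePreserving.ae (hg.symm.trans hg0)
  filter_upwards [h6, Lp.coeFn_zero ℂ 2 (volume : Measure (ι → Pt n))] with p hp h0
  have h5 : (splitEquiv n e).symm (split n e p) = p := (splitEquiv n e).symm_apply_apply p
  rw [h0]
  simpa [h5] using hp

theorem span_tmul_dense (e : κ ⊕ κ' ≃ ι) :
    (Submodule.span ℂ {u : HS n ι | ∃ a b, u = tmul e a b}).topologicalClosure = ⊤ := by
  rw [Submodule.topologicalClosure_eq_top_iff, Submodule.eq_bot_iff]
  intro f hf
  refine eq_zero_of_forall_inner_tmul e f fun a b => ?_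
  exact (Submodule.mem_orthogonal _ _).1 hf _ (Submodule.subset_span ⟨a, b, rfl⟩)

/-- A closed subspace which contains the elementary tensors is everything. -/
theorem mem_of_tmul_mem (e : κ ⊕ κ' ≃ ι) {V : Submodule ℂ (HS n ι)} (hV : IsClosed (V : Set (HS n ι)))
    (h : ∀ a b, tmul e a b ∈ V) (u : HS n ι) : u ∈ V := by
  have : (Submodule.span ℂ {u : HS n ι | ∃ a b, u = tmul e a b}).topologicalClosure ≤ V :=
    Submodule.topologicalClosure_minimal _
      (Submodule.span_le.2 (by rintro _ ⟨a, b, rfl⟩; exact h a b)) hV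
  rw [span_tmul_dense] at this
  exact this trivial

theorem clm_ext_tmul {F : Type*} [NormedAddCommGroup F] [NormedSpace ℂ F] (e : κ ⊕ κ' ≃ ι)
    {S T : HS n ι →L[ℂ] F} (h : ∀ a b, S (tmul e a b) = T (tmul e a b)) : S = T := by
  ext1 u
  exact mem_of_tmul_mem e (V := LinearMap.eqLocus S.toLinearMap T.toLinearMap)
    (isClosed_eq S.continuous T.continuous) h u

theorem op_ext_inner_tmul {ι' μ μ' : Type} [Fintype ι'] [Fintype μ] [Fintype μ']
    (e : κ ⊕ κ' ≃ ι) (d : μ ⊕ μ' ≃ ι') {S T : HS n ι →L[ℂ] HS n ι'}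
    (h : ∀ a b a' b', inner ℂ (tmul d a' b') (S (tmul e a b)) =
      inner ℂ (tmul d a' b') (T (tmul e a b))) : S = T := by
  refine clm_ext_tmul e fun a b => ?_
  rw [← sub_eq_zero]
  refine eq_zero_of_forall_inner_tmul d _ fun a' b' => ?_
  rw [inner_sub_right, h, sub_self]

theorem tmulLin_tmul (e : κ ⊕ κ' ≃ ι) (a : HS n κ) (c : HS n κ') :
    tmulLin n e (a ⊗ₜ[ℂ] c) = tmul e a c := rfl

theorem tmul_add_left (e : κ ⊕ κ' ≃ ι) (a b : HS n κ) (c : HS n κ') :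
    tmul e (a + b) c = tmul e a c + tmul e b c := by
  simp only [← tmulLin_tmul, TensorProduct.add_tmul, map_add]

theorem tmul_smul_left (e : κ ⊕ κ' ≃ ι) (r : ℂ) (a : HS n κ) (c : HS n κ') :
    tmul e (r • a) c = r • tmul e a c := by
  simp only [← tmulLin_tmul, ← TensorProduct.smul_tmul', map_smul]

theorem tmul_smul_right (e : κ ⊕ κ' ≃ ι) (r : ℂ) (a : HS n κ) (c : HS n κ') :
    tmul e a (r • c) = r • tmul e a c := by
  simp only [← tmulLin_tmul, TensorProduct.tmul_smul, map_smul]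

theorem norm_tmul (e : κ ⊕ κ' ≃ ι) (a : HS n κ) (c : HS n κ') : ‖tmul e a c‖ = ‖a‖ * ‖c‖ := by
  have h := (tmulIso n e).norm_map (a ⊗ₜ c)
  rw [TensorProduct.norm_tmul] at h
  exact h

end Density

/-! ## Leg calculus -/

section LegCalculus

variable {n : ℕ} {ι κ κ' κ₂ μ μ' : Type} [Fintype ι] [Fintype κ] [Fintype κ'] [Fintype κ₂]
  [Fintype μ] [Fintype μ']

/-- The operator `ξ ↦ ξ ⊗ ζ`. -/
def cre (e : κ ⊕ κ' ≃ ι) (ζ : HS n κ') : HS n κ →L[ℂ] HS n ι :=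
  (tmulIso n e).toContinuousLinearMap.comp ((TensorProduct.mkL ℂ (HS n κ) (HS n κ')).flip ζ)

@[simp] theorem cre_apply (e : κ ⊕ κ' ≃ ι) (ζ : HS n κ') (ξ : HS n κ) :
    cre e ζ ξ = tmul e ξ ζ := rfl

/-- The same decomposition with the two parts interchanged. -/
abbrev swapE (e : κ ⊕ κ' ≃ ι) : κ' ⊕ κ ≃ ι := (Equiv.sumComm κ' κ).trans e

theorem tmul_swap (e : κ ⊕ κ' ≃ ι) (ξ : HS n κ) (ζ : HS n κ') :
    tmul (swapE e) ζ ξ = tmul e ξ ζ := by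
  apply Lp.ext
  filter_upwards [coeFn_tmul e ξ ζ, coeFn_tmul (swapE e) ζ ξ] with p h1 h2
  rw [h1, h2, mul_comm]
  rfl

theorem ampl_swap_tmul (e : κ ⊕ κ' ≃ ι) (T : HS n κ' →L[ℂ] HS n κ') (ξ : HS n κ) (ζ : HS n κ') :
    ampl (swapE e) T (tmul e ξ ζ) = tmul e ξ (T ζ) := by
  rw [← tmul_swap, ampl_tmul, tmul_swap]

theorem ampl_mul (e : κ ⊕ κ' ≃ ι) (S T : HS n κ →L[ℂ] HS n κ) :
    ampl e (S * T) = ampl e S * ampl e T :=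
  clm_ext_tmul e fun a b => by simp [ampl_tmul]

theorem ampl_one (e : κ ⊕ κ' ≃ ι) : ampl e (1 : HS n κ →L[ℂ] HS n κ) = 1 :=
  clm_ext_tmul e fun a b => by simp [ampl_tmul]

theorem ampl_add (e : κ ⊕ κ' ≃ ι) (S T : HS n κ →L[ℂ] HS n κ) :
    ampl e (S + T) = ampl e S + ampl e T :=
  clm_ext_tmul e fun a b => by simp [ampl_tmul, tmul_add_left]

theorem ampl_smul (e : κ ⊕ κ' ≃ ι) (r : ℂ) (T : HS n κ →L[ℂ] HS n κ) :
    ampl e (r • T) = r • ampl e T :=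
  clm_ext_tmul e fun a b => by simp [ampl_tmul, tmul_smul_left]

theorem ampl_star (e : κ ⊕ κ' ≃ ι) (T : HS n κ →L[ℂ] HS n κ) :
    ampl e (star T) = star (ampl e T) :=
  op_ext_inner_tmul e e fun a b a' b' => by
    rw [ContinuousLinearMap.star_eq_adjoint (ampl e T), ContinuousLinearMap.adjoint_inner_right,
      ampl_tmul, ampl_tmul, inner_tmul, inner_tmul, ContinuousLinearMap.star_eq_adjoint,
      ContinuousLinearMap.adjoint_inner_right]

/-- `T ↦ T ⊗ 1` as a homomorphism. -/
def amplHom (e : κ ⊕ κ' ≃ ι) : (HS n κ →L[ℂ] HS n κ) →⋆ₐ[ℂ] (HS n ι →L[ℂ] HS n ι) where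
  toFun := ampl e
  map_one' := ampl_one e
  map_mul' := ampl_mul e
  map_zero' := by simpa using ampl_smul e 0 (0 : HS n κ →L[ℂ] HS n κ)
  map_add' := ampl_add e
  commutes' r := by
    rw [Algebra.algebraMap_eq_smul_one, Algebra.algebraMap_eq_smul_one, ampl_smul, ampl_one]
  map_star' := ampl_star e

/-- Relabelling of legs. -/
def relabel (σ : κ ≃ κ₂) (ζ : HS n κ) : HS n κ₂ :=
  Lp.compMeasurePreserving _ (volume_measurePreserving_piCongrLeft (fun _ : κ₂ => Pt n) σ).symm ζ

theorem coeFn_relabel (σ : κ ≃ κ₂) (ζ : HS n κ) :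
    relabel σ ζ =ᵐ[volume] fun p => ζ (fun i => p (σ i)) :=
  Lp.coeFn_compMeasurePreserving ζ _

theorem tmul_relabel (e : κ ⊕ κ' ≃ ι) (d : κ ⊕ κ₂ ≃ ι) (σ : κ' ≃ κ₂)
    (hl : ∀ i, d (Sum.inl i) = e (Sum.inl i)) (hr : ∀ i, d (Sum.inr (σ i)) = e (Sum.inr i))
    (ξ : HS n κ) (ζ : HS n κ') : tmul d ξ (relabel σ ζ) = tmul e ξ ζ := by
  apply Lp.ext
  filter_upwards [coeFn_tmul e ξ ζ, coeFn_tmul d ξ (relabel σ ζ),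
    ae_split_snd d (coeFn_relabel σ ζ)] with p h1 h2 h3
  rw [h1, h2, h3]
  simp only [split, hl, hr]

/-- The labelling of the idle legs is immaterial: two labellings differ by a bijection, which only
relabels the second tensor factor. This makes leg numbering functorial. -/
theorem ampl_eq (e : κ ⊕ κ' ≃ ι) (f : κ → ι) [Fintype {i // i ∉ Set.range f}]
    (hf : Function.Injective f)
    (h : ∀ i, e (Sum.inl i) = f i) (T : HS n κ →L[ℂ] HS n κ) :
    ampl e T = ampl (legEquiv f hf) T := by
  classical
  have hmem : ∀ i : κ', e (Sum.inr i) ∉ Set.range f := by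
    rintro i ⟨k, hk⟩
    rw [← h, e.apply_eq_iff_eq] at hk
    cases hk
  let σ : κ' ≃ {i // i ∉ Set.range f} := Equiv.ofBijective (fun i => ⟨e (Sum.inr i), hmem i⟩) (by
    refine ⟨fun i j hij => by simpa using hij, fun ⟨i, hi⟩ => ?_⟩
    obtain ⟨x, rfl⟩ := e.surjective i
    cases x with
    | inl k => exact absurd ⟨k, (h k).symm⟩ hi
    | inr k => exact ⟨k, rfl⟩)
  have hl : ∀ i, legEquiv f hf (Sum.inl i) = e (Sum.inl i) := fun i => by
    rw [h]; rfl
  have hr : ∀ i, legEquiv f hf (Sum.inr (σ i)) = e (Sum.inr i) := fun i => rfl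
  refine clm_ext_tmul e fun a b => ?_
  rw [ampl_tmul, ← tmul_relabel e _ σ hl hr, ← tmul_relabel e _ σ hl hr, ampl_tmul]

/-- Associativity of elementary tensors. -/
theorem tmul_assoc (e : κ ⊕ κ' ≃ ι) (d : μ ⊕ μ' ≃ κ) (ξ : HS n μ) (ζ : HS n μ') (χ : HS n κ') :
    tmul e (tmul d ξ ζ) χ =
      tmul ((Equiv.sumAssoc μ μ' κ').symm.trans ((Equiv.sumCongr d (Equiv.refl κ')).trans e)) ξ
        (tmul (Equiv.refl (μ' ⊕ κ')) ζ χ) := by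
  apply Lp.ext
  filter_upwards [coeFn_tmul e (tmul d ξ ζ) χ, ae_split_fst e (coeFn_tmul d ξ ζ),
    coeFn_tmul ((Equiv.sumAssoc μ μ' κ').symm.trans ((Equiv.sumCongr d (Equiv.refl κ')).trans e)) ξ
        (tmul (Equiv.refl (μ' ⊕ κ')) ζ χ),
    ae_split_snd ((Equiv.sumAssoc μ μ' κ').symm.trans
      ((Equiv.sumCongr d (Equiv.refl κ')).trans e)) (coeFn_tmul (Equiv.refl (μ' ⊕ κ')) ζ χ)]
    with p h1 h2 h3 h4
  rw [h1, h2, h3, h4, mul_assoc]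
  rfl

theorem ampl_ampl (e : κ ⊕ κ' ≃ ι) (d : μ ⊕ μ' ≃ κ) (T : HS n μ →L[ℂ] HS n μ) :
    ampl e (ampl d T) =
      ampl ((Equiv.sumAssoc μ μ' κ').symm.trans ((Equiv.sumCongr d (Equiv.refl κ')).trans e)) T := by
  refine clm_ext_tmul e fun u χ => ?_
  have : (ampl e (ampl d T)).comp (cre e χ) = (ampl ((Equiv.sumAssoc μ μ' κ').symm.trans
      ((Equiv.sumCongr d (Equiv.refl κ')).trans e)) T).comp (cre e χ) := by
    refine clm_ext_tmul d fun ξ ζ => ?_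
    simp only [ContinuousLinearMap.comp_apply, cre_apply, ampl_tmul]
    rw [tmul_assoc, tmul_assoc, ampl_tmul]
  exact congrArg (fun S => S u) this

theorem commute_ampl (e : κ ⊕ κ' ≃ ι) (S : HS n κ →L[ℂ] HS n κ) (T : HS n κ' →L[ℂ] HS n κ') :
    Commute (ampl e S) (ampl (swapE e) T) :=
  clm_ext_tmul e fun a b => by
    simp only [mul_apply_eq_comp, ampl_swap_tmul, ampl_tmul]

/-- Leg numbering for arbitrary index sets. -/
def gleg (f : κ → ι) [Fintype {i // i ∉ Set.range f}] (hf : Function.Injective f)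
    (T : HS n κ →L[ℂ] HS n κ) : HS n ι →L[ℂ] HS n ι := ampl (legEquiv f hf) T

theorem gleg_gleg (f : κ → ι) [Fintype {i // i ∉ Set.range f}] (hf : Function.Injective f)
    (g : μ → κ) [Fintype {i // i ∉ Set.range g}] (hg : Function.Injective g)
    [Fintype {i // i ∉ Set.range (f ∘ g)}] (T : HS n μ →L[ℂ] HS n μ) :
    gleg f hf (gleg g hg T) = gleg (f ∘ g) (hf.comp hg) T := by
  rw [gleg, gleg, ampl_ampl, ampl_eq _ (f ∘ g) (hf.comp hg)]
  · rfl
  · intro i; rfl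

/-- As the ranges are disjoint, g factors through the complement of the range of f, so the two
operators act on different factors of one decomposition. -/
theorem commute_gleg (f : κ → ι) [Fintype {i // i ∉ Set.range f}] (hf : Function.Injective f)
    (g : μ → ι) [Fintype {i // i ∉ Set.range g}]
    (hg : Function.Injective g) (h : ∀ i j, f i ≠ g j) (S : HS n κ →L[ℂ] HS n κ)
    (T : HS n μ →L[ℂ] HS n μ) : Commute (gleg f hf S) (gleg g hg T) := by
  classical
  let e := legEquiv f hf
  let g' : μ → {i // i ∉ Set.range f} := fun j => ⟨g j, by rintro ⟨i, hi⟩; exact h i j hi⟩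
  have hg' : Function.Injective g' := fun a b hab => hg (by simpa [g'] using hab)
  let _ : Fintype {i // i ∉ Set.range g'} := Fintype.ofFinite _
  have : gleg g hg T = ampl (swapE e) (gleg g' hg' T) := by
    rw [gleg, gleg, ampl_ampl]
    exact (ampl_eq _ g hg (fun i => rfl) T).symm
  rw [this]
  exact commute_ampl e S _

end LegCalculus

/-! ### Leg numbering on 𝓗^{⊗ m} as a unital *-homomorphism. -/

section Legs

variable {n k l m m' : ℕ}

theorem ampl_eq_leg {l : ℕ} (d : Fin k ⊕ Fin l ≃ Fin m) (f : Fin k → Fin m)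
    (h : ∀ i, d (Sum.inl i) = f i) (hf : Function.Injective f) (T : Op n k) :
    ampl d T = leg f T hf := ampl_eq d f hf h T

theorem leg_leg (f : Fin m → Fin m') (g : Fin k → Fin m) (T : Op n k) (hg : Function.Injective g)
    (hf : Function.Injective f) : leg f (leg g T hg) hf = leg (f ∘ g) T (hf.comp hg) :=
  gleg_gleg f hf g hg T

theorem leg_mul (f : Fin k → Fin m) (S T : Op n k) (hf : Function.Injective f) :
    leg f (S * T) hf = leg f S hf * leg f T hf := ampl_mul _ S T

theorem leg_star (f : Fin k → Fin m) (T : Op n k) (hf : Function.Injective f) :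
    leg f (star T) hf = star (leg f T hf) := ampl_star _ T

theorem leg_one (f : Fin k → Fin m) (hf : Function.Injective f) :
    leg f (1 : Op n k) hf = 1 := ampl_one _

theorem leg_commute {f : Fin k → Fin m} {g : Fin l → Fin m} (S : Op n k) (T : Op n l)
    (hf : Function.Injective f) (hg : Function.Injective g) (h : ∀ i j, f i ≠ g j) :
    Commute (leg f S hf) (leg g T hg) := commute_gleg f hf g hg h S T

/-- Leg numbering as a homomorphism. -/
def legHom (n : ℕ) (f : Fin k → Fin m) (hf : Function.Injective f := by decide) :
    Op n k →⋆ₐ[ℂ] Op n m := amplHom (legEquiv f hf)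

theorem legHom_apply (f : Fin k → Fin m) (T : Op n k) (hf : Function.Injective f) :
    legHom n f hf T = leg f T hf := rfl

theorem leg_mem_unitary {f : Fin k → Fin m} {T : Op n k} (hT : T ∈ unitary (Op n k))
    (hf : Function.Injective f) : leg f T hf ∈ unitary (Op n m) :=
  Unitary.map_mem (legHom n f hf) hT

theorem opTensor_eq (S : Op n k) (T : Op n l) (h1 : Function.Injective (Fin.castAdd l : Fin k → _))
    (h2 : Function.Injective (Fin.natAdd k : Fin l → _)) :
    opTensor S T = leg (Fin.castAdd l) S h1 * leg (Fin.natAdd k) T h2 := by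
  rw [opTensor, ampl_eq_leg _ (Fin.castAdd l) (fun i => rfl) h1,
    ampl_eq_leg _ (Fin.natAdd k) (fun i => rfl) h2]

end Legs

/-! ## Calculus of weighted composition operators -/

section Weighted

variable {α : Type*} [MeasureSpace α] {c d : α → ℂ} {θ τ : α → α}

theorem coeFn_weightedComp (h : IsWeight c θ) (ξ : Lp ℂ 2 (volume : Measure α)) :
    weightedComp h ξ =ᵐ[volume] fun p => c p * ξ (θ p) :=
  MemLp.coeFn_toLp (h.memLp ξ)

theorem IsWeight.comp (h : IsWeight c θ) (h' : IsWeight d τ) :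
    IsWeight (fun p => c p * d (θ p)) (fun p => τ (θ p)) where
  measurable_weight := h.measurable_weight.mul (h'.measurable_weight.comp h.measurable_map)
  measurable_map := h'.measurable_map.comp h.measurable_map
  ne_zero p := mul_ne_zero (h.ne_zero _) (h'.ne_zero _)
  lintegral_eq f hf := by
    rw [← h'.lintegral_eq f hf, ← h.lintegral_eq (fun p => ‖d p‖ₑ ^ 2 * f (τ p))
      ((h'.measurable_weight.enorm.pow_const 2).mul (hf.comp h'.measurable_map))]
    simp only [enorm_mul, mul_pow, mul_assoc]

theorem weightedComp_mul (h : IsWeight c θ) (h' : IsWeight d τ) :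
    weightedComp h * weightedComp h' = weightedComp (h.comp h') := by
  ext1 ξ
  apply Lp.ext
  filter_upwards [coeFn_weightedComp h (weightedComp h' ξ), coeFn_weightedComp (h.comp h') ξ,
    h.quasi.ae (coeFn_weightedComp h' ξ)] with p h1 h2 h3
  rw [mul_apply_eq_comp, h1, h2, h3, mul_assoc]

theorem weightedComp_eq_one (h : IsWeight c θ) (hc : ∀ p, c p = 1) (hθ : ∀ p, θ p = p) :
    weightedComp h = 1 := by
  ext1 ξ
  apply Lp.ext
  filter_upwards [coeFn_weightedComp h ξ] with p h1
  rw [h1, hc, hθ, one_mul]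
  rfl

theorem norm_weightedComp (h : IsWeight c θ) (ξ : Lp ℂ 2 (volume : Measure α)) :
    ‖weightedComp h ξ‖ = ‖ξ‖ := by
  rw [Lp.norm_def, Lp.norm_def, eLpNorm_congr_ae (coeFn_weightedComp h ξ), h.eLpNorm_eq]

theorem star_weightedComp_mul_self (h : IsWeight c θ) :
    star (weightedComp h) * weightedComp h = 1 := by
  rw [ContinuousLinearMap.star_eq_adjoint]
  exact (ContinuousLinearMap.norm_map_iff_adjoint_comp_self _).1 (norm_weightedComp h)

/-- The inverse of a weighted change of variables is one. -/
theorem IsWeight.inverse (h : IsWeight c θ) (hτ : Measurable τ) (h2 : ∀ p, τ (θ p) = p) :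
    IsWeight (fun p => (c (τ p))⁻¹) τ where
  measurable_weight := (h.measurable_weight.comp hτ).inv
  measurable_map := hτ
  ne_zero p := inv_ne_zero (h.ne_zero _)
  lintegral_eq f hf := by
    have := h.lintegral_eq (fun p => ‖(c (τ p))⁻¹‖ₑ ^ 2 * f (τ p)) ((((h.measurable_weight.comp hτ).inv).enorm.pow_const 2).mul
      (hf.comp hτ))
    rw [← this]
    congr 1; ext p
    rw [h2, ← mul_assoc, ← mul_pow, ← enorm_mul, mul_inv_cancel₀ (h.ne_zero p)]
    simp

/-- For an isometry, a right inverse equals the adjoint. Hence only the one-sided relation τ ∘ θ =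
id has to be known. -/
theorem star_weightedComp (h : IsWeight c θ) (hτ : Measurable τ) (h2 : ∀ p, τ (θ p) = p) :
    star (weightedComp h) = weightedComp (h.inverse hτ h2) := by
  have h3 : weightedComp h * weightedComp (h.inverse hτ h2) = 1 := by
    rw [weightedComp_mul]
    exact weightedComp_eq_one _ (fun p => by rw [h2, mul_inv_cancel₀ (h.ne_zero p)]) h2
  calc star (weightedComp h)
      = star (weightedComp h) * (weightedComp h * weightedComp (h.inverse hτ h2)) := by
        rw [h3, mul_one]
    _ = weightedComp (h.inverse hτ h2) := by
        rw [← mul_assoc, star_weightedComp_mul_self, one_mul]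

theorem weightedComp_mem_unitary (h : IsWeight c θ) (hτ : Measurable τ)
    (h2 : ∀ p, τ (θ p) = p) : weightedComp h ∈ unitary _ := by
  refine ⟨star_weightedComp_mul_self h, ?_⟩
  rw [star_weightedComp h hτ h2, weightedComp_mul]
  exact weightedComp_eq_one _ (fun p => by rw [h2, mul_inv_cancel₀ (h.ne_zero p)]) h2

theorem weightedComp_congr (h : IsWeight c θ) (h' : IsWeight d τ) (h1 : ∀ p, c p = d p)
    (h2 : ∀ p, θ p = τ p) : weightedComp h = weightedComp h' := by
  obtain rfl : c = d := funext h1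
  obtain rfl : θ = τ := funext h2
  rfl

/-- Change of variables in Bochner integrals. -/
theorem IsWeight.integral_eq (h : IsWeight c θ) {f : α → ℂ}
    (hf : AEStronglyMeasurable f volume) :
    ∫ p, ((‖c p‖ ^ 2 : ℝ) : ℂ) * f (θ p) = ∫ p, f p := by
  have hm : Measurable fun p => ‖c p‖₊ ^ 2 := h.measurable_weight.nnnorm.pow_const 2
  -- The weight condition, tested on indicators, says that θ pushes |c|² dp forward to dp; the
  -- Bochner formula then follows from those for images and densities.
  have hmap : Measure.map θ (volume.withDensity fun p => ((‖c p‖₊ ^ 2 : NNReal) : ℝ≥0∞)) =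
      volume := by
    ext s hs
    rw [Measure.map_apply h.measurable_map hs, withDensity_apply _ (h.measurable_map hs),
      ← lintegral_indicator_one hs, ← h.lintegral_eq _ (measurable_one.indicator hs),
      ← lintegral_indicator (h.measurable_map hs)]
    congr 1; ext p
    by_cases hp : θ p ∈ s <;> simp [Set.indicator, hp, enorm_eq_nnnorm]
  conv_rhs => rw [← hmap]
  rw [integral_map h.measurable_map.aemeasurable (by rwa [hmap]),
    integral_withDensity_eq_integral_smul hm]
  rfl

end Weighted

/-! ### Weighted composition operators acting on some of the legs. -/

section Legs

variable {n : ℕ} {ι κ κ' : Type} [Fintype ι] [Fintype κ] [Fintype κ']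

/-- Tonelli: with the variables of the idle legs frozen, this is the original change of variables.
-/
theorem IsWeight.onLegs (e : κ ⊕ κ' ≃ ι) {c : (κ → Pt n) → ℂ} {θ : (κ → Pt n) → (κ → Pt n)}
    (h : IsWeight c θ) (Θ : (ι → Pt n) → ι → Pt n)
    (hΘ : ∀ p, split n e (Θ p) = (θ (split n e p).1, (split n e p).2)) :
    IsWeight (fun p => c (split n e p).1) Θ := by
  have hmp := measurePreserving_split (n := n) e
  have hΘm : Θ = fun p => (splitEquiv n e).symm (θ (split n e p).1, (split n e p).2) := by
    funext p
    rw [← hΘ]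
    exact ((splitEquiv n e).symm_apply_apply _).symm
  refine ⟨h.measurable_weight.comp (measurable_fst.comp hmp.measurable), ?_, fun p => h.ne_zero _,
    fun f hf => ?_⟩
  · rw [hΘm]
    exact (splitEquiv n e).symm.measurable.comp
      ((h.measurable_map.comp (measurable_fst.comp hmp.measurable)).prodMk
        (measurable_snd.comp hmp.measurable))
  · have hg : Measurable fun z => f ((splitEquiv n e).symm z) :=
      hf.comp (splitEquiv n e).symm.measurable
    have h1 : ∀ p, f p = (fun z => f ((splitEquiv n e).symm z)) (QDouble.split n e p) := fun p =>
      congrArg f ((splitEquiv n e).symm_apply_apply p).symm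
    have hG : Measurable fun z : (κ → Pt n) × (κ' → Pt n) =>
        ‖c z.1‖ₑ ^ 2 * f ((splitEquiv n e).symm (θ z.1, z.2)) :=
      ((h.measurable_weight.comp measurable_fst).enorm.pow_const 2).mul
        (hg.comp ((h.measurable_map.comp measurable_fst).prodMk measurable_snd))
    simp_rw [hΘm]
    rw [hmp.lintegral_comp hG]
    conv_rhs => rw [lintegral_congr h1, hmp.lintegral_comp hg]
    rw [Measure.volume_eq_prod, lintegral_prod_symm' _ hG, lintegral_prod_symm' _ hg]
    congr 1; ext b
    exact h.lintegral_eq (fun a => f ((splitEquiv n e).symm (a, b)))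
      (hg.comp (measurable_id.prodMk measurable_const))

theorem ampl_weightedComp (e : κ ⊕ κ' ≃ ι) {c : (κ → Pt n) → ℂ}
    {θ : (κ → Pt n) → (κ → Pt n)} (h : IsWeight c θ) (Θ : (ι → Pt n) → ι → Pt n)
    (hΘ : ∀ p, split n e (Θ p) = (θ (split n e p).1, (split n e p).2)) :
    ampl e (weightedComp h) = weightedComp (h.onLegs e Θ hΘ) := by
  refine clm_ext_tmul e fun a b => ?_
  rw [ampl_tmul]
  apply Lp.ext
  filter_upwards [coeFn_tmul e (weightedComp h a) b, ae_split_fst e (coeFn_weightedComp h a),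
    coeFn_weightedComp (h.onLegs e Θ hΘ) (tmul e a b),
    (h.onLegs e Θ hΘ).quasi.ae (coeFn_tmul e a b)] with p h1 h2 h3 h4
  rw [h1, h2, h3, h4, hΘ, mul_assoc]

end Legs

/-! ## Operators given by a dilation weight, a phase and a change of variables -/

/-- `(T ξ)(p) = exp(L p)ⁿ e[φ p] ξ(θ p)`. -/
def Acts {n k : ℕ} (T : Op n k) (L φ : (Fin k → Pt n) → ℝ)
    (θ : (Fin k → Pt n) → Fin k → Pt n) : Prop :=
  ∃ h : IsWeight (fun p => ((Real.exp (L p) ^ n : ℝ) : ℂ) * expTwoPiI (φ p)) θ,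
    T = weightedComp h

theorem expTwoPiI_add (s t : ℝ) : expTwoPiI (s + t) = expTwoPiI s * expTwoPiI t := by
  rw [expTwoPiI, expTwoPiI, expTwoPiI, ← Complex.exp_add]
  congr 1; push_cast; ring

theorem expTwoPiI_zero : expTwoPiI 0 = 1 := by simp [expTwoPiI]

theorem expTwoPiI_neg (t : ℝ) : expTwoPiI (-t) = (expTwoPiI t)⁻¹ := by
  rw [expTwoPiI, expTwoPiI, ← Complex.exp_neg]
  congr 1; push_cast; ring

theorem conj_expTwoPiI (t : ℝ) : starRingEnd ℂ (expTwoPiI t) = expTwoPiI (-t) := by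
  rw [expTwoPiI, expTwoPiI, ← Complex.exp_conj]
  congr 1
  simp [map_ofNat]

section Acts

variable {n k m : ℕ} {S T : Op n k} {L φ M ψ : (Fin k → Pt n) → ℝ}
  {θ τ : (Fin k → Pt n) → Fin k → Pt n}

/-- The left factor T substitutes θ p into the data of S; logarithmic weights and phases add, while
the substitutions compose in the reversed order. -/
theorem Acts.mul (hT : Acts T L φ θ) (hS : Acts S M ψ τ) :
    Acts (T * S) (fun p => L p + M (θ p)) (fun p => φ p + ψ (θ p)) (fun p => τ (θ p)) := by
  obtain ⟨h, rfl⟩ := hT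
  obtain ⟨h', rfl⟩ := hS
  have : (fun p => ((Real.exp (L p + M (θ p)) ^ n : ℝ) : ℂ) * expTwoPiI (φ p + ψ (θ p))) =
      fun p => ((Real.exp (L p) ^ n : ℝ) : ℂ) * expTwoPiI (φ p) *
        (((Real.exp (M (θ p)) ^ n : ℝ) : ℂ) * expTwoPiI (ψ (θ p))) := by
    funext p
    rw [Real.exp_add, expTwoPiI_add, mul_pow]
    push_cast
    ring
  unfold Acts
  rw [this]
  exact ⟨h.comp h', weightedComp_mul h h'⟩

theorem Acts.congr (hT : Acts T L φ θ) (h1 : ∀ p, L p = M p) (h2 : ∀ p, φ p = ψ p)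
    (h3 : ∀ p, θ p = τ p) : Acts T M ψ τ := by
  obtain rfl : L = M := funext h1
  obtain rfl : φ = ψ := funext h2
  obtain rfl : θ = τ := funext h3
  exact hT

/-- The device by which operator identities become identities between real functions. -/
theorem Acts.unique (hT : Acts T L φ θ) (hS : Acts S M ψ τ) (h1 : ∀ p, L p = M p)
    (h2 : ∀ p, φ p = ψ p) (h3 : ∀ p, θ p = τ p) : T = S := by
  obtain ⟨h, rfl⟩ := hT
  obtain ⟨h', rfl⟩ := hS
  exact weightedComp_congr h h' (fun p => by rw [h1, h2]) h3

theorem Acts.star (hT : Acts T L φ θ) (hτ : Measurable τ) (h2 : ∀ p, τ (θ p) = p) :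
    Acts (star T) (fun p => -L (τ p)) (fun p => -φ (τ p)) τ := by
  obtain ⟨h, rfl⟩ := hT
  have : (fun p => ((Real.exp (-L (τ p)) ^ n : ℝ) : ℂ) * expTwoPiI (-φ (τ p))) =
      fun p => (((Real.exp (L (τ p)) ^ n : ℝ) : ℂ) * expTwoPiI (φ (τ p)))⁻¹ := by
    funext p
    rw [Real.exp_neg, expTwoPiI_neg, mul_inv, inv_pow]
    push_cast
    rfl
  unfold Acts
  rw [this]
  exact ⟨h.inverse hτ h2, star_weightedComp h hτ h2⟩

theorem Acts.mem_unitary (hT : Acts T L φ θ) (hτ : Measurable τ) (h2 : ∀ p, τ (θ p) = p) :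
    T ∈ unitary (Op n k) := by
  obtain ⟨h, rfl⟩ := hT
  exact weightedComp_mem_unitary h hτ h2

theorem Acts.leg (hT : Acts T L φ θ) {f : Fin k → Fin m} (hf : Function.Injective f)
    {L' φ' : (Fin m → Pt n) → ℝ} {Θ : (Fin m → Pt n) → Fin m → Pt n}
    (h1 : ∀ p, L' p = L (fun i => p (f i))) (h2 : ∀ p, φ' p = φ (fun i => p (f i)))
    (h3 : ∀ p i, Θ p (f i) = θ (fun i => p (f i)) i)
    (h4 : ∀ p j, (∀ i, f i ≠ j) → Θ p j = p j) : Acts (leg f T hf) L' φ' Θ := by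
  obtain ⟨h, rfl⟩ := hT
  obtain rfl : L' = fun p => L (fun i => p (f i)) := funext h1
  obtain rfl : φ' = fun p => φ (fun i => p (f i)) := funext h2
  have hΘ : ∀ p, QDouble.split n (legEquiv f hf) (Θ p) =
      (θ (QDouble.split n (legEquiv f hf) p).1, (QDouble.split n (legEquiv f hf) p).2) := by
    intro p
    refine Prod.ext (funext fun i => h3 p i) (funext fun j => ?_)
    exact h4 p j.1 fun i hi => j.2 ⟨i, hi⟩
  exact ⟨h.onLegs _ Θ hΘ, ampl_weightedComp _ h Θ hΘ⟩

end Acts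

theorem leg_leg_two {n k m : ℕ} (f : Fin k → Fin m) (i j : Fin k) (T : Op n 2)
    (hg : Function.Injective ![i, j]) (hf : Function.Injective f) :
    leg f (leg ![i, j] T hg) hf = leg ![f i, f j] T (by
      have : f ∘ ![i, j] = ![f i, f j] := by funext l; fin_cases l <;> rfl
      exact this ▸ hf.comp hg) := by
  have : f ∘ ![i, j] = ![f i, f j] := by funext l; fin_cases l <;> rfl
  rw [leg_leg]
  congr 1

theorem leg_leg_three {n k m : ℕ} (f : Fin k → Fin m) (i j l : Fin k) (T : Op n 3)
    (hg : Function.Injective ![i, j, l]) (hf : Function.Injective f) :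
    leg f (leg ![i, j, l] T hg) hf = leg ![f i, f j, f l] T (by
      have : f ∘ ![i, j, l] = ![f i, f j, f l] := by funext l; fin_cases l <;> rfl
      exact this ▸ hf.comp hg) := by
  have : f ∘ ![i, j, l] = ![f i, f j, f l] := by funext l; fin_cases l <;> rfl
  rw [leg_leg]
  congr 1

theorem leg_leg_four {n k m : ℕ} (f : Fin k → Fin m) (i j l o : Fin k) (T : Op n 4)
    (hg : Function.Injective ![i, j, l, o]) (hf : Function.Injective f) :
    leg f (leg ![i, j, l, o] T hg) hf = leg ![f i, f j, f l, f o] T (by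
      have : f ∘ ![i, j, l, o] = ![f i, f j, f l, f o] := by funext l; fin_cases l <;> rfl
      exact this ▸ hf.comp hg) := by
  have : f ∘ ![i, j, l, o] = ![f i, f j, f l, f o] := by funext l; fin_cases l <;> rfl
  rw [leg_leg]
  congr 1

/-! ## The phases -/

/-- With exp(2λr) written as a square, all phases become rational expressions in λ, the exp(λ rᵢ)
and the values of β, so that clearing denominators decides their equality. The case λ = 0 is
polynomial and is treated apart. -/
theorem eta_of_ne {lam : ℝ} (h : lam ≠ 0) (r : ℝ) :
    eta lam r = (Real.exp (lam * r) ^ 2 - 1) / (2 * lam) := by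
  have : Real.exp (2 * lam * r) = Real.exp (lam * r) ^ 2 := by
    rw [← Real.exp_nat_mul]; congr 1; push_cast; ring
  rw [eta, if_neg h, this]

theorem eta_zero_left (r : ℝ) : eta 0 r = r := by simp [eta]

section Beta

variable {n : ℕ} (x y z : Fin n → ℝ) (a : ℝ)

theorem beta_add_left : beta (x + y) z = beta x z + beta y z := by
  simp [beta, add_mul, Finset.sum_add_distrib]

theorem beta_add_right : beta x (y + z) = beta x y + beta x z := by
  simp [beta, mul_add, Finset.sum_add_distrib]

theorem beta_smul_left : beta (a • x) y = a * beta x y := by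
  simp [beta, Finset.mul_sum, mul_assoc]

theorem beta_smul_right : beta x (a • y) = a * beta x y := by
  simp [beta, Finset.mul_sum, mul_left_comm]

theorem beta_neg_left : beta (-x) y = -beta x y := by
  simp [beta]

theorem beta_neg_right : beta x (-y) = -beta x y := by
  simp [beta]

theorem beta_sub_left : beta (x - y) z = beta x z - beta y z := by
  simp [sub_eq_add_neg, beta_add_left, beta_neg_left]

theorem beta_sub_right : beta x (y - z) = beta x y - beta x z := by
  simp [sub_eq_add_neg, beta_add_right, beta_neg_right]

end Beta

theorem Acts.leg_one {n m : ℕ} {T : Op n 1} {L φ : (Fin 1 → Pt n) → ℝ}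
    {θ : (Fin 1 → Pt n) → Fin 1 → Pt n} (hT : Acts T L φ θ) (i : Fin m)
    (hf : Function.Injective ![i]) :
    Acts (QDouble.leg ![i] T hf) (fun p => L ![p i]) (fun p => φ ![p i])
      (fun p l => if l = i then θ ![p i] 0 else p l) := by
  have h : ∀ p : Fin m → Pt n, (fun l => p ((![i] : Fin 1 → Fin m) l)) = ![p i] := fun p => by
    funext l; fin_cases l; rfl
  refine hT.leg hf (fun p => by rw [h]) (fun p => by rw [h]) (fun p l => ?_) (fun p l hl => ?_)
  · fin_cases l
    exact (if_pos rfl).trans (by rw [h]; rfl)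
  · exact if_neg fun h => hl 0 h.symm

theorem Acts.leg_two {n m : ℕ} {T : Op n 2} {L φ : (Fin 2 → Pt n) → ℝ}
    {θ : (Fin 2 → Pt n) → Fin 2 → Pt n} (hT : Acts T L φ θ) (i j : Fin m)
    (hf : Function.Injective ![i, j]) :
    Acts (QDouble.leg ![i, j] T hf) (fun p => L ![p i, p j]) (fun p => φ ![p i, p j])
      (fun p l => if l = i then θ ![p i, p j] 0 else if l = j then θ ![p i, p j] 1 else p l) := by
  have h : ∀ p : Fin m → Pt n, (fun l => p ((![i, j] : Fin 2 → Fin m) l)) = ![p i, p j] :=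
    fun p => by funext l; fin_cases l <;> rfl
  have hij : j ≠ i := fun hji => by
    have := @hf 0 1 (by simp [hji])
    simp at this
  refine hT.leg hf (fun p => by rw [h]) (fun p => by rw [h]) (fun p l => ?_) (fun p l hl => ?_)
  · fin_cases l
    · exact (if_pos rfl).trans (by rw [h]; rfl)
    · exact ((if_neg hij).trans (if_pos rfl)).trans (by rw [h]; rfl)
  · exact (if_neg fun h => hl 0 h.symm).trans (if_neg fun h => hl 1 h.symm)

/-! ## Closed forms -/

theorem Acts.leg_three {n m : ℕ} {T : Op n 3} {L φ : (Fin 3 → Pt n) → ℝ}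
    {θ : (Fin 3 → Pt n) → Fin 3 → Pt n} (hT : Acts T L φ θ) (i j k : Fin m)
    (hf : Function.Injective ![i, j, k]) :
    Acts (QDouble.leg ![i, j, k] T hf) (fun p => L ![p i, p j, p k]) (fun p => φ ![p i, p j, p k])
      (fun p l => if l = i then θ ![p i, p j, p k] 0 else if l = j then θ ![p i, p j, p k] 1 else
        if l = k then θ ![p i, p j, p k] 2 else p l) := by
  have h : ∀ p : Fin m → Pt n, (fun l => p ((![i, j, k] : Fin 3 → Fin m) l)) = ![p i, p j, p k] :=
    fun p => by funext l; fin_cases l <;> rfl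
  have hij : j ≠ i := fun hji => by
    have := @hf 0 1 (by simp [hji])
    simp at this
  have hik : k ≠ i := fun hji => by
    have := @hf 0 2 (by simp [hji])
    simp at this
  have hjk : k ≠ j := fun hji => by
    have := @hf 1 2 (by simp [hji])
    simp at this
  refine hT.leg hf (fun p => by rw [h]) (fun p => by rw [h]) (fun p l => ?_) (fun p l hl => ?_)
  · fin_cases l
    · exact (if_pos rfl).trans (by rw [h]; rfl)
    · exact ((if_neg hij).trans (if_pos rfl)).trans (by rw [h]; rfl)
    · exact ((if_neg hik).trans ((if_neg hjk).trans (if_pos rfl))).trans (by rw [h]; rfl)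
  · exact (if_neg fun h => hl 0 h.symm).trans
      ((if_neg fun h => hl 1 h.symm).trans (if_neg fun h => hl 2 h.symm))

theorem acts_one (n k : ℕ) : Acts (1 : Op n k) (fun _ => 0) (fun _ => 0) (fun p => p) := by
  have h : IsWeight (fun _ : Fin k → Pt n => ((Real.exp 0 ^ n : ℝ) : ℂ) * expTwoPiI 0)
      (fun p => p) := by
    refine ⟨by fun_prop, by fun_prop, fun p => ?_, fun f _ => ?_⟩ <;> simp [expTwoPiI_zero]
  exact ⟨h, (weightedComp_eq_one h (fun p => by simp [expTwoPiI_zero]) (fun p => rfl)).symm⟩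

set_option linter.unusedSimpArgs false

section Closed

variable (n : ℕ) (lam : ℝ)

theorem acts_UA : Acts (UA n lam) (fun p => -lam * (p 1).2.2)
    (fun p => -(eta lam (p 1).2.2 * beta (Real.exp (-lam * (p 1).2.2) • (p 0).1)
        ((p 1).2.1 - Real.exp (-lam * (p 1).2.2) • (p 0).2.1)))
    (fun p => ![(Real.exp (-lam * (p 1).2.2) • (p 0).1, Real.exp (-lam * (p 1).2.2) • (p 0).2.1,
        (p 0).2.2 + (p 1).2.2),
      ((p 1).1 - Real.exp (-lam * (p 1).2.2) • (p 0).1,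
        (p 1).2.1 - Real.exp (-lam * (p 1).2.2) • (p 0).2.1, (p 1).2.2)]) :=
  ⟨isWeight_U n lam, rfl⟩

theorem acts_jop : Acts (jop n lam) (fun p => lam * (p 0).2.2)
    (fun p => -(eta lam (p 0).2.2 * beta (p 0).1 (p 0).2.1))
    (fun p => ![(-(Real.exp (lam * (p 0).2.2) • (p 0).1),
      -(Real.exp (lam * (p 0).2.2) • (p 0).2.1), -(p 0).2.2)]) :=
  ⟨isWeight_j n lam, rfl⟩

theorem jop_mul_self : jop n lam * jop n lam = 1 := by
  refine ((acts_jop n lam).mul (acts_jop n lam)).unique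
    (acts_one n 1) (fun p => ?_) (fun p => ?_) (fun p => ?_)
  · simp
  · have := (Real.exp_pos (lam * (p 0).2.2)).ne'
    rcases eq_or_ne lam 0 with rfl | hl
    · simp [eta_zero_left, beta_neg_left, beta_neg_right]
    · simp [eta_of_ne hl, beta_smul_left, beta_smul_right, beta_neg_left, beta_neg_right,
        Real.exp_neg]
      field_simp
      ring
  · have := (Real.exp_pos (lam * (p 0).2.2)).ne'
    funext i
    fin_cases i
    refine Prod.ext (funext fun i => ?_) (Prod.ext (funext fun i => ?_) ?_) <;>
    simp [Real.exp_neg]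

theorem jop_mem_unitary : jop n lam ∈ unitary (Op n 1) := by
  obtain ⟨h, hj⟩ := acts_jop n lam
  have h1 : star (jop n lam) * jop n lam = 1 := star_weightedComp_mul_self (isWeight_j n lam)
  have h2 : star (jop n lam) = jop n lam := by
    calc star (jop n lam) = star (jop n lam) * (jop n lam * jop n lam) := by
          rw [jop_mul_self, mul_one]
      _ = jop n lam := by rw [← mul_assoc, h1, one_mul]
  exact ⟨h1, by rw [h2, jop_mul_self]⟩

theorem star_jop : star (jop n lam) = jop n lam := by
  calc star (jop n lam) = star (jop n lam) * (jop n lam * jop n lam) := by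
        rw [jop_mul_self, mul_one]
    _ = jop n lam := by rw [← mul_assoc, (jop_mem_unitary n lam).1, one_mul]

/-- The phase of `X`. -/
def phX (n : ℕ) (lam : ℝ) (p : Fin 2 → Pt n) : ℝ :=
  -(eta lam (p 1).2.2 * beta (Real.exp (lam * (p 0).2.2) • (p 0).1)
    ((p 1).2.1 - Real.exp (lam * (p 0).2.2) • (p 0).2.1))

/-- The change of variables of `X`. -/
def mapX (n : ℕ) (lam : ℝ) (p : Fin 2 → Pt n) : Fin 2 → Pt n :=
  ![((p 0).1, (p 0).2.1, (p 0).2.2 + (p 1).2.2),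
    ((p 1).1 - Real.exp (lam * (p 0).2.2) • (p 0).1,
      (p 1).2.1 - Real.exp (lam * (p 0).2.2) • (p 0).2.1, (p 1).2.2)]

/-- The phase of `Y`. -/
def phY (n : ℕ) (lam : ℝ) (p : Fin 2 → Pt n) : ℝ :=
  eta lam (p 0).2.2 * beta (Real.exp (lam * ((p 1).2.2 - (p 0).2.2)) • (p 1).1) (p 0).2.1

/-- The change of variables of `Y`. -/
def mapY (n : ℕ) (lam : ℝ) (p : Fin 2 → Pt n) : Fin 2 → Pt n :=
  ![((p 0).1 + Real.exp (lam * ((p 1).2.2 - (p 0).2.2)) • (p 1).1,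
      (p 0).2.1 + Real.exp (lam * ((p 1).2.2 - (p 0).2.2)) • (p 1).2.1, (p 0).2.2),
    ((p 1).1, (p 1).2.1, (p 1).2.2 - (p 0).2.2)]

/-- The phase of `Z`. -/
def phZ (n : ℕ) (lam : ℝ) (p : Fin 2 → Pt n) : ℝ :=
  eta lam (p 0).2.2 * (beta (p 0).1 (p 1).2.1 -
    Real.exp (lam * (p 1).2.2) * beta (p 1).1 (p 0).2.1 +
    Real.exp (lam * (p 1).2.2) * (Real.exp (lam * (p 1).2.2) - 1) * beta (p 1).1 (p 1).2.1)

/-- The change of variables of `Z`. -/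
def mapZ (n : ℕ) (lam : ℝ) (p : Fin 2 → Pt n) : Fin 2 → Pt n :=
  ![((p 0).1 + (1 - Real.exp (lam * (p 1).2.2)) • (p 1).1,
      (p 0).2.1 + (1 - Real.exp (lam * (p 1).2.2)) • (p 1).2.1, (p 0).2.2),
    (Real.exp (lam * (p 0).2.2) • (p 1).1, Real.exp (lam * (p 0).2.2) • (p 1).2.1, (p 1).2.2)]

/-- The dilation weights of the two factors j cancel that of U_A, so Y, and with it X, comes from a
measure preserving substitution; in contrast Z keeps the weight exp(λ r)ⁿ of its first leg. -/
theorem acts_Y : Acts (Yop n lam) (fun _ => 0) (phY n lam) (mapY n lam) := by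
  refine ((((acts_jop n lam).leg_one 0 (by decide)).mul (acts_UA n lam)).mul
    ((acts_jop n lam).leg_one 0 (by decide))).leg_two 1 0 (by decide) |>.congr
    (fun p => ?_) (fun p => ?_) (fun p => ?_)
  · simp
    ring
  · have h0 := (Real.exp_pos (lam * (p 0).2.2)).ne'
    have h1 := (Real.exp_pos (lam * (p 1).2.2)).ne'
    rcases eq_or_ne lam 0 with rfl | hl
    · simp [phY, eta_zero_left, beta_smul_left, beta_smul_right, beta_neg_left, beta_neg_right, beta_add_left,
      beta_add_right, beta_sub_left, beta_sub_right]
      ring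
    · simp [phY, eta_of_ne hl, beta_smul_left, beta_smul_right, beta_neg_left, beta_neg_right, beta_add_left,
      beta_add_right, beta_sub_left, beta_sub_right, Real.exp_neg, mul_add, mul_sub, Real.exp_add, Real.exp_sub]
      field_simp
      ring
  · have h0 := (Real.exp_pos (lam * (p 0).2.2)).ne'
    have h1 := (Real.exp_pos (lam * (p 1).2.2)).ne'
    funext i
    fin_cases i <;> refine Prod.ext (funext fun i => ?_) (Prod.ext (funext fun i => ?_) ?_) <;>
    simp [mapY, Real.exp_neg, mul_add, mul_sub, Real.exp_add, Real.exp_sub] <;> field_simp <;> ring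

/-- The change of variables of `Y^*`. -/
def mapYs (n : ℕ) (lam : ℝ) (p : Fin 2 → Pt n) : Fin 2 → Pt n :=
  ![((p 0).1 - Real.exp (lam * (p 1).2.2) • (p 1).1,
      (p 0).2.1 - Real.exp (lam * (p 1).2.2) • (p 1).2.1, (p 0).2.2),
    ((p 1).1, (p 1).2.1, (p 1).2.2 + (p 0).2.2)]

theorem measurable_mapYs : Measurable (mapYs n lam) := by
  unfold mapYs
  exact measurable_vecPair (by fun_prop) (by fun_prop)

theorem mapYs_mapY (p : Fin 2 → Pt n) : mapYs n lam (mapY n lam p) = p := by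
  funext i
  fin_cases i <;> refine Prod.ext (funext fun i => ?_) (Prod.ext (funext fun i => ?_) ?_) <;>
  simp [mapY, mapYs]

theorem Y_mem_unitary : Yop n lam ∈ unitary (Op n 2) :=
  (acts_Y n lam).mem_unitary (measurable_mapYs n lam) (mapYs_mapY n lam)

theorem acts_star_Y : Acts (star (Yop n lam)) (fun _ => 0)
    (fun p => -(eta lam (p 0).2.2 * beta (Real.exp (lam * (p 1).2.2) • (p 1).1)
      ((p 0).2.1 - Real.exp (lam * (p 1).2.2) • (p 1).2.1))) (mapYs n lam) := by
  refine ((acts_Y n lam).star (measurable_mapYs n lam) (mapYs_mapY n lam)).congr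
    (fun p => by simp) (fun p => ?_) (fun p => rfl)
  simp [phY, mapYs]

theorem acts_X : Acts (Xop n lam) (fun _ => 0) (phX n lam) (mapX n lam) := by
  refine ((acts_star_Y n lam).leg_two 1 0 (by decide)).congr (fun p => by simp) (fun p => ?_)
    (fun p => ?_)
  · simp [phX]
  · funext i
    fin_cases i <;> simp [mapX, mapYs]

theorem X_mem_unitary : Xop n lam ∈ unitary (Op n 2) :=
  leg_mem_unitary (Unitary.star_mem (Y_mem_unitary n lam)) _

theorem acts_jj : Acts (jj n lam) (fun p => lam * (p 0).2.2 + lam * (p 1).2.2)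
    (fun p => -(eta lam (p 0).2.2 * beta (p 0).1 (p 0).2.1) +
      -(eta lam (p 1).2.2 * beta (p 1).1 (p 1).2.1))
    (fun p => ![(-(Real.exp (lam * (p 0).2.2) • (p 0).1),
      -(Real.exp (lam * (p 0).2.2) • (p 0).2.1), -(p 0).2.2),
      (-(Real.exp (lam * (p 1).2.2) • (p 1).1),
      -(Real.exp (lam * (p 1).2.2) • (p 1).2.1), -(p 1).2.2)]) := by
  refine (((acts_jop n lam).leg_one 0 (by decide)).mul
    ((acts_jop n lam).leg_one 1 (by decide))).congr (fun p => by simp) (fun p => by simp)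
    (fun p => ?_)
  funext i
  fin_cases i <;> simp

theorem acts_Z : Acts (Zop n lam) (fun p => lam * (p 0).2.2) (phZ n lam) (mapZ n lam) := by
  refine ((acts_star_Y n lam).mul (((acts_jj n lam).mul (acts_Y n lam)).mul
    (acts_jj n lam))).congr (fun p => ?_) (fun p => ?_) (fun p => ?_)
  · simp [mapYs, mapY]
    ring
  · have h0 := (Real.exp_pos (lam * (p 0).2.2)).ne'
    have h1 := (Real.exp_pos (lam * (p 1).2.2)).ne'
    rcases eq_or_ne lam 0 with rfl | hl
    · simp [phY, phZ, mapYs, mapY, eta_zero_left, beta_smul_left, beta_smul_right, beta_neg_left, beta_neg_right, beta_add_left,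
      beta_add_right, beta_sub_left, beta_sub_right]
      try ring
    · simp [phY, phZ, mapYs, mapY, eta_of_ne hl, beta_smul_left, beta_smul_right, beta_neg_left, beta_neg_right, beta_add_left,
      beta_add_right, beta_sub_left, beta_sub_right, Real.exp_neg, mul_add, mul_sub, Real.exp_add, Real.exp_sub]
      field_simp
      ring
  · have h0 := (Real.exp_pos (lam * (p 0).2.2)).ne'
    have h1 := (Real.exp_pos (lam * (p 1).2.2)).ne'
    funext i
    fin_cases i <;> refine Prod.ext (funext fun i => ?_) (Prod.ext (funext fun i => ?_) ?_) <;>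
    simp [mapYs, mapY, mapZ, Real.exp_neg, mul_add, mul_sub, Real.exp_add, Real.exp_sub] <;>
    first | (field_simp; done) | (field_simp; ring1)

/-- The change of variables of `Z^*`. -/
def mapZs (n : ℕ) (lam : ℝ) (p : Fin 2 → Pt n) : Fin 2 → Pt n :=
  ![((p 0).1 - ((1 - Real.exp (lam * (p 1).2.2)) * Real.exp (-(lam * (p 0).2.2))) • (p 1).1,
      (p 0).2.1 - ((1 - Real.exp (lam * (p 1).2.2)) * Real.exp (-(lam * (p 0).2.2))) • (p 1).2.1,
      (p 0).2.2),
    (Real.exp (-(lam * (p 0).2.2)) • (p 1).1, Real.exp (-(lam * (p 0).2.2)) • (p 1).2.1,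
      (p 1).2.2)]

theorem measurable_mapZs : Measurable (mapZs n lam) := by
  unfold mapZs
  exact measurable_vecPair (by fun_prop) (by fun_prop)

theorem mapZs_mapZ (p : Fin 2 → Pt n) : mapZs n lam (mapZ n lam p) = p := by
  have h0 := (Real.exp_pos (lam * (p 0).2.2)).ne'
  funext i
  fin_cases i <;> refine Prod.ext (funext fun i => ?_) (Prod.ext (funext fun i => ?_) ?_) <;>
  simp [mapZ, mapZs, Real.exp_neg] <;> field_simp <;> ring

theorem Z_mem_unitary : Zop n lam ∈ unitary (Op n 2) :=
  (acts_Z n lam).mem_unitary (measurable_mapZs n lam) (mapZs_mapZ n lam)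

theorem acts_star_Z : Acts (star (Zop n lam)) (fun p => -(lam * (p 0).2.2))
    (fun p => -phZ n lam (mapZs n lam p)) (mapZs n lam) :=
  ((acts_Z n lam).star (measurable_mapZs n lam) (mapZs_mapZ n lam)).congr
    (fun p => by simp [mapZs]) (fun p => rfl) (fun p => rfl)

/-! ## Identities between the unitaries -/

theorem pentagon_X : (leg ![0, 1] (Xop n lam) * leg ![0, 2] (Xop n lam) * leg ![1, 2] (Xop n lam) :
    Op n 3) = leg ![1, 2] (Xop n lam) * leg ![0, 1] (Xop n lam) := by
  have X := acts_X n lam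
  refine (((X.leg_two 0 1 (by decide)).mul (X.leg_two 0 2 (by decide))).mul
    (X.leg_two 1 2 (by decide))).unique ((X.leg_two 1 2 (by decide)).mul
    (X.leg_two 0 1 (by decide))) (fun p => ?_) (fun p => ?_) (fun p => ?_)
  · simp
  · have h0 := (Real.exp_pos (lam * (p 0).2.2)).ne'
    have h1 := (Real.exp_pos (lam * (p 1).2.2)).ne'
    have h2 := (Real.exp_pos (lam * (p 2).2.2)).ne'
    rcases eq_or_ne lam 0 with rfl | hl
    · simp [phX, mapX, eta_zero_left, beta_smul_left, beta_smul_right, beta_neg_left, beta_neg_right, beta_add_left,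
      beta_add_right, beta_sub_left, beta_sub_right]
      try ring
    · simp [phX, mapX, eta_of_ne hl, beta_smul_left, beta_smul_right, beta_neg_left, beta_neg_right, beta_add_left,
      beta_add_right, beta_sub_left, beta_sub_right, Real.exp_neg, mul_add, mul_sub, Real.exp_add, Real.exp_sub]
      field_simp
      ring
  · have h0 := (Real.exp_pos (lam * (p 0).2.2)).ne'
    have h1 := (Real.exp_pos (lam * (p 1).2.2)).ne'
    have h2 := (Real.exp_pos (lam * (p 2).2.2)).ne'
    funext i
    fin_cases i <;> refine Prod.ext (funext fun i => ?_) (Prod.ext (funext fun i => ?_) ?_) <;>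
    simp [mapX, Real.exp_neg, mul_add, mul_sub, Real.exp_add, Real.exp_sub] <;>
    first | (field_simp; done) | (field_simp; ring1) | ring1

/-- `Z₁₂ Y₂₃ Z₁₂^*`. -/
def Yt (n : ℕ) (lam : ℝ) : Op n 3 :=
  leg ![0, 1] (Zop n lam) * leg ![1, 2] (Yop n lam) * star (leg ![0, 1] (Zop n lam))

/-- The change of variables of `Z₁₂ Y₂₃ Z₁₂^*`. -/
def mapYt (n : ℕ) (lam : ℝ) (p : Fin 3 → Pt n) : Fin 3 → Pt n :=
  let A := Real.exp (lam * ((p 2).2.2 - (p 0).2.2 - (p 1).2.2))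
  let B := Real.exp (lam * (p 1).2.2)
  ![((p 0).1 - ((1 - B) * A) • (p 2).1, (p 0).2.1 - ((1 - B) * A) • (p 2).2.1, (p 0).2.2),
    ((p 1).1 + A • (p 2).1, (p 1).2.1 + A • (p 2).2.1, (p 1).2.2),
    ((p 2).1, (p 2).2.1, (p 2).2.2 - (p 1).2.2)]

/-- The phase of `Z₁₂ Y₂₃ Z₁₂^*`. -/
def phYt (n : ℕ) (lam : ℝ) (p : Fin 3 → Pt n) : ℝ :=
  let A := Real.exp (lam * ((p 2).2.2 - (p 0).2.2 - (p 1).2.2))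
  let B := Real.exp (lam * (p 1).2.2)
  eta lam (p 0).2.2 * (B * A * beta (p 2).1 (p 0).2.1 - A * beta (p 0).1 (p 2).2.1 +
    (1 - B ^ 2) * A * beta (p 2).1 (p 1).2.1 + (1 - B) * A ^ 2 * beta (p 2).1 (p 2).2.1) +
    eta lam (p 1).2.2 * (Real.exp (lam * (p 0).2.2) ^ 2 * A * beta (p 2).1 (p 1).2.1)

theorem acts_Yt : Acts (Yt n lam) (fun _ => 0) (phYt n lam) (mapYt n lam) := by
  rw [Yt, ← leg_star]
  refine ((((acts_Z n lam).leg_two 0 1 (by decide)).mul ((acts_Y n lam).leg_two 1 2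
    (by decide))).mul ((acts_star_Z n lam).leg_two 0 1 (by decide))).congr
    (fun p => ?_) (fun p => ?_) (fun p => ?_)
  · simp [mapZ, mapY]
  · have h0 := (Real.exp_pos (lam * (p 0).2.2)).ne'
    have h1 := (Real.exp_pos (lam * (p 1).2.2)).ne'
    have h2 := (Real.exp_pos (lam * (p 2).2.2)).ne'
    rcases eq_or_ne lam 0 with rfl | hl
    · simp [phYt, phZ, phY, mapZ, mapZs, mapY, eta_zero_left, beta_smul_left, beta_smul_right, beta_neg_left, beta_neg_right, beta_add_left,
      beta_add_right, beta_sub_left, beta_sub_right]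
      try ring
    · simp [phYt, phZ, phY, mapZ, mapZs, mapY, eta_of_ne hl, beta_smul_left, beta_smul_right, beta_neg_left, beta_neg_right, beta_add_left,
      beta_add_right, beta_sub_left, beta_sub_right, Real.exp_neg, mul_add, mul_sub, Real.exp_add, Real.exp_sub]
      field_simp
      ring
  · have h0 := (Real.exp_pos (lam * (p 0).2.2)).ne'
    have h1 := (Real.exp_pos (lam * (p 1).2.2)).ne'
    have h2 := (Real.exp_pos (lam * (p 2).2.2)).ne'
    funext i
    fin_cases i <;> refine Prod.ext (funext fun i => ?_) (Prod.ext (funext fun i => ?_) ?_) <;>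
    simp [mapYt, mapZ, mapZs, mapY, Real.exp_neg, mul_add, mul_sub, Real.exp_add, Real.exp_sub] <;>
    first | (field_simp; done) | (field_simp; ring1)

/-- The relation responsible for the double: Z₂₃ intertwines the two orders of the factors of V_D.
It is used for the pentagon equation of V_D, for the second comultiplication formula, and for
interchanging π(A) with Â^op ⊗ 1. -/
theorem X_Yt_star_Z : (leg ![0, 2] (Xop n lam) * leg ![0, 1, 3] (Yt n lam) *
    leg ![2, 3] (star (Zop n lam)) : Op n 4) =
    leg ![2, 3] (star (Zop n lam)) * leg ![0, 1, 3] (Yt n lam) * leg ![0, 2] (Xop n lam) := by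
  have X := (acts_X n lam).leg_two (m := 4) 0 2 (by decide)
  have Yt := (acts_Yt n lam).leg_three (m := 4) 0 1 3 (by decide)
  have Z := (acts_star_Z n lam).leg_two (m := 4) 2 3 (by decide)
  refine ((X.mul Yt).mul Z).unique ((Z.mul Yt).mul X) (fun p => ?_) (fun p => ?_) (fun p => ?_)
  · simp [mapX, mapYt, mapZs]
  · have h0 := (Real.exp_pos (lam * (p 0).2.2)).ne'
    have h1 := (Real.exp_pos (lam * (p 1).2.2)).ne'
    have h2 := (Real.exp_pos (lam * (p 2).2.2)).ne'
    have h3 := (Real.exp_pos (lam * (p 3).2.2)).ne'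
    rcases eq_or_ne lam 0 with rfl | hl
    · simp [phX, phYt, phZ, mapX, mapYt, mapZs, eta_zero_left, beta_smul_left, beta_smul_right, beta_neg_left, beta_neg_right, beta_add_left,
      beta_add_right, beta_sub_left, beta_sub_right]
      try ring
    · simp [phX, phYt, phZ, mapX, mapYt, mapZs, eta_of_ne hl, beta_smul_left, beta_smul_right, beta_neg_left, beta_neg_right, beta_add_left,
      beta_add_right, beta_sub_left, beta_sub_right, Real.exp_neg, mul_add, mul_sub, Real.exp_add, Real.exp_sub]
      field_simp
      ring
  · have h0 := (Real.exp_pos (lam * (p 0).2.2)).ne'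
    have h1 := (Real.exp_pos (lam * (p 1).2.2)).ne'
    have h2 := (Real.exp_pos (lam * (p 2).2.2)).ne'
    have h3 := (Real.exp_pos (lam * (p 3).2.2)).ne'
    funext i
    fin_cases i <;> refine Prod.ext (funext fun i => ?_) (Prod.ext (funext fun i => ?_) ?_) <;>
    simp [mapX, mapYt, mapZs, Real.exp_neg, mul_add, mul_sub, Real.exp_add, Real.exp_sub] <;>
    first | (field_simp; done) | (field_simp; ring1)

/-- Together with `Xt_X_X` this splits the relation 𝓡₁₂V₁₃V₂₃ = V₂₃V₁₃𝓡₁₂ into a part for the Ỹ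
factors and a part for the X factors of V_D. -/
theorem X_Yt_Y : (leg ![0, 2] (Xop n lam) * leg ![0, 1, 3] (Yt n lam) *
    leg ![2, 3] (Yop n lam) : Op n 4) =
    leg ![2, 3] (Yop n lam) * leg ![0, 1, 3] (Yt n lam) * leg ![0, 2] (Xop n lam) := by
  have X := (acts_X n lam).leg_two (m := 4) 0 2 (by decide)
  have Yt := (acts_Yt n lam).leg_three (m := 4) 0 1 3 (by decide)
  have Y := (acts_Y n lam).leg_two (m := 4) 2 3 (by decide)
  refine ((X.mul Yt).mul Y).unique ((Y.mul Yt).mul X) (fun p => ?_) (fun p => ?_) (fun p => ?_)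
  · simp [mapX, mapYt, mapY]
  · have h0 := (Real.exp_pos (lam * (p 0).2.2)).ne'
    have h1 := (Real.exp_pos (lam * (p 1).2.2)).ne'
    have h2 := (Real.exp_pos (lam * (p 2).2.2)).ne'
    have h3 := (Real.exp_pos (lam * (p 3).2.2)).ne'
    rcases eq_or_ne lam 0 with rfl | hl
    · simp [phX, phYt, phY, mapX, mapYt, mapY, eta_zero_left, beta_smul_left, beta_smul_right, beta_neg_left, beta_neg_right, beta_add_left,
      beta_add_right, beta_sub_left, beta_sub_right]
      try ring
    · simp [phX, phYt, phY, mapX, mapYt, mapY, eta_of_ne hl, beta_smul_left, beta_smul_right, beta_neg_left, beta_neg_right, beta_add_left,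
      beta_add_right, beta_sub_left, beta_sub_right, Real.exp_neg, mul_add, mul_sub, Real.exp_add, Real.exp_sub]
      field_simp
      ring
  · have h0 := (Real.exp_pos (lam * (p 0).2.2)).ne'
    have h1 := (Real.exp_pos (lam * (p 1).2.2)).ne'
    have h2 := (Real.exp_pos (lam * (p 2).2.2)).ne'
    have h3 := (Real.exp_pos (lam * (p 3).2.2)).ne'
    funext i
    fin_cases i <;> refine Prod.ext (funext fun i => ?_) (Prod.ext (funext fun i => ?_) ?_) <;>
    simp [mapX, mapYt, mapY, Real.exp_neg, mul_add, mul_sub, Real.exp_add, Real.exp_sub,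
      -mul_eq_mul_right_iff, -mul_eq_mul_left_iff, -sub_right_inj] <;>
    first | (field_simp; done) | (field_simp; ring1) | ring1

/-- `Z₂₃ X₁₃ Z₂₃^*`. -/
def Xt (n : ℕ) (lam : ℝ) : Op n 3 :=
  leg ![1, 2] (Zop n lam) * leg ![0, 2] (Xop n lam) * star (leg ![1, 2] (Zop n lam))

/-- The X part of the intertwining relation. It is also the core of the Yang-Baxter equation, whose
remaining content is conjugation by a commuting Z. -/
theorem Xt_X_X : (leg ![0, 1, 2] (Xt n lam) * leg ![0, 3] (Xop n lam) *
    leg ![1, 3] (Xop n lam) : Op n 4) =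
    leg ![1, 3] (Xop n lam) * leg ![0, 3] (Xop n lam) * leg ![0, 1, 2] (Xt n lam) := by
  have hX : (leg ![0, 1, 2] (Xt n lam) : Op n 4) = leg ![1, 2] (Zop n lam) *
      leg ![0, 2] (Xop n lam) * leg ![1, 2] (star (Zop n lam)) := by
    simp [Xt, leg_mul, ← leg_star, leg_leg_two]
  rw [hX]
  have X := fun i j hij => (acts_X n lam).leg_two (m := 4) i j hij
  have Z := (acts_Z n lam).leg_two (m := 4) 1 2 (by decide)
  have Zs := (acts_star_Z n lam).leg_two (m := 4) 1 2 (by decide)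
  have Xt := (Z.mul (X 0 2 (by decide))).mul Zs
  refine ((Xt.mul (X 0 3 (by decide))).mul (X 1 3 (by decide))).unique
    (((X 1 3 (by decide)).mul (X 0 3 (by decide))).mul Xt)
    (fun p => ?_) (fun p => ?_) (fun p => ?_)
  · simp [mapX, mapZ, mapZs]
  · have h0 := (Real.exp_pos (lam * (p 0).2.2)).ne'
    have h1 := (Real.exp_pos (lam * (p 1).2.2)).ne'
    have h2 := (Real.exp_pos (lam * (p 2).2.2)).ne'
    have h3 := (Real.exp_pos (lam * (p 3).2.2)).ne'
    rcases eq_or_ne lam 0 with rfl | hl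
    · simp [phX, phZ, mapX, mapZ, mapZs, eta_zero_left, beta_smul_left, beta_smul_right, beta_neg_left, beta_neg_right, beta_add_left,
      beta_add_right, beta_sub_left, beta_sub_right]
      try ring
    · simp [phX, phZ, mapX, mapZ, mapZs, eta_of_ne hl, beta_smul_left, beta_smul_right, beta_neg_left, beta_neg_right, beta_add_left,
      beta_add_right, beta_sub_left, beta_sub_right, Real.exp_neg, mul_add, mul_sub, Real.exp_add, Real.exp_sub]
      field_simp
      ring
  · have h0 := (Real.exp_pos (lam * (p 0).2.2)).ne'
    have h1 := (Real.exp_pos (lam * (p 1).2.2)).ne'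
    have h2 := (Real.exp_pos (lam * (p 2).2.2)).ne'
    have h3 := (Real.exp_pos (lam * (p 3).2.2)).ne'
    funext i
    fin_cases i <;> refine Prod.ext (funext fun i => ?_) (Prod.ext (funext fun i => ?_) ?_) <;>
    simp [mapX, mapZ, mapZs, Real.exp_neg, mul_add, mul_sub, Real.exp_add, Real.exp_sub] <;>
    first | (field_simp; done) | (field_simp; ring1) | ring1

end Closed

/-! ## Identities for the quantum double -/

theorem mul_mul_eq {M : Type*} [Semigroup M] {a b c d : M} (h : a * b = c * d) (z : M) :
    a * (b * z) = c * (d * z) := by rw [← mul_assoc, h, mul_assoc]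

section Monoid

variable {M : Type*} [Monoid M]

theorem mul_mul_mul_mul_eq_one {z zs : M} (h : z * zs = 1) (c : M) : z * (zs * c) = c := by
  rw [← mul_assoc, h, one_mul]

/-- For Ỹ₀₁₂Ỹ₀₁₃Y₂₃ = Y₂₃Ỹ₀₁₂: the pentagon equation of Y conjugated by z = Z₀₁, which does not
touch the legs of y3 = Y₂₃. -/
theorem conj_pentagon {z zs y1 y2 y3 : M} (hz' : zs * z = 1)
    (p : y1 * y2 * y3 = y3 * y1) (c : y3 * z = z * y3) (c' : y3 * zs = zs * y3) :
    (z * y1 * zs) * (z * y2 * zs) * y3 = y3 * (z * y1 * zs) := by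
  simp only [mul_assoc, mul_mul_mul_mul_eq_one hz', ← c']
  rw [mul_mul_eq c, ← mul_assoc y1, ← mul_assoc (y1 * y2), p, mul_assoc]

/-- To be read with a = Ỹ₀₁₃, x = X₀₂, a' = Ỹ₀₁₅, x' = X₀₄, z = Z₂₃, y = Y₃₅, w = X₂₄. Moving z to
the left reverses the product a x, the pentagon equation for Ỹ then removes a', moving z^* restores
the order, and the pentagon equation for X removes x'. -/
theorem pentagon_aux {a a' x x' w y z zs : M} (hz : z * zs = 1) (hz' : zs * z = 1)
    (b : z * (x * a) = a * x * z) (py : a * a' * y = y * a) (px : x * x' * w = w * x)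
    (c1 : w * a = a * w) (c2 : x' * (z * y * zs) = (z * y * zs) * x')
    (c3 : y * x = x * y) (c4 : a' * z = z * a') :
    a * x * (a' * x') * ((z * y * zs) * w) = (z * y * zs) * w * (a * x) := by
  have b' : zs * (a * x) = x * a * zs := by
    have := congrArg (fun t => zs * t * zs) b
    simp only [mul_assoc, mul_mul_mul_mul_eq_one hz', hz, mul_one] at this
    simpa only [mul_assoc] using this.symm
  calc a * x * (a' * x') * ((z * y * zs) * w)
      = a * x * a' * (x' * (z * y * zs)) * w := by simp only [mul_assoc]
    _ = a * x * (a' * z) * y * zs * x' * w := by rw [c2]; simp only [mul_assoc]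
    _ = (a * x * z) * a' * y * zs * x' * w := by rw [c4]; simp only [mul_assoc]
    _ = z * x * (a * a' * y) * zs * x' * w := by rw [← b]; simp only [mul_assoc]
    _ = z * (x * y) * a * zs * x' * w := by rw [py]; simp only [mul_assoc]
    _ = z * y * (x * a * zs) * x' * w := by rw [← c3]; simp only [mul_assoc]
    _ = z * y * zs * a * (x * x' * w) := by rw [← b']; simp only [mul_assoc]
    _ = z * y * zs * (w * a) * x := by rw [px, c1]; simp only [mul_assoc]
    _ = _ := by simp only [mul_assoc]

/-- To be read with r = X̃₀₂₃, x = X₀₃, a' = Ỹ₀₁₅, x' = X₀₄, z = Z₂₃, y = Y₃₅, w = X₂₄. Undoing the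
conjugation by z lets x reverse a' y; restoring it lets r reverse x' w. -/
theorem intertwine_aux {r a' x x' w y z zs : M} (hr : r = z * x * zs) (hz' : zs * z = 1)
    (c : x * a' * y = y * a' * x) (d : r * x' * w = w * x' * r)
    (c1 : w * a' = a' * w) (c2 : x' * (z * y * zs) = (z * y * zs) * x')
    (c3 : a' * z = z * a') (c4 : a' * zs = zs * a') :
    r * (a' * x') * ((z * y * zs) * w) = (z * y * zs) * w * (a' * x') * r := by
  calc r * (a' * x') * ((z * y * zs) * w)
      = r * a' * (x' * (z * y * zs)) * w := by simp only [mul_assoc]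
    _ = z * x * (zs * a') * z * y * zs * x' * w := by rw [c2, hr]; simp only [mul_assoc]
    _ = z * (x * a' * y) * zs * x' * w := by
        rw [← c4]; simp only [mul_assoc, mul_mul_mul_mul_eq_one hz']
    _ = z * y * zs * (z * a') * x * zs * x' * w := by
        rw [c]; simp only [mul_assoc, mul_mul_mul_mul_eq_one hz']
    _ = z * y * zs * a' * (r * x' * w) := by rw [← c3, hr]; simp only [mul_assoc]
    _ = z * y * zs * (a' * w) * x' * r := by rw [d]; simp only [mul_assoc]
    _ = _ := by rw [← c1]; simp only [mul_assoc]

/-- To be read with a = Ỹ₀₁₃, x = X₀₂, x' = X₀₅, w = X₂₅, z = Z₄₅: only the pentagon equation of X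
is needed, because z acts on legs disjoint from a and x. -/
theorem comul_left_aux {a x x' w z zs : M} (hz' : zs * z = 1) (p : x * x' * w = w * x)
    (c1 : w * a = a * w) (c2 : a * z = z * a) (c3 : x * z = z * x) (c4 : a * zs = zs * a)
    (c5 : x * zs = zs * x) :
    (z * w * zs) * (a * x) = a * x * (z * x' * zs) * (z * w * zs) := by
  calc (z * w * zs) * (a * x) = z * w * (zs * a) * x := by simp only [mul_assoc]
    _ = z * (w * a) * (zs * x) := by rw [← c4]; simp only [mul_assoc]
    _ = z * a * (w * x) * zs := by rw [← c5, c1]; simp only [mul_assoc]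
    _ = (z * a) * x * x' * w * zs := by rw [← p]; simp only [mul_assoc]
    _ = a * (z * x) * x' * w * zs := by rw [← c2]; simp only [mul_assoc]
    _ = a * x * z * x' * (zs * z) * w * zs := by
        rw [← c3, hz', mul_one]; simp only [mul_assoc]
    _ = _ := by simp only [mul_assoc]

/-- To be read with A = Ỹ₂₃₅, x = X₀₅, w = X₂₄, z = Z₄₅, r = X̃₀₂₃. The relation k creates the new
factor r; since x sits inside a conjugation by z, the product A w is first reversed by z^* and
afterwards restored by z. -/
theorem comul_right_aux {r A x w z zs : M} (hz : z * zs = 1) (hz' : zs * z = 1)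
    (b : z * (w * A) = A * w * z) (k : x * A = A * x * r) (c1 : x * w = w * x)
    (c2 : r * zs = zs * r) :
    (z * x * zs) * (A * w) = A * w * (z * x * zs) * r := by
  have b' : zs * (A * w) = w * A * zs := by
    have := congrArg (fun t => zs * t * zs) b
    simp only [mul_assoc, mul_mul_mul_mul_eq_one hz', hz, mul_one] at this
    simpa only [mul_assoc] using this.symm
  calc (z * x * zs) * (A * w) = z * x * (zs * (A * w)) := by simp only [mul_assoc]
    _ = z * (x * w) * A * zs := by rw [b']; simp only [mul_assoc]
    _ = z * w * (x * A) * zs := by rw [c1]; simp only [mul_assoc]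
    _ = (z * (w * A)) * x * (r * zs) := by rw [k]; simp only [mul_assoc]
    _ = _ := by rw [b, c2]; simp only [mul_assoc]

/-- To be read with x = X₀₅, x' = X₀₃, y = Y₃₅, z = Z₂₃. As y is inverse to v = X₅₃, the pentagon
equation on the legs 0, 5, 3 becomes a rule for moving x past y, which is then conjugated by z. -/
theorem comul_key_aux {x x' y v z zs : M} (hz' : zs * z = 1) (hv : y * v = 1) (hv' : v * y = 1)
    (p : x * x' * v = v * x) (c1 : x * z = z * x) (c2 : x * zs = zs * x) :
    x * (z * y * zs) = (z * y * zs) * x * (z * x' * zs) := by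
  have p' : x * y = y * x * x' := by
    have := congrArg (fun t => y * t * y) p
    simp only [mul_assoc, mul_mul_mul_mul_eq_one hv, hv', mul_one] at this
    simpa only [mul_assoc] using this.symm
  calc x * (z * y * zs) = (x * z) * y * zs := by simp only [mul_assoc]
    _ = z * (x * y) * zs := by rw [c1]; simp only [mul_assoc]
    _ = z * y * x * (zs * z) * x' * zs := by rw [p', hz', mul_one]; simp only [mul_assoc]
    _ = z * y * (zs * x) * z * x' * zs := by rw [← c2]; simp only [mul_assoc]
    _ = _ := by simp only [mul_assoc]

/-- To be read with r = X̃₀₂₃, x = X₀₅, w = X₂₅, z = Z₄₅: the relation d conjugated by z, which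
commutes with r. -/
theorem yang_baxter_aux {r x w z zs : M} (hz' : zs * z = 1) (d : r * x * w = w * x * r)
    (c1 : r * z = z * r) (c2 : r * zs = zs * r) :
    r * (z * x * zs) * (z * w * zs) = (z * w * zs) * (z * x * zs) * r := by
  simp only [mul_assoc, mul_mul_mul_mul_eq_one hz', ← c2]
  rw [← mul_assoc, c1, mul_assoc, ← mul_assoc x, ← mul_assoc r, ← mul_assoc r, d]
  simp only [mul_assoc]

end Monoid

section Identities

variable (n : ℕ) (lam : ℝ)

theorem VD_eq : VD n lam = leg ![0, 1, 3] (Yt n lam) * leg ![0, 2] (Xop n lam) := by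
  simp [VD, Yt, leg_mul, ← leg_star, leg_leg_two]

/-- Leg 1 is idle in 𝓡, so relations for 𝓡 are relations on three legs. -/
theorem Rmat_eq : Rmat n lam = leg ![0, 2, 3] (Xt n lam) := by
  simp [Rmat, Xt, leg_mul, ← leg_star, leg_leg_two]

theorem VD_mem_unitary : VD n lam ∈ unitary (Op n 4) :=
  mul_mem (mul_mem (mul_mem (leg_mem_unitary (Z_mem_unitary n lam) _)
    (leg_mem_unitary (Y_mem_unitary n lam) _))
    (Unitary.star_mem (leg_mem_unitary (Z_mem_unitary n lam) _)))
    (leg_mem_unitary (X_mem_unitary n lam) _)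

theorem Rmat_mem_unitary : Rmat n lam ∈ unitary (Op n 4) :=
  mul_mem (mul_mem (leg_mem_unitary (Z_mem_unitary n lam) _)
    (leg_mem_unitary (X_mem_unitary n lam) _))
    (Unitary.star_mem (leg_mem_unitary (Z_mem_unitary n lam) _))

/-- `Y = Σ X^* Σ`. -/
theorem leg_Y {m : ℕ} (i j : Fin m) (h : Function.Injective ![i, j])
    (h' : Function.Injective ![j, i]) :
    leg ![i, j] (Yop n lam) h = star (leg ![j, i] (Xop n lam) h') := by
  simp [Xop, leg_leg_two, leg_star]

theorem pentagon_Y : (leg ![0, 1] (Yop n lam) * leg ![0, 2] (Yop n lam) * leg ![1, 2] (Yop n lam) :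
    Op n 3) = leg ![1, 2] (Yop n lam) * leg ![0, 1] (Yop n lam) := by
  -- The adjoint reverses the order of the factors; reversing the three legs as well turns each X^*
  -- into a Y on legs in increasing order.
  have h := congrArg (fun T => leg ![2, 1, 0] (star T) (m := 3) (by decide)) (pentagon_X n lam)
  simp [leg_mul, ← leg_star, leg_leg_two] at h
  rw [leg_Y n lam 0 1 _ (by decide), leg_Y n lam 0 2 _ (by decide), leg_Y n lam 1 2 _ (by decide)]
  rw [← leg_star, ← leg_star, ← leg_star, mul_assoc]
  exact h

theorem leg_Xt {m : ℕ} (i j k : Fin m) (h : Function.Injective ![i, j, k])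
    (h1 : Function.Injective ![j, k]) (h2 : Function.Injective ![i, k]) :
    leg ![i, j, k] (Xt n lam) h = leg ![j, k] (Zop n lam) h1 * leg ![i, k] (Xop n lam) h2 *
      star (leg ![j, k] (Zop n lam) h1) := by
  simp [Xt, leg_mul, ← leg_star, leg_leg_two]

theorem leg_Yt {m : ℕ} (i j k : Fin m) (h : Function.Injective ![i, j, k])
    (h1 : Function.Injective ![i, j]) (h2 : Function.Injective ![j, k]) :
    leg ![i, j, k] (Yt n lam) h = leg ![i, j] (Zop n lam) h1 * leg ![j, k] (Yop n lam) h2 *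
      star (leg ![i, j] (Zop n lam) h1) := by
  simp [Yt, leg_mul, ← leg_star, leg_leg_two]

theorem leg_VD {m : ℕ} (i j k l : Fin m) (h : Function.Injective ![i, j, k, l])
    (h1 : Function.Injective ![i, j, l]) (h2 : Function.Injective ![i, k]) :
    leg ![i, j, k, l] (VD n lam) h = leg ![i, j, l] (Yt n lam) h1 * leg ![i, k] (Xop n lam) h2 := by
  simp [VD_eq, leg_mul, leg_leg_two, leg_leg_three]

theorem leg_Rmat {m : ℕ} (i j k l : Fin m) (h : Function.Injective ![i, j, k, l])
    (h1 : Function.Injective ![i, k, l]) :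
    leg ![i, j, k, l] (Rmat n lam) h = leg ![i, k, l] (Xt n lam) h1 := by
  simp [Rmat_eq, leg_leg_three]

/-- Transport of the pentagon equation to other legs. -/
theorem leg_pentagon_X {m : ℕ} (i j k : Fin m) (h : Function.Injective ![i, j, k])
    (h1 : Function.Injective ![i, j]) (h2 : Function.Injective ![i, k])
    (h3 : Function.Injective ![j, k]) :
    leg ![i, j] (Xop n lam) h1 * leg ![i, k] (Xop n lam) h2 * leg ![j, k] (Xop n lam) h3 =
      leg ![j, k] (Xop n lam) h3 * leg ![i, j] (Xop n lam) h1 := by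
  have := congrArg (fun T => leg ![i, j, k] T h) (pentagon_X n lam)
  simpa [leg_mul, leg_leg_two] using this

theorem leg_pentagon_Y {m : ℕ} (i j k : Fin m) (h : Function.Injective ![i, j, k])
    (h1 : Function.Injective ![i, j]) (h2 : Function.Injective ![i, k])
    (h3 : Function.Injective ![j, k]) :
    leg ![i, j] (Yop n lam) h1 * leg ![i, k] (Yop n lam) h2 * leg ![j, k] (Yop n lam) h3 =
      leg ![j, k] (Yop n lam) h3 * leg ![i, j] (Yop n lam) h1 := by
  have := congrArg (fun T => leg ![i, j, k] T h) (pentagon_Y n lam)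
  simpa [leg_mul, leg_leg_two] using this

/-- `X₁₃ Ỹ₁₂₄ Z₃₄^* = Z₃₄^* Ỹ₁₂₄ X₁₃` on arbitrary legs, without the adjoint. -/
theorem leg_Z_X_Yt {m : ℕ} (i j k l : Fin m) (h : Function.Injective ![i, j, k, l])
    (h1 : Function.Injective ![i, k]) (h2 : Function.Injective ![i, j, l])
    (h3 : Function.Injective ![k, l]) :
    leg ![k, l] (Zop n lam) h3 * (leg ![i, k] (Xop n lam) h1 * leg ![i, j, l] (Yt n lam) h2) =
      leg ![i, j, l] (Yt n lam) h2 * leg ![i, k] (Xop n lam) h1 * leg ![k, l] (Zop n lam) h3 := by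
  have := congrArg (fun T => leg ![i, j, k, l] T h) (X_Yt_star_Z n lam)
  simp [leg_mul, leg_leg_two, leg_leg_three, leg_star] at this
  have hu := leg_mem_unitary (Z_mem_unitary n lam) h3
  have h4 := congrArg (fun T => leg ![k, l] (Zop n lam) h3 * T * leg ![k, l] (Zop n lam) h3) this
  simp only [mul_assoc, hu.1, mul_one] at h4
  rw [h4]
  simp only [← mul_assoc, hu.2, one_mul]

theorem leg_pentagon_Yt {m : ℕ} (i j k l : Fin m) (h : Function.Injective ![i, j, k, l])
    (h1 : Function.Injective ![i, j, k]) (h2 : Function.Injective ![i, j, l])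
    (h3 : Function.Injective ![k, l]) :
    leg ![i, j, k] (Yt n lam) h1 * leg ![i, j, l] (Yt n lam) h2 * leg ![k, l] (Yop n lam) h3 =
      leg ![k, l] (Yop n lam) h3 * leg ![i, j, k] (Yt n lam) h1 := by
  have key : (leg ![0, 1, 2] (Yt n lam) * leg ![0, 1, 3] (Yt n lam) * leg ![2, 3] (Yop n lam) :
      Op n 4) = leg ![2, 3] (Yop n lam) * leg ![0, 1, 2] (Yt n lam) := by
    rw [leg_Yt n lam 0 1 2 _ (by decide) (by decide), leg_Yt n lam 0 1 3 _ (by decide) (by decide),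
      ← leg_star]
    refine conj_pentagon ?_ (leg_pentagon_Y n lam 1 2 3 (by decide) _ _ _)
      (leg_commute _ _ _ _ (by decide)) (leg_commute _ _ _ _ (by decide))
    rw [leg_star]
    exact (leg_mem_unitary (Z_mem_unitary n lam) _).1
  have := congrArg (fun T => leg ![i, j, k, l] T h) key
  simpa [leg_mul, leg_leg_two, leg_leg_three] using this

theorem pentagon_VD : (leg ![0, 1, 2, 3] (VD n lam) * leg ![0, 1, 4, 5] (VD n lam) *
    leg ![2, 3, 4, 5] (VD n lam) : Op n 6) =
    leg ![2, 3, 4, 5] (VD n lam) * leg ![0, 1, 2, 3] (VD n lam) := by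
  have c2 : (leg ![0, 4] (Xop n lam) * leg ![2, 3, 5] (Yt n lam) : Op n 6) = _ :=
    leg_commute _ _ (by decide) (by decide) (by decide)
  rw [leg_VD n lam 0 1 2 3 _ (by decide) (by decide), leg_VD n lam 0 1 4 5 _ (by decide) (by decide),
    leg_VD n lam 2 3 4 5 _ (by decide) (by decide)]
  rw [leg_Yt n lam 2 3 5 _ (by decide) (by decide)] at c2 ⊢
  exact pentagon_aux (leg_mem_unitary (Z_mem_unitary n lam) _).2
    (leg_mem_unitary (Z_mem_unitary n lam) _).1 (leg_Z_X_Yt n lam 0 1 2 3 (by decide) _ _ _)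
    (leg_pentagon_Yt n lam 0 1 3 5 (by decide) _ (by decide) _)
    (leg_pentagon_X n lam 0 2 4 (by decide) _ _ _)
    (leg_commute _ _ _ _ (by decide)) c2
    (leg_commute _ _ _ _ (by decide)) (leg_commute _ _ _ _ (by decide))

theorem leg_X_Yt_Y {m : ℕ} (i j k l : Fin m) (h : Function.Injective ![i, j, k, l])
    (h1 : Function.Injective ![i, k]) (h2 : Function.Injective ![i, j, l])
    (h3 : Function.Injective ![k, l]) :
    leg ![i, k] (Xop n lam) h1 * leg ![i, j, l] (Yt n lam) h2 * leg ![k, l] (Yop n lam) h3 =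
      leg ![k, l] (Yop n lam) h3 * leg ![i, j, l] (Yt n lam) h2 * leg ![i, k] (Xop n lam) h1 := by
  have := congrArg (fun T => leg ![i, j, k, l] T h) (X_Yt_Y n lam)
  simpa [leg_mul, leg_leg_two, leg_leg_three] using this

theorem leg_Xt_X_X {m : ℕ} (i j k l : Fin m) (h : Function.Injective ![i, j, k, l])
    (h1 : Function.Injective ![i, j, k]) (h2 : Function.Injective ![i, l])
    (h3 : Function.Injective ![j, l]) :
    leg ![i, j, k] (Xt n lam) h1 * leg ![i, l] (Xop n lam) h2 * leg ![j, l] (Xop n lam) h3 =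
      leg ![j, l] (Xop n lam) h3 * leg ![i, l] (Xop n lam) h2 * leg ![i, j, k] (Xt n lam) h1 := by
  have := congrArg (fun T => leg ![i, j, k, l] T h) (Xt_X_X n lam)
  simpa [leg_mul, leg_leg_two, leg_leg_three] using this

theorem Rmat_VD_VD : (leg ![0, 1, 2, 3] (Rmat n lam) * leg ![0, 1, 4, 5] (VD n lam) *
    leg ![2, 3, 4, 5] (VD n lam) : Op n 6) =
    leg ![2, 3, 4, 5] (VD n lam) * leg ![0, 1, 4, 5] (VD n lam) *
      leg ![0, 1, 2, 3] (Rmat n lam) := by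
  have c2 : (leg ![0, 4] (Xop n lam) * leg ![2, 3, 5] (Yt n lam) : Op n 6) = _ :=
    leg_commute _ _ (by decide) (by decide) (by decide)
  have c4 : (leg ![0, 1, 5] (Yt n lam) * leg ![2, 3] (star (Zop n lam)) : Op n 6) = _ :=
    leg_commute _ _ (by decide) (by decide) (by decide)
  rw [leg_VD n lam 0 1 4 5 _ (by decide) (by decide), leg_VD n lam 2 3 4 5 _ (by decide) (by decide),
    leg_Rmat n lam 0 1 2 3 _ (by decide)]
  rw [leg_star] at c4
  rw [leg_Yt n lam 2 3 5 _ (by decide) (by decide)] at c2 ⊢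
  exact intertwine_aux (leg_Xt n lam 0 2 3 _ _ (by decide))
    (leg_mem_unitary (Z_mem_unitary n lam) _).1 (leg_X_Yt_Y n lam 0 1 3 5 (by decide) _ _ _)
    (leg_Xt_X_X n lam 0 2 3 4 (by decide) _ _ _) (leg_commute _ _ _ _ (by decide)) c2
    (leg_commute _ _ _ _ (by decide)) c4

theorem Rmat_VD_left : (leg ![2, 3, 4, 5] (Rmat n lam) * leg ![0, 1, 2, 3] (VD n lam) : Op n 6) =
    leg ![0, 1, 2, 3] (VD n lam) * leg ![0, 1, 4, 5] (Rmat n lam) *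
      leg ![2, 3, 4, 5] (Rmat n lam) := by
  rw [leg_VD n lam 0 1 2 3 _ (by decide) (by decide), leg_Rmat n lam 0 1 4 5 _ (by decide),
    leg_Rmat n lam 2 3 4 5 _ (by decide), leg_Xt n lam 2 4 5 _ (by decide) (by decide),
    leg_Xt n lam 0 4 5 _ (by decide) (by decide), ← leg_star]
  refine comul_left_aux ?_ (leg_pentagon_X n lam 0 2 5 (by decide) _ _ _)
    (leg_commute _ _ _ _ (by decide)) (leg_commute _ _ _ _ (by decide))
    (leg_commute _ _ _ _ (by decide)) (leg_commute _ _ _ _ (by decide))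
    (leg_commute _ _ _ _ (by decide))
  rw [leg_star]
  exact (leg_mem_unitary (Z_mem_unitary n lam) _).1

theorem X_Yt_comul : (leg ![0, 5] (Xop n lam) * leg ![2, 3, 5] (Yt n lam) : Op n 6) =
    leg ![2, 3, 5] (Yt n lam) * leg ![0, 5] (Xop n lam) * leg ![0, 2, 3] (Xt n lam) := by
  have hu := leg_mem_unitary (f := (![5, 3] : Fin 2 → Fin 6)) (X_mem_unitary n lam) (by decide)
  rw [leg_Yt n lam 2 3 5 _ (by decide) (by decide), leg_Xt n lam 0 2 3 _ (by decide) (by decide),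
    ← leg_star]
  refine comul_key_aux ?_ ?_ ?_ (leg_pentagon_X n lam 0 5 3 (by decide) (by decide) _ (by decide))
    (leg_commute _ _ _ _ (by decide)) (leg_commute _ _ _ _ (by decide))
  · rw [leg_star]
    exact (leg_mem_unitary (Z_mem_unitary n lam) _).1
  · rw [leg_Y n lam 3 5 _ (by decide)]
    exact hu.1
  · rw [leg_Y n lam 3 5 _ (by decide)]
    exact hu.2

theorem Rmat_VD_right : (leg ![0, 1, 4, 5] (Rmat n lam) * leg ![2, 3, 4, 5] (VD n lam) : Op n 6) =
    leg ![2, 3, 4, 5] (VD n lam) * leg ![0, 1, 4, 5] (Rmat n lam) *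
      leg ![0, 1, 2, 3] (Rmat n lam) := by
  rw [leg_VD n lam 2 3 4 5 _ (by decide) (by decide), leg_Rmat n lam 0 1 4 5 _ (by decide),
    leg_Rmat n lam 0 1 2 3 _ (by decide), leg_Xt n lam 0 4 5 _ (by decide) (by decide), ← leg_star]
  refine comul_right_aux ?_ ?_ (leg_Z_X_Yt n lam 2 3 4 5 (by decide) _ _ _) (X_Yt_comul n lam)
    (leg_commute _ _ _ _ (by decide)) (leg_commute _ _ _ _ (by decide))
  · rw [leg_star]
    exact (leg_mem_unitary (Z_mem_unitary n lam) _).2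
  · rw [leg_star]
    exact (leg_mem_unitary (Z_mem_unitary n lam) _).1

theorem yang_baxter : (leg ![0, 1, 2, 3] (Rmat n lam) * leg ![0, 1, 4, 5] (Rmat n lam) *
    leg ![2, 3, 4, 5] (Rmat n lam) : Op n 6) =
    leg ![2, 3, 4, 5] (Rmat n lam) * leg ![0, 1, 4, 5] (Rmat n lam) *
      leg ![0, 1, 2, 3] (Rmat n lam) := by
  rw [leg_Rmat n lam 0 1 4 5 _ (by decide), leg_Rmat n lam 2 3 4 5 _ (by decide),
    leg_Rmat n lam 0 1 2 3 _ (by decide), leg_Xt n lam 0 4 5 _ (by decide) (by decide),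
    leg_Xt n lam 2 4 5 _ (by decide) (by decide), ← leg_star]
  refine yang_baxter_aux ?_ (leg_Xt_X_X n lam 0 2 3 5 (by decide) _ _ _)
    (leg_commute _ _ _ _ (by decide)) (leg_commute _ _ _ _ (by decide))
  rw [leg_star]
  exact (leg_mem_unitary (Z_mem_unitary n lam) _).1

end Identities

/-! ## Subspaces up to closure -/

section Closure

variable {A : Type*} [NormedRing A] [NormedAlgebra ℂ A]

/-- Inclusion up to closure. -/
def Cle {A : Type*} [NormedRing A] [NormedAlgebra ℂ A] (P Q : Submodule ℂ A) : Prop :=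
  P ≤ Q.topologicalClosure

/-- Equality up to closure. -/
def Ceq {A : Type*} [NormedRing A] [NormedAlgebra ℂ A] (P Q : Submodule ℂ A) : Prop :=
  Cle P Q ∧ Cle Q P

variable {P Q R P' Q' : Submodule ℂ A}

theorem Cle.of_le (h : P ≤ Q) : Cle P Q := h.trans Q.le_topologicalClosure

theorem Cle.refl (P : Submodule ℂ A) : Cle P P := Cle.of_le le_rfl

theorem Cle.trans (h : Cle P Q) (h' : Cle Q R) : Cle P R :=
  le_trans (a := P) (b := Q.topologicalClosure) h
    (Submodule.topologicalClosure_minimal Q h' R.isClosed_topologicalClosure)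

theorem Cle.mul (h : Cle P P') (h' : Cle Q Q') : Cle (P * Q) (P' * Q') :=
  Submodule.mul_le.2 fun _ ha _ hb =>
    map_mem_closure₂ continuous_mul (h ha) (h' hb) fun _ hx _ hy => Submodule.mul_mem_mul hx hy

theorem Cle.map {B : Type*} [NormedRing B] [NormedAlgebra ℂ B] (h : Cle P Q) (f : A →ₗ[ℂ] B)
    (hf : Continuous f) : Cle (P.map f) (Q.map f) := by
  rintro _ ⟨a, ha, rfl⟩
  exact map_mem_closure hf (h ha) fun x hx => Submodule.mem_map_of_mem hx

theorem Ceq.refl (P : Submodule ℂ A) : Ceq P P := ⟨Cle.refl P, Cle.refl P⟩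

theorem Ceq.of_eq (h : P = Q) : Ceq P Q := h ▸ Ceq.refl P

theorem Ceq.symm (h : Ceq P Q) : Ceq Q P := ⟨h.2, h.1⟩

theorem Ceq.trans (h : Ceq P Q) (h' : Ceq Q R) : Ceq P R :=
  ⟨h.1.trans h'.1, h'.2.trans h.2⟩

theorem Ceq.mul (h : Ceq P P') (h' : Ceq Q Q') : Ceq (P * Q) (P' * Q') :=
  ⟨h.1.mul h'.1, h.2.mul h'.2⟩

/-- The line spanned by an operator. -/
abbrev line (a : A) : Submodule ℂ A := Submodule.span ℂ {a}

theorem line_mul_line (a b : A) : line a * line b = line (a * b) := by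
  rw [line, line, Submodule.span_mul_span, Set.singleton_mul_singleton]

theorem line_one_mul (P : Submodule ℂ A) : line 1 * P = P := by
  change Submodule.span ℂ {(1 : A)} * P = P
  rw [← Submodule.one_eq_span, one_mul]

theorem mul_line_one (P : Submodule ℂ A) : P * line 1 = P := by
  change P * Submodule.span ℂ {(1 : A)} = P
  rw [← Submodule.one_eq_span, mul_one]

theorem submodule_mul_comm (h : ∀ p ∈ P, ∀ q ∈ Q, p * q = q * p) : P * Q = Q * P := by
  apply le_antisymm
  · exact Submodule.mul_le.2 fun p hp q hq => by
      rw [h p hp q hq]; exact Submodule.mul_mem_mul hq hp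
  · exact Submodule.mul_le.2 fun q hq p hp => by
      rw [← h p hp q hq]; exact Submodule.mul_mem_mul hp hq

variable [StarRing A] [StarModule ℂ A]

/-- The adjoints of the elements of a subspace. -/
def adj {A : Type*} [NormedRing A] [NormedAlgebra ℂ A] [StarRing A] [StarModule ℂ A]
    (P : Submodule ℂ A) : Submodule ℂ A :=
  P.map (starLinearEquiv ℂ : A ≃ₗ⋆[ℂ] A).toLinearMap

theorem mem_adj {a : A} : a ∈ adj P ↔ star a ∈ P := by
  constructor
  · rintro ⟨b, hb, rfl⟩
    simpa using hb
  · intro h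
    exact ⟨star a, h, by simp⟩

theorem adj_adj (P : Submodule ℂ A) : adj (adj P) = P := by
  ext a; simp [mem_adj]

theorem adj_mul (P Q : Submodule ℂ A) : adj (P * Q) = adj Q * adj P := by
  have key : ∀ P Q : Submodule ℂ A, adj (P * Q) ≤ adj Q * adj P := by
    intro P Q
    rintro _ ⟨a, ha, rfl⟩
    induction ha using Submodule.mul_induction_on' with
    | mem_mul_mem p hp q hq =>
      change star (p * q) ∈ _
      rw [star_mul]
      exact Submodule.mul_mem_mul (mem_adj.2 (by simpa using hq)) (mem_adj.2 (by simpa using hp))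
    | add x _ y _ hx hy => rw [map_add]; exact add_mem hx hy
  refine le_antisymm (key P Q) fun a ha => ?_
  have h1 : star a ∈ adj (adj Q * adj P) := mem_adj.2 (by simpa using ha)
  have h2 := key _ _ h1
  rw [adj_adj, adj_adj] at h2
  exact mem_adj.2 h2

theorem adj_line (a : A) : adj (line a) = line (star a) := by
  rw [adj, line, Submodule.map_span, Set.image_singleton]
  rfl

theorem Cle.adj [ContinuousStar A] (h : Cle P Q) : Cle (adj P) (adj Q) := by
  intro a ha
  have h1 := map_mem_closure continuous_star (h (mem_adj.1 ha)) (t := QDouble.adj Q)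
    fun x hx => mem_adj.2 (by simpa using hx)
  rwa [star_star] at h1

end Closure

/-! ## Finite rank operators and slices -/

section Slices

variable {n k l m : ℕ}

/-- The image of a space of operators under leg numbering. -/
def LL (f : Fin k → Fin m) (P : Submodule ℂ (Op n k)) (hf : Function.Injective f := by decide) :
    Submodule ℂ (Op n m) := P.map (legHom n f hf).toAlgHom.toLinearMap

theorem leg_mem_LL {f : Fin k → Fin m} {P : Submodule ℂ (Op n k)} (hf : Function.Injective f)
    {T : Op n k} (hT : T ∈ P) : leg f T hf ∈ LL f P hf := Submodule.mem_map_of_mem hT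

theorem LL_mul {f : Fin k → Fin m} (hf : Function.Injective f) (P Q : Submodule ℂ (Op n k)) :
    LL f (P * Q) hf = LL f P hf * LL f Q hf :=
  Submodule.map_mul P Q (legHom n f hf : Op n k →ₐ[ℂ] Op n m)

theorem LL_line {f : Fin k → Fin m} (hf : Function.Injective f) (T : Op n k) :
    LL f (line T) hf = line (leg f T hf) := by
  rw [LL, line, Submodule.map_span, Set.image_singleton]
  rfl

theorem continuous_leg (f : Fin k → Fin m) (hf : Function.Injective f) :
    Continuous fun T : Op n k => leg f T hf := map_continuous (legHom n f hf)

theorem Cle.LL {P Q : Submodule ℂ (Op n k)} (h : Cle P Q) (f : Fin k → Fin m)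
    (hf : Function.Injective f) : Cle (LL f P hf) (LL f Q hf) := h.map _ (continuous_leg f hf)

theorem Ceq.LL {P Q : Submodule ℂ (Op n k)} (h : Ceq P Q) (f : Fin k → Fin m)
    (hf : Function.Injective f) : Ceq (LL f P hf) (LL f Q hf) := ⟨h.1.LL f hf, h.2.LL f hf⟩

theorem LL_LL (f : Fin l → Fin m) (g : Fin k → Fin l) (P : Submodule ℂ (Op n k))
    (hf : Function.Injective f) (hg : Function.Injective g) :
    LL f (LL g P hg) hf = LL (f ∘ g) P (hf.comp hg) := by
  rw [LL, LL, LL, ← Submodule.map_comp]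
  congr 1
  ext1 T
  exact leg_leg f g T hg hf

theorem LL_LL_eq (f : Fin l → Fin m) (g : Fin k → Fin l) (h : Fin k → Fin m)
    (P : Submodule ℂ (Op n k)) (hf : Function.Injective f) (hg : Function.Injective g)
    (hh : Function.Injective h) (e : ∀ i, f (g i) = h i) :
    LL f (LL g P hg) hf = LL h P hh := by
  obtain rfl : f ∘ g = h := funext e
  exact LL_LL f g P hf hg

theorem LL_comm {f : Fin k → Fin m} {g : Fin l → Fin m} (P : Submodule ℂ (Op n k))
    (Q : Submodule ℂ (Op n l)) (hf : Function.Injective f) (hg : Function.Injective g)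
    (h : ∀ i j, f i ≠ g j) : LL f P hf * LL g Q hg = LL g Q hg * LL f P hf := by
  refine submodule_mul_comm ?_
  rintro _ ⟨S, hS, rfl⟩ _ ⟨T, hT, rfl⟩
  exact leg_commute S T hf hg h

theorem adj_LL {f : Fin k → Fin m} (hf : Function.Injective f) (P : Submodule ℂ (Op n k)) :
    adj (LL f P hf) = LL f (adj P) hf := by
  ext T
  constructor
  · intro h
    obtain ⟨S, hS, hST⟩ := mem_adj.1 h
    refine ⟨star S, mem_adj.2 (by simpa using hS), ?_⟩
    rw [← star_star T, ← hST]
    exact leg_star f S hf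
  · rintro ⟨S, hS, rfl⟩
    exact mem_adj.2 ⟨star S, mem_adj.1 hS, leg_star f S hf⟩

open InnerProductSpace

/-- Finite rank operators. -/
def FR (n k : ℕ) : Submodule ℂ (Op n k) :=
  Submodule.span ℂ {T | ∃ ξ η, T = rankOne ℂ ξ η}

theorem rankOne_mem_FR (ξ η : HT n k) : rankOne ℂ ξ η ∈ FR n k :=
  Submodule.subset_span ⟨ξ, η, rfl⟩

theorem mul_rankOne (T : Op n k) (ξ η : HT n k) : T * rankOne ℂ ξ η = rankOne ℂ (T ξ) η :=
  comp_rankOne ξ η T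

theorem rankOne_mul (T : Op n k) (ξ η : HT n k) :
    rankOne ℂ ξ η * T = rankOne ℂ ξ (star T η) := by
  ext1 u
  simp [ContinuousLinearMap.star_eq_adjoint, ContinuousLinearMap.adjoint_inner_left]

theorem line_mul_FR_le (T : Op n k) : line T * FR n k ≤ FR n k := by
  rw [FR, line, Submodule.span_mul_span, Submodule.span_le]
  rintro _ ⟨_, rfl, _, ⟨ξ, η, rfl⟩, rfl⟩
  simp only [mul_rankOne]
  exact rankOne_mem_FR _ _

theorem FR_mul_line_le (T : Op n k) : FR n k * line T ≤ FR n k := by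
  rw [FR, line, Submodule.span_mul_span, Submodule.span_le]
  rintro _ ⟨_, ⟨ξ, η, rfl⟩, _, rfl, rfl⟩
  simp only [rankOne_mul]
  exact rankOne_mem_FR _ _

theorem line_mul_FR {T : Op n k} (hT : T ∈ unitary (Op n k)) : line T * FR n k = FR n k := by
  refine le_antisymm (line_mul_FR_le T) ?_
  calc FR n k = line T * (line (star T) * FR n k) := by
        rw [← mul_assoc, line_mul_line, hT.2, line_one_mul]
    _ ≤ _ := mul_le_mul' le_rfl (line_mul_FR_le _)

theorem FR_mul_line {T : Op n k} (hT : T ∈ unitary (Op n k)) : FR n k * line T = FR n k := by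
  refine le_antisymm (FR_mul_line_le T) ?_
  calc FR n k = (FR n k * line (star T)) * line T := by
        rw [mul_assoc (FR n k), line_mul_line, hT.1, mul_line_one]
    _ ≤ _ := mul_le_mul' (FR_mul_line_le _) le_rfl

theorem FR_mul_FR_le (n k : ℕ) : FR n k * FR n k ≤ FR n k := by
  conv_lhs => rw [FR]
  rw [Submodule.span_mul_span, Submodule.span_le]
  rintro _ ⟨_, ⟨ξ, η, rfl⟩, _, ⟨ξ', η', rfl⟩, rfl⟩
  simp only [rankOne_mul]
  exact rankOne_mem_FR _ _

theorem adj_FR (n k : ℕ) : adj (FR n k) = FR n k := by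
  have : ∀ T ∈ FR n k, star T ∈ FR n k := by
    intro T hT
    have : FR n k ≤ adj (FR n k) := Submodule.span_le.2 (by
      rintro _ ⟨ξ, η, rfl⟩
      refine mem_adj.2 ?_
      rw [ContinuousLinearMap.star_eq_adjoint, adjoint_rankOne]
      exact rankOne_mem_FR _ _)
    exact mem_adj.1 (this hT)
  ext T
  exact ⟨fun h => by simpa using this _ (mem_adj.1 h), fun h => mem_adj.2 (this _ h)⟩

/-- The slice `(id ⊗ ω_{ζ,ζ'})(T)`. -/
def sl (d : Fin k ⊕ Fin l ≃ Fin m) (ζ ζ' : HT n l) (T : Op n m) : Op n k :=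
  (ContinuousLinearMap.adjoint (tmulRight d ζ')).comp (T.comp (tmulRight d ζ))

theorem tmulRight_apply (d : Fin k ⊕ Fin l ≃ Fin m) (ζ : HT n l) (ξ : HT n k) :
    tmulRight d ζ ξ = tmul d ξ ζ := rfl

theorem inner_sl (d : Fin k ⊕ Fin l ≃ Fin m) (ζ ζ' : HT n l) (T : Op n m) (ξ ξ' : HT n k) :
    inner ℂ ξ' (sl d ζ ζ' T ξ) = inner ℂ (tmul d ξ' ζ') (T (tmul d ξ ζ)) := by
  rw [sl, ContinuousLinearMap.comp_apply, ContinuousLinearMap.adjoint_inner_right]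
  rfl

/-- The span of the slices by vector functionals. -/
def SL (d : Fin k ⊕ Fin l ≃ Fin m) (T : Op n m) : Submodule ℂ (Op n k) :=
  Submodule.span ℂ {S | ∃ ζ ζ', S = sl d ζ ζ' T}

theorem sl_mem_SL (d : Fin k ⊕ Fin l ≃ Fin m) (T : Op n m) (ζ ζ' : HT n l) :
    sl d ζ ζ' T ∈ SL d T := Submodule.subset_span ⟨ζ, ζ', rfl⟩

theorem star_sl (d : Fin k ⊕ Fin l ≃ Fin m) (ζ ζ' : HT n l) (T : Op n m) :
    star (sl d ζ ζ' T) = sl d ζ' ζ (star T) := by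
  simp [sl, ContinuousLinearMap.star_eq_adjoint, ContinuousLinearMap.adjoint_comp,
    ContinuousLinearMap.comp_assoc]

theorem adj_SL (d : Fin k ⊕ Fin l ≃ Fin m) (T : Op n m) : adj (SL d T) = SL d (star T) := by
  rw [adj, SL, Submodule.map_span]
  congr 1
  ext S
  constructor
  · rintro ⟨_, ⟨ζ, ζ', rfl⟩, rfl⟩
    exact ⟨ζ', ζ, star_sl d ζ ζ' T⟩
  · rintro ⟨ζ, ζ', rfl⟩
    exact ⟨_, ⟨ζ', ζ, rfl⟩, star_sl d ζ' ζ T⟩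

variable {f : Fin k → Fin m} {g : Fin l → Fin m}

theorem leg_fst_tmul (d : Fin k ⊕ Fin l ≃ Fin m) (hf : Function.Injective f)
    (hd : ∀ i, d (Sum.inl i) = f i) (T : Op n k) (ξ : HT n k) (ζ : HT n l) :
    leg f T hf (tmul d ξ ζ) = tmul d (T ξ) ζ := by
  rw [← ampl_eq_leg d f hd hf, ampl_tmul]

theorem leg_snd_tmul (d : Fin k ⊕ Fin l ≃ Fin m) (hg : Function.Injective g)
    (hd : ∀ i, d (Sum.inr i) = g i) (T : Op n l) (ξ : HT n k) (ζ : HT n l) :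
    leg g T hg (tmul d ξ ζ) = tmul d ξ (T ζ) := by
  rw [← ampl_eq_leg (swapE d) g hd hg, ampl_swap_tmul]

/-- In bra-ket notation on the legs g, ⟨β| T |γ⟩ is an operator on the legs f, namely a slice of T,
and |α⟩⟨δ| is what remains outside. This links slices with products of spaces of operators. -/
theorem rankOne_mul_mul_rankOne (d : Fin k ⊕ Fin l ≃ Fin m) (hf : Function.Injective f)
    (hg : Function.Injective g) (hdf : ∀ i, d (Sum.inl i) = f i)
    (hdg : ∀ i, d (Sum.inr i) = g i) (T : Op n m) (α β γ δ : HT n l) :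
    leg g (rankOne ℂ α β) hg * T * leg g (rankOne ℂ γ δ) hg =
      leg g (rankOne ℂ α δ) hg * leg f (sl d γ β T) hf := by
  refine op_ext_inner_tmul d d fun a b a' b' => ?_
  have h1 : star (leg g (rankOne ℂ α β) hg : Op n m) = leg g (rankOne ℂ β α) hg := by
    rw [← leg_star, ContinuousLinearMap.star_eq_adjoint, adjoint_rankOne]
  rw [mul_apply_eq_comp, mul_apply_eq_comp, mul_apply_eq_comp, leg_fst_tmul d hf hdf,
    leg_snd_tmul d hg hdg, leg_snd_tmul d hg hdg, ← ContinuousLinearMap.adjoint_inner_left,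
    ← ContinuousLinearMap.star_eq_adjoint, h1, leg_snd_tmul d hg hdg, rankOne_apply,
    rankOne_apply, rankOne_apply, tmul_smul_right, tmul_smul_right, tmul_smul_right, map_smul,
    inner_smul_right, inner_smul_right, inner_smul_left, inner_tmul, inner_sl, inner_conj_symm]
  ring

/-- Compressing by finite rank operators amounts to slicing. -/
theorem FR_mul_mul_FR (d : Fin k ⊕ Fin l ≃ Fin m) (hf : Function.Injective f)
    (hg : Function.Injective g) (hdf : ∀ i, d (Sum.inl i) = f i)
    (hdg : ∀ i, d (Sum.inr i) = g i) (T : Op n m) :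
    LL g (FR n l) hg * line T * LL g (FR n l) hg = LL g (FR n l) hg * LL f (SL d T) hf := by
  simp only [LL, FR, SL, line, Submodule.map_span, Submodule.span_mul_span]
  apply le_antisymm
  · rw [Submodule.span_le]
    rintro _ ⟨_, ⟨_, ⟨_, ⟨α, β, rfl⟩, rfl⟩, T', rfl, rfl⟩, _, ⟨_, ⟨γ, δ, rfl⟩, rfl⟩, rfl⟩
    have := rankOne_mul_mul_rankOne d hf hg hdf hdg T' α β γ δ
    refine (congrArg (· ∈ _) this).mpr (Submodule.subset_span ?_)
    exact ⟨_, ⟨_, ⟨α, δ, rfl⟩, rfl⟩, _, ⟨_, ⟨γ, β, rfl⟩, rfl⟩, rfl⟩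
  · rw [Submodule.span_le]
    rintro _ ⟨_, ⟨_, ⟨α, δ, rfl⟩, rfl⟩, _, ⟨_, ⟨γ, β, rfl⟩, rfl⟩, rfl⟩
    have := rankOne_mul_mul_rankOne d hf hg hdf hdg T α β γ δ
    refine (congrArg (· ∈ _) this).mp (Submodule.subset_span ?_)
    exact ⟨_, ⟨_, ⟨_, ⟨α, β, rfl⟩, rfl⟩, _, rfl, rfl⟩, _, ⟨_, ⟨γ, δ, rfl⟩, rfl⟩, rfl⟩

end Slices

/-! ### Finite rank operators on tensor products and removal of compact legs. -/

section Slices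

open InnerProductSpace

variable {n k l m : ℕ}

/-- The normalised indicator of a closed ball. A unit vector is needed whenever a spectator leg is
sliced away. -/
theorem exists_unit (n k : ℕ) : ∃ ζ : HT n k, inner ℂ ζ ζ = 1 := by
  have := sigmaFinite_pt n
  have : Measure.IsOpenPosMeasure (volume : Measure (Pt n)) :=
    inferInstanceAs (Measure.IsOpenPosMeasure ((volume : Measure (Fin n → ℝ)).prod
      ((volume : Measure (Fin n → ℝ)).prod (volume : Measure ℝ))))
  have : IsFiniteMeasureOnCompacts (volume : Measure (Pt n)) :=
    inferInstanceAs (IsFiniteMeasureOnCompacts ((volume : Measure (Fin n → ℝ)).prod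
      ((volume : Measure (Fin n → ℝ)).prod (volume : Measure ℝ))))
  have : Measure.IsOpenPosMeasure (volume : Measure (Fin k → Pt n)) :=
    inferInstanceAs (Measure.IsOpenPosMeasure (Measure.pi fun _ => volume))
  have : IsLocallyFiniteMeasure (volume : Measure (Fin k → Pt n)) :=
    inferInstanceAs (IsLocallyFiniteMeasure (Measure.pi fun _ => volume))
  have h0 : (volume : Measure (Fin k → Pt n)) (Metric.closedBall 0 1) ≠ 0 :=
    (Metric.measure_closedBall_pos _ _ one_pos).ne'
  have h1 : (volume : Measure (Fin k → Pt n)) (Metric.closedBall 0 1) ≠ ∞ :=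
    (isCompact_closedBall _ _).measure_lt_top.ne
  let v : HT n k := indicatorConstLp 2 Metric.isClosed_closedBall.measurableSet h1 (1 : ℂ)
  have hv : v ≠ 0 := by
    rw [← norm_ne_zero_iff, norm_indicatorConstLp (by norm_num) (by norm_num)]
    have : (volume : Measure (Fin k → Pt n)).real (Metric.closedBall 0 1) ≠ 0 :=
      ENNReal.toReal_ne_zero.2 ⟨h0, h1⟩
    simp only [norm_one, one_mul]
    exact (Real.rpow_pos_of_pos (lt_of_le_of_ne measureReal_nonneg this.symm) _).ne'
  refine ⟨((‖v‖⁻¹ : ℝ) : ℂ) • v, ?_⟩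
  rw [inner_self_eq_norm_sq_to_K, norm_smul]
  simp [norm_ne_zero_iff.2 hv]

theorem FR_mul_FR (n k : ℕ) : FR n k * FR n k = FR n k := by
  refine le_antisymm (FR_mul_FR_le n k) (Submodule.span_le.2 ?_)
  rintro _ ⟨ξ, η, rfl⟩
  obtain ⟨ζ, hζ⟩ := exists_unit n k
  have : rankOne ℂ ξ η = rankOne ℂ ξ ζ * rankOne ℂ ζ η := by
    rw [mul_rankOne, rankOne_apply, hζ, one_smul]
  rw [this]
  exact Submodule.mul_mem_mul (rankOne_mem_FR _ _) (rankOne_mem_FR _ _)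

variable {f : Fin k → Fin m} {g : Fin l → Fin m}

theorem leg_rankOne_mul_leg_rankOne (d : Fin k ⊕ Fin l ≃ Fin m) (hf : Function.Injective f)
    (hg : Function.Injective g) (hdf : ∀ i, d (Sum.inl i) = f i)
    (hdg : ∀ i, d (Sum.inr i) = g i) (α β : HT n k) (γ δ : HT n l) :
    leg f (rankOne ℂ α β) hf * leg g (rankOne ℂ γ δ) hg =
      rankOne ℂ (tmul d α γ) (tmul d β δ) := by
  refine clm_ext_tmul d fun a b => ?_
  rw [mul_apply_eq_comp, leg_snd_tmul d hg hdg, leg_fst_tmul d hf hdf, rankOne_apply,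
    rankOne_apply, rankOne_apply, tmul_smul_left, tmul_smul_right, inner_tmul, smul_smul]

/-- A subspace of operators contains all rank one operators up to closure, if it contains those
coming from elementary tensors. -/
theorem FR_cle_of_tmul {k' l' : ℕ} (d : Fin k ⊕ Fin l ≃ Fin m) (d' : Fin k' ⊕ Fin l' ≃ Fin m)
    (P : Submodule ℂ (Op n m))
    (h : ∀ α γ β δ, rankOne ℂ (tmul d α γ) (tmul d' β δ) ∈ P.topologicalClosure) :
    Cle (FR n m) P := by
  refine Submodule.span_le.2 ?_
  rintro _ ⟨u, v, rfl⟩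
  have c1 : ∀ w : HT n m, Continuous fun u : HT n m => (rankOne ℂ u w : Op n m) := fun w =>
    ((rankOne ℂ : HT n m →L[ℂ] HT n m →L⋆[ℂ] Op n m).flip w).continuous
  have c2 : ∀ u : HT n m, Continuous fun w : HT n m => (rankOne ℂ u w : Op n m) := fun u =>
    (rankOne ℂ u : HT n m →L⋆[ℂ] Op n m).continuous
  have h1 : ∀ u β δ, rankOne ℂ u (tmul d' β δ) ∈ P.topologicalClosure := fun u β δ =>
    mem_of_tmul_mem d (V :=
      { carrier := {u | rankOne ℂ u (tmul d' β δ) ∈ P.topologicalClosure}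
        zero_mem' := by simp
        add_mem' := fun {a b} ha hb => by
          simp only [Set.mem_ofPred_eq, map_add, add_apply]
          exact add_mem ha hb
        smul_mem' := fun r a ha => by
          simp only [Set.mem_ofPred_eq, map_smul, smul_apply]
          exact Submodule.smul_mem _ _ ha })
      (P.isClosed_topologicalClosure.preimage (c1 _)) (fun a b => h a b β δ) u
  exact mem_of_tmul_mem d' (V :=
      { carrier := {v | rankOne ℂ u v ∈ P.topologicalClosure}
        zero_mem' := by simp
        add_mem' := fun {a b} ha hb => by
          simp only [Set.mem_ofPred_eq, map_add]
          exact add_mem ha hb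
        smul_mem' := fun r a ha => by
          simp only [Set.mem_ofPred_eq, map_smulₛₗ]
          exact Submodule.smul_mem _ _ ha })
      (P.isClosed_topologicalClosure.preimage (c2 _)) (fun a b => h1 u a b) v

theorem LL_FR_mul_LL_FR_le (d : Fin k ⊕ Fin l ≃ Fin m) (hf : Function.Injective f)
    (hg : Function.Injective g) (hdf : ∀ i, d (Sum.inl i) = f i)
    (hdg : ∀ i, d (Sum.inr i) = g i) :
    LL f (FR n k) hf * LL g (FR n l) hg ≤ FR n m := by
  simp only [LL, FR, Submodule.map_span, Submodule.span_mul_span]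
  rw [Submodule.span_le]
  rintro _ ⟨_, ⟨_, ⟨α, β, rfl⟩, rfl⟩, _, ⟨_, ⟨γ, δ, rfl⟩, rfl⟩, rfl⟩
  have := leg_rankOne_mul_leg_rankOne d hf hg hdf hdg α β γ δ
  exact (congrArg (· ∈ _) this).mpr (Submodule.subset_span ⟨_, _, rfl⟩)

/-- Finite rank operators on a tensor product. -/
theorem LL_FR_mul_LL_FR (d : Fin k ⊕ Fin l ≃ Fin m) (hf : Function.Injective f)
    (hg : Function.Injective g) (hdf : ∀ i, d (Sum.inl i) = f i)
    (hdg : ∀ i, d (Sum.inr i) = g i) :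
    Ceq (LL f (FR n k) hf * LL g (FR n l) hg) (FR n m) := by
  refine ⟨Cle.of_le (LL_FR_mul_LL_FR_le d hf hg hdf hdg), FR_cle_of_tmul d d _ ?_⟩
  intro α γ β δ
  refine Submodule.le_topologicalClosure _ ?_
  rw [← leg_rankOne_mul_leg_rankOne d hf hg hdf hdg]
  exact Submodule.mul_mem_mul (leg_mem_LL hf (rankOne_mem_FR _ _))
    (leg_mem_LL hg (rankOne_mem_FR _ _))

theorem sl_mul_leg (d : Fin k ⊕ Fin l ≃ Fin m) (hf : Function.Injective f)
    (hg : Function.Injective g) (hdf : ∀ i, d (Sum.inl i) = f i)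
    (hdg : ∀ i, d (Sum.inr i) = g i) (ζ : HT n l) (T : Op n l) (S : Op n k) :
    sl d ζ ζ (leg g T hg * leg f S hf) = inner ℂ ζ (T ζ) • S := by
  ext1 ξ
  refine ext_inner_left ℂ fun ξ' => ?_
  rw [inner_sl, mul_apply_eq_comp, leg_fst_tmul d hf hdf, leg_snd_tmul d hg hdg, inner_tmul]
  simp [inner_smul_right, mul_comm]

theorem sl_add (d : Fin k ⊕ Fin l ≃ Fin m) (ζ ζ' : HT n l) (S T : Op n m) :
    sl d ζ ζ' (S + T) = sl d ζ ζ' S + sl d ζ ζ' T := by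
  simp [sl, ContinuousLinearMap.add_comp, ContinuousLinearMap.comp_add]

theorem continuous_sl (d : Fin k ⊕ Fin l ≃ Fin m) (ζ ζ' : HT n l) :
    Continuous fun T : Op n m => sl d ζ ζ' T := by
  unfold sl
  fun_prop

/-- Compact legs can be removed. -/
theorem cle_of_FR_mul (d : Fin k ⊕ Fin l ≃ Fin m) (hf : Function.Injective f)
    (hg : Function.Injective g) (hdf : ∀ i, d (Sum.inl i) = f i)
    (hdg : ∀ i, d (Sum.inr i) = g i) {P Q : Submodule ℂ (Op n k)}
    (h : Cle (LL g (FR n l) hg * LL f P hf) (LL g (FR n l) hg * LL f Q hf)) : Cle P Q := by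
  intro S hS
  obtain ⟨ζ, hζ⟩ := exists_unit n l
  have h1 : leg g (rankOne ℂ ζ ζ) hg * leg f S hf ∈
      LL g (FR n l) hg * LL f P hf :=
    Submodule.mul_mem_mul (leg_mem_LL hg (rankOne_mem_FR _ _)) (leg_mem_LL hf hS)
  -- The slice by ω_{ζ,ζ} is continuous, sends the right hand space into Q, and returns S from
  -- |ζ⟩⟨ζ| ⊗ S since ‖ζ‖ = 1.
  have h2 := map_mem_closure (continuous_sl d ζ ζ) (h h1) (t := Q) fun T hT => by
    have hT' : T ∈ LL g (FR n l) hg * LL f Q hf := hT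
    induction hT' using Submodule.mul_induction_on' with
    | mem_mul_mem p hp q hq =>
      obtain ⟨p, -, rfl⟩ := hp
      obtain ⟨q, hq, rfl⟩ := hq
      have := sl_mul_leg d hf hg hdf hdg ζ p q
      exact (congrArg (· ∈ Q) this).mpr (Q.smul_mem _ hq)
    | add x hx y hy h1 h2 => rw [sl_add]; exact Q.add_mem (h1 hx) (h2 hy)
  rw [sl_mul_leg d hf hg hdf hdg, rankOne_apply, inner_smul_right, hζ, mul_one, one_smul] at h2
  exact h2

end Slices

/-! ### Compression of one leg among many. -/

section Compress

variable {n k l m p : ℕ}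

theorem compress (d : Fin k ⊕ Fin l ≃ Fin p) {e : Fin p → Fin m} {f : Fin k → Fin m}
    {g : Fin l → Fin m} (he : Function.Injective e) (hf : Function.Injective f)
    (hg : Function.Injective g) (hef : ∀ i, e (d (Sum.inl i)) = f i)
    (heg : ∀ i, e (d (Sum.inr i)) = g i) (T : Op n p) :
    LL g (FR n l) hg * line (leg e T he) * LL g (FR n l) hg =
      LL g (FR n l) hg * LL f (SL d T) hf := by
  have hl : Function.Injective fun i => d (Sum.inl i) := d.injective.comp Sum.inl_injective
  have hr : Function.Injective fun i => d (Sum.inr i) := d.injective.comp Sum.inr_injective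
  have h := congrArg (fun P => LL e P he)
    (FR_mul_mul_FR (n := n) d hl hr (fun _ => rfl) (fun _ => rfl) T)
  simp only [LL_mul, LL_line] at h
  rwa [LL_LL_eq e _ g _ he hr hg heg, LL_LL_eq e _ f _ he hl hf hef] at h

/-- A space of operators placed on the leg `i`. -/
def on (i : Fin m) (P : Submodule ℂ (Op n 1)) : Submodule ℂ (Op n m) :=
  LL ![i] P (Function.injective_of_subsingleton _)

theorem on_comm {i j : Fin m} (h : i ≠ j) (P Q : Submodule ℂ (Op n 1)) :
    on i P * on j Q = on j Q * on i P :=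
  LL_comm P Q _ _ fun a b => by simpa using h

theorem on_line_comm {i : Fin m} {f : Fin k → Fin m} (hf : Function.Injective f)
    (h : ∀ a, i ≠ f a) (P : Submodule ℂ (Op n 1)) (T : Op n k) :
    on i P * line (leg f T hf) = line (leg f T hf) * on i P := by
  rw [← LL_line]
  exact LL_comm P _ _ _ fun a b => by simpa using h b

theorem LL_on (f : Fin k → Fin m) (hf : Function.Injective f) (i : Fin k)
    (P : Submodule ℂ (Op n 1)) : LL f (on i P) hf = on (f i) P :=
  LL_LL_eq f _ _ P hf _ _ fun a => by simp

theorem on_mul (i : Fin m) (P Q : Submodule ℂ (Op n 1)) : on i (P * Q) = on i P * on i Q :=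
  LL_mul _ P Q

theorem adj_on (i : Fin m) (P : Submodule ℂ (Op n 1)) : adj (on i P) = on i (adj P) :=
  adj_LL _ P

theorem Ceq.on {P Q : Submodule ℂ (Op n 1)} (h : Ceq P Q) (i : Fin m) :
    Ceq (on i P) (on i Q) := h.LL _ _

theorem on_FR_mul_on_FR {i j : Fin m} (h : Function.Injective ![i, j]) :
    Ceq (on i (FR n 1) * on j (FR n 1)) (LL ![i, j] (FR n 2) h) := by
  have h1 := (LL_FR_mul_LL_FR (n := n) (firstLast 1 1) (f := ![0]) (g := ![1]) (by decide)
    (by decide) (by decide) (by decide)).LL ![i, j] h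
  rw [LL_mul] at h1
  erw [LL_on, LL_on] at h1
  exact h1

theorem compress_right {i j : Fin m} (h : Function.Injective ![i, j]) (T : Op n 2) :
    on j (FR n 1) * line (leg ![i, j] T h) * on j (FR n 1) =
      on j (FR n 1) * on i (SL (firstLast 1 1) T) :=
  compress (firstLast 1 1) h _ _ (by intro a; fin_cases a; rfl) (by intro a; fin_cases a; rfl) T

theorem compress_left {i j : Fin m} (h : Function.Injective ![i, j]) (T : Op n 2) :
    on i (FR n 1) * line (leg ![i, j] T h) * on i (FR n 1) =
      on i (FR n 1) * on j (SL (lastFirst 1 1) T) :=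
  compress (lastFirst 1 1) h _ _ (by intro a; fin_cases a; rfl) (by intro a; fin_cases a; rfl) T

end Compress

/-! ## Regular multiplicative unitaries -/

section Multiplicative

variable {n : ℕ} {W : Op n 2}

/-- `W` is a regular multiplicative unitary. -/
structure IsRegular (W : Op n 2) : Prop where
  unitary : W ∈ unitary (Op n 2)
  pentagon : (leg ![0, 1] W * leg ![0, 2] W * leg ![1, 2] W : Op n 3) = leg ![1, 2] W * leg ![0, 1] W
  regular : Ceq (on 1 (FR n 1) * line (star W) * on 0 (FR n 1)) (FR n 2)

theorem IsRegular.leg_mul_leg (hW : IsRegular W) :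
    (leg ![0, 2] W * leg ![1, 2] W : Op n 3) =
      leg ![0, 1] (star W) * (leg ![1, 2] W * leg ![0, 1] W) := by
  rw [← hW.pentagon, mul_assoc, ← mul_assoc (leg ![0, 1] (star W) : Op n 3),
    ← leg_mul, hW.unitary.1, leg_one, one_mul]

/-- Equality up to closure, as a congruence. -/
def ceqCon (A : Type*) [NormedRing A] [NormedAlgebra ℂ A] : Con (Submodule ℂ A) where
  r := Ceq
  iseqv := ⟨Ceq.refl, Ceq.symm, Ceq.trans⟩
  mul' := Ceq.mul

/-- The class of a subspace, up to closure. -/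
def cls {A : Type*} [NormedRing A] [NormedAlgebra ℂ A] : Submodule ℂ A →* (ceqCon A).Quotient :=
  (ceqCon A).mk'

theorem cls_eq {A : Type*} [NormedRing A] [NormedAlgebra ℂ A] {P Q : Submodule ℂ A} :
    cls P = cls Q ↔ Ceq P Q := (ceqCon A).eq

theorem cls_mul_eq {A : Type*} [NormedRing A] [NormedAlgebra ℂ A] {P Q R S : Submodule ℂ A}
    (h : P * Q = R * S) : cls P * cls Q = cls R * cls S := by rw [← map_mul, h, map_mul]

/-- Here k0, k1 are the finite rank operators on the legs 0 and 1, and s is the space of slices on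
leg 2. The two factors s are realised by compressing W₀₂ and W₁₂; their product is W₀₁^*W₁₂W₀₁, and
the outer unitaries are absorbed by k0 k1. -/
theorem slices_mul_aux {M : Type*} [Monoid M] {k0 k1 s w01 w01' w02 w12 : M}
    (h01 : k0 * k1 = k1 * k0) (h1s : k1 * s = s * k1)
    (h1w : k1 * w02 = w02 * k1) (h0w : k0 * w12 = w12 * k0)
    (c0 : k0 * w02 * k0 = k0 * s) (c1 : k1 * w12 * k1 = k1 * s)
    (p : w02 * w12 = w01' * (w12 * w01)) (e1 : k0 * k1 * w01' = k0 * k1)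
    (e2 : w01 * (k0 * k1) = k0 * k1) (e3 : k0 * k0 = k0) :
    k0 * k1 * (s * s) = k0 * k1 * s := by
  calc k0 * k1 * (s * s) = k0 * (k1 * s) * s := by simp only [mul_assoc]
    _ = k0 * (s * k1) * s := by rw [h1s]
    _ = (k0 * s) * (k1 * s) := by simp only [mul_assoc]
    _ = k0 * w02 * (k0 * k1) * w12 * k1 := by rw [← c0, ← c1]; simp only [mul_assoc]
    _ = k0 * (w02 * k1) * (k0 * w12) * k1 := by rw [h01]; simp only [mul_assoc]
    _ = k0 * k1 * (w02 * w12) * (k0 * k1) := by rw [← h1w, h0w]; simp only [mul_assoc]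
    _ = (k0 * k1 * w01') * w12 * (w01 * (k0 * k1)) := by rw [p]; simp only [mul_assoc]
    _ = k0 * k1 * (w12 * k0) * k1 := by rw [e1, e2]; simp only [mul_assoc]
    _ = k0 * (k1 * k0) * (w12 * k1) := by rw [← h0w]; simp only [mul_assoc]
    _ = (k0 * k0) * (k1 * w12 * k1) := by rw [← h01]; simp only [mul_assoc]
    _ = k0 * k1 * s := by rw [e3, c1, mul_assoc]

/-- The notation is that of `slices_mul_aux`. Now W₀₁^* ends up between k1 on its left and k0 on its
right, with no full K ⊗ K beside it to absorb it; the hypothesis r, which is regularity, removes it.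
-/
theorem line_mul_aux {M : Type*} [Monoid M] {k0 k1 s w01 w01' w02 w12 : M}
    (h01 : k0 * k1 = k1 * k0)
    (h1w : k1 * w02 = w02 * k1) (h0w : k0 * w12 = w12 * k0)
    (c1 : k1 * w12 * k1 = k1 * s)
    (p : w02 * w12 = w01' * (w12 * w01)) (e2 : w01 * (k0 * k1) = k0 * k1)
    (r : k1 * w01' * k0 = k0 * k1) :
    k1 * (w02 * (k0 * s)) = k1 * (k0 * s) := by
  calc k1 * (w02 * (k0 * s)) = (k1 * w02) * (k0 * s) := by simp only [mul_assoc]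
    _ = w02 * (k1 * k0) * s := by rw [h1w]; simp only [mul_assoc]
    _ = w02 * k0 * (k1 * s) := by rw [← h01]; simp only [mul_assoc]
    _ = w02 * (k0 * k1) * w12 * k1 := by rw [← c1]; simp only [mul_assoc]
    _ = (w02 * k1) * (k0 * w12) * k1 := by rw [h01]; simp only [mul_assoc]
    _ = k1 * (w02 * w12) * (k0 * k1) := by rw [← h1w, h0w]; simp only [mul_assoc]
    _ = k1 * w01' * w12 * (w01 * (k0 * k1)) := by rw [p]; simp only [mul_assoc]
    _ = k1 * w01' * (w12 * k0) * k1 := by rw [e2]; simp only [mul_assoc]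
    _ = (k1 * w01' * k0) * w12 * k1 := by rw [← h0w]; simp only [mul_assoc]
    _ = k0 * (k1 * w12 * k1) := by rw [r]; simp only [mul_assoc]
    _ = k1 * (k0 * s) := by rw [c1, ← mul_assoc, h01, mul_assoc]

/-- Up to closure the product of the two one-leg spaces is the space of finite rank operators on
both legs, which every unitary on these legs preserves. -/
theorem cls_on_FR_mul_line {m : ℕ} {i j : Fin m} (h : Function.Injective ![i, j]) {T : Op n 2}
    (hT : T ∈ unitary (Op n 2)) :
    cls (on i (FR n 1)) * cls (on j (FR n 1)) * cls (line (leg ![i, j] T h)) =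
      cls (on i (FR n 1)) * cls (on j (FR n 1)) := by
  rw [← map_mul, cls_eq.2 (on_FR_mul_on_FR h), ← map_mul, ← LL_line, ← LL_mul, FR_mul_line hT]

theorem cls_line_mul_on_FR {m : ℕ} {i j : Fin m} (h : Function.Injective ![i, j]) {T : Op n 2}
    (hT : T ∈ unitary (Op n 2)) :
    cls (line (leg ![i, j] T h)) * (cls (on i (FR n 1)) * cls (on j (FR n 1))) =
      cls (on i (FR n 1)) * cls (on j (FR n 1)) := by
  rw [← map_mul, cls_eq.2 (on_FR_mul_on_FR h), ← map_mul, ← LL_line, ← LL_mul, line_mul_FR hT]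

/-- Only unitarity and the pentagon equation enter here; regularity is needed for
`IsRegular.line_mul`. -/
theorem IsRegular.slices_mul (hW : IsRegular W) :
    Ceq (SL (lastFirst 1 1) W * SL (lastFirst 1 1) W) (SL (lastFirst 1 1) W) := by
  set S := SL (lastFirst 1 1) W with hS
  have hF := on_FR_mul_on_FR (n := n) (m := 3) (i := 0) (j := 1) (by decide)
  have h02 : Function.Injective ![(0 : Fin 3), 2] := by decide
  have h12 : Function.Injective ![(1 : Fin 3), 2] := by decide
  have h01 : Function.Injective ![(0 : Fin 3), 1] := by decide
  have key := slices_mul_aux (M := (ceqCon (Op n 3)).Quotient)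
    (cls_mul_eq (on_comm (i := 0) (j := 1) (by decide) (FR n 1) (FR n 1)))
    (cls_mul_eq (on_comm (i := 1) (j := 2) (by decide) (FR n 1) S))
    (cls_mul_eq (on_line_comm h02 (i := 1) (by decide) (FR n 1) W))
    (cls_mul_eq (on_line_comm h12 (i := 0) (by decide) (FR n 1) W))
    (by simp only [← map_mul, compress_left h02, hS]) (by simp only [← map_mul, compress_left h12, hS])
    (w01 := cls (line (leg ![0, 1] W h01))) (w01' := cls (line (leg ![0, 1] (star W) h01)))
    (by simp only [← map_mul, line_mul_line]; exact congrArg (fun T => cls (line T)) hW.leg_mul_leg)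
    (cls_on_FR_mul_line h01 (Unitary.star_mem hW.unitary))
    (cls_line_mul_on_FR h01 hW.unitary) (by rw [← map_mul, ← on_mul, FR_mul_FR])
  simp only [← map_mul] at key
  have e3 := (hF.symm.mul (Ceq.refl _)).trans ((cls_eq.1 key).trans (hF.mul (Ceq.refl _)))
  rw [← on_mul] at e3
  have hd : ∀ i : Fin 1, lastFirst 2 1 (Sum.inl i) = (![2] : Fin 1 → Fin 3) i := by decide
  have hd' : ∀ i : Fin 2, lastFirst 2 1 (Sum.inr i) = (![0, 1] : Fin 2 → Fin 3) i := by decide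
  exact ⟨cle_of_FR_mul (lastFirst 2 1) _ _ hd hd' e3.1,
    cle_of_FR_mul (lastFirst 2 1) _ _ hd hd' e3.2⟩

/-- The step from slices to multipliers: W maps K ⊗ S onto itself up to closure, where S is the
space of left slices. The computation takes place on three legs, the middle one being a compact
spectator that is removed at the end. -/
theorem IsRegular.line_mul (hW : IsRegular W) :
    Ceq (line W * (on 0 (FR n 1) * on 1 (SL (lastFirst 1 1) W)))
      (on 0 (FR n 1) * on 1 (SL (lastFirst 1 1) W)) := by
  set S := SL (lastFirst 1 1) W with hS
  have h02 : Function.Injective ![(0 : Fin 3), 2] := by decide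
  have h12 : Function.Injective ![(1 : Fin 3), 2] := by decide
  have h01 : Function.Injective ![(0 : Fin 3), 1] := by decide
  have hF := on_FR_mul_on_FR (n := n) h01
  have hr : Ceq (on 1 (FR n 1) * line (leg ![0, 1] (star W) h01) * on 0 (FR n 1))
      (LL ![0, 1] (FR n 2) h01) := by
    have := hW.regular.LL ![(0 : Fin 3), 1] h01
    rw [LL_mul, LL_mul, LL_on, LL_on, LL_line] at this
    exact this
  have key := line_mul_aux (M := (ceqCon (Op n 3)).Quotient)
    (cls_mul_eq (on_comm (i := 0) (j := 1) (by decide) (FR n 1) (FR n 1)))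
    (cls_mul_eq (on_line_comm h02 (i := 1) (by decide) (FR n 1) W))
    (cls_mul_eq (on_line_comm h12 (i := 0) (by decide) (FR n 1) W))
    (s := cls (on 2 S)) (by simp only [← map_mul, compress_left h12, hS])
    (w01 := cls (line (leg ![0, 1] W h01))) (w01' := cls (line (leg ![0, 1] (star W) h01)))
    (by simp only [← map_mul, line_mul_line]; exact congrArg (fun T => cls (line T)) hW.leg_mul_leg)
    (cls_line_mul_on_FR h01 hW.unitary)
    (by simp only [← map_mul]; exact cls_eq.2 (hr.trans hF.symm))
  simp only [← map_mul] at key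
  have e1 := cls_eq.1 key
  have hd : ∀ i : Fin 2, (Equiv.ofBijective (Sum.elim ![0, 2] ![1]) (by decide) :
      Fin 2 ⊕ Fin 1 ≃ Fin 3) (Sum.inl i) = (![0, 2] : Fin 2 → Fin 3) i := by decide
  have hd' : ∀ i : Fin 1, (Equiv.ofBijective (Sum.elim ![0, 2] ![1]) (by decide) :
      Fin 2 ⊕ Fin 1 ≃ Fin 3) (Sum.inr i) = (![1] : Fin 1 → Fin 3) i := by decide
  have e3 : LL ![(0 : Fin 3), 2] (on 0 (FR n 1) * on 1 S) h02 = on 0 (FR n 1) * on 2 S := by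
    rw [LL_mul, LL_on, LL_on]; rfl
  have e2 : LL ![(0 : Fin 3), 2] (line W * (on 0 (FR n 1) * on 1 S)) h02 =
      line (leg ![0, 2] W h02) * (on 0 (FR n 1) * on 2 S) := by
    rw [LL_mul, LL_line, e3]
  rw [← e2, ← e3] at e1
  exact ⟨cle_of_FR_mul _ _ _ hd hd' e1.1, cle_of_FR_mul _ _ _ hd hd' e1.2⟩

theorem line_star_mul {m : ℕ} {T : Op n m} (hT : T ∈ unitary (Op n m)) {P : Submodule ℂ (Op n m)}
    (h : Ceq (line T * P) P) : Ceq (line (star T) * P) P := by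
  have := (Ceq.refl (line (star T))).mul h.symm
  rwa [← mul_assoc, line_mul_line, hT.1, line_one_mul] at this

end Multiplicative

/-! ## Changes of variables -/

section Changes

variable {n k : ℕ}

/-- The change of variables `θ` has Jacobian `exp(L)²ⁿ`. -/
def Changes {n k : ℕ} (L : (Fin k → Pt n) → ℝ) (θ : (Fin k → Pt n) → Fin k → Pt n) : Prop :=
  IsWeight (fun p => ((Real.exp (L p) ^ n : ℝ) : ℂ)) θ

variable {L M φ : (Fin k → Pt n) → ℝ} {θ τ : (Fin k → Pt n) → Fin k → Pt n}

/-- Only the modulus of the weight enters the change of variables formula, so phases can be dropped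
or attached at will. -/
theorem IsWeight.congr_norm {α : Type*} [MeasureSpace α] {c d : α → ℂ} {θ : α → α}
    (h : IsWeight c θ) (hd : Measurable d) (hcd : ∀ p, ‖d p‖ = ‖c p‖) : IsWeight d θ where
  measurable_weight := hd
  measurable_map := h.measurable_map
  ne_zero p := by rw [← norm_ne_zero_iff, hcd, norm_ne_zero_iff]; exact h.ne_zero p
  lintegral_eq f hf := by
    rw [← h.lintegral_eq f hf]
    congr 1; ext p
    rw [← ofReal_norm, ← ofReal_norm, hcd]

theorem norm_expTwoPiI (t : ℝ) : ‖expTwoPiI t‖ = 1 := by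
  rw [expTwoPiI, Complex.norm_exp]
  simp

theorem Acts.changes {T : Op n k} (h : Acts T L φ θ) : Changes L θ := by
  obtain ⟨h, -⟩ := h
  refine h.congr_norm ?_ fun p => by rw [norm_mul, norm_expTwoPiI, mul_one]
  have : (fun p => ((Real.exp (L p) ^ n : ℝ) : ℂ)) = fun p =>
      ((‖((Real.exp (L p) ^ n : ℝ) : ℂ) * expTwoPiI (φ p)‖ : ℝ) : ℂ) := by
    funext p
    rw [norm_mul, norm_expTwoPiI, mul_one, Complex.norm_real, Real.norm_eq_abs, abs_of_nonneg]
    positivity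
  rw [this]
  exact measurable_ofReal.comp h.measurable_weight.norm

theorem Changes.isWeight (h : Changes L θ) (hφ : Measurable φ) :
    IsWeight (fun p => ((Real.exp (L p) ^ n : ℝ) : ℂ) * expTwoPiI (φ p)) θ :=
  h.congr_norm (h.measurable_weight.mul (measurable_expTwoPiI.comp hφ))
    fun p => by rw [norm_mul, norm_expTwoPiI, mul_one]

theorem Changes.acts (h : Changes L θ) :
    Acts (weightedComp (h.isWeight (φ := fun _ => 0) measurable_const)) L (fun _ => 0) θ :=
  ⟨_, rfl⟩

theorem Changes.comp (h : Changes L θ) (h' : Changes M τ) :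
    Changes (fun p => L p + M (θ p)) (fun p => τ (θ p)) := (h.acts.mul h'.acts).changes

theorem Changes.inverse (h : Changes L θ) (hτ : Measurable τ) (h2 : ∀ p, τ (θ p) = p) :
    Changes (fun p => -L (τ p)) τ := (h.acts.star hτ h2).changes

theorem Changes.congr (h : Changes L θ) (h1 : ∀ p, L p = M p) (h2 : ∀ p, θ p = τ p) :
    Changes M τ := by
  obtain rfl : L = M := funext h1
  obtain rfl : θ = τ := funext h2
  exact h

/-- Translation of the variable `r` of the first leg by that of the second. -/
theorem changes_shift (n : ℕ) : Changes (n := n) (k := 2) (fun _ => 0)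
    (fun p => ![((p 0).1, (p 0).2.1, (p 0).2.2 + (p 1).2.2), p 1]) where
  measurable_weight := by fun_prop
  measurable_map := measurable_vecPair (by fun_prop) (by fun_prop)
  ne_zero p := by simp
  lintegral_eq f hf := by
    have := sigmaFinite_pt n
    have key : ∀ g : (Fin 2 → Pt n) → ℝ≥0∞,
        ∫⁻ p, g p = ∫⁻ q : Pt n × Pt n, g ![q.1, q.2] := fun g => by
      exact (((volume_preserving_finTwoArrow (Pt n)).symm _).lintegral_comp_emb
        (MeasurableEquiv.measurableEmbedding _) g).symm
    rw [key, key f, Measure.volume_eq_prod, lintegral_prod_symm' _ ?_, lintegral_prod_symm' _ ?_]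
    · congr 1; ext p1
      have h2 := lintegral_add_pt n (fun q => f ![q, p1])
        (hf.comp (measurable_vecPair (by fun_prop) (by fun_prop))) (0, 0, p1.2.2)
      rw [← h2]
      congr 1; ext p0
      simp
    · exact hf.comp (measurable_vecPair (by fun_prop) (by fun_prop))
    · simp only [Real.exp_zero, one_pow, ofReal_one, enorm_one, one_mul]
      exact hf.comp (measurable_vecPair (by fun_prop) (by fun_prop))

theorem changes_neg (n : ℕ) : Changes (n := n) (k := 1) (fun _ => 0)
    (fun p => ![(-(p 0).1, -(p 0).2.1, (p 0).2.2)]) where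
  measurable_weight := by fun_prop
  measurable_map := by
    refine measurable_pi_iff.2 fun i => ?_
    fin_cases i
    change Measurable fun p : Fin 1 → Pt n => (-(p 0).1, -(p 0).2.1, (p 0).2.2)
    fun_prop
  ne_zero p := by simp
  lintegral_eq f hf := by
    have hu := volume_preserving_funUnique (Fin 1) (Pt n)
    have key : ∀ g : (Fin 1 → Pt n) → ℝ≥0∞, ∫⁻ p, g p = ∫⁻ q : Pt n, g (fun _ => q) := fun g => by
      exact ((hu.symm _).lintegral_comp_emb (MeasurableEquiv.measurableEmbedding _) g).symm
    rw [key, key f]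
    have h1 := lintegral_scale_pt n (fun _ => -1) (by fun_prop) (fun r => by norm_num)
      (fun q => f (fun _ => q)) (hf.comp (by fun_prop))
    rw [← h1]
    congr 1; ext q
    have : (![(-q.1, -q.2.1, q.2.2)] : Fin 1 → Pt n) = fun _ => (-q.1, -q.2.1, q.2.2) := by
      funext i; fin_cases i; rfl
    simp [this]

end Changes

/-! ## Matrix coefficients of weighted composition operators -/

section Coefficients

variable {n : ℕ}

theorem split_firstLast (p : Fin 2 → Pt n) : split n (firstLast 1 1) p = (![p 0], ![p 1]) := by
  refine Prod.ext (funext fun i => ?_) (funext fun i => ?_) <;> fin_cases i <;> rfl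

theorem ae_leg_zero {P : (Fin 1 → Pt n) → Prop} (h : ∀ᵐ x, P x) :
    ∀ᵐ p : Fin 2 → Pt n, P ![p 0] := by
  filter_upwards [ae_split_fst (firstLast 1 1) h] with p hp
  rwa [split_firstLast] at hp

theorem ae_leg_one {P : (Fin 1 → Pt n) → Prop} (h : ∀ᵐ x, P x) :
    ∀ᵐ p : Fin 2 → Pt n, P ![p 1] := by
  filter_upwards [ae_split_snd (firstLast 1 1) h] with p hp
  rwa [split_firstLast] at hp

variable {c : (Fin 2 → Pt n) → ℂ} {θ : (Fin 2 → Pt n) → Fin 2 → Pt n}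

theorem inner_weightedComp (h : IsWeight c θ) (a b e f : HT n 1) :
    inner ℂ (tmul (firstLast 1 1) a b) (weightedComp h (tmul (firstLast 1 1) e f)) =
      ∫ p : Fin 2 → Pt n, starRingEnd ℂ (a ![p 0]) * starRingEnd ℂ (b ![p 1]) *
        (c p * (e ![θ p 0] * f ![θ p 1])) := by
  rw [L2.inner_def]
  apply integral_congr_ae
  filter_upwards [coeFn_tmul (firstLast 1 1) a b,
    coeFn_weightedComp h (tmul (firstLast 1 1) e f),
    h.quasi.ae (coeFn_tmul (firstLast 1 1) e f)] with p h1 h2 h3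
  rw [h1, h2, h3, split_firstLast, split_firstLast]
  simp only [RCLike.inner_apply, map_mul]
  ring

theorem measurable_coefficient (h : IsWeight c θ) (a b e f : HT n 1) :
    AEStronglyMeasurable (fun p : Fin 2 → Pt n => starRingEnd ℂ (a ![p 0]) *
      starRingEnd ℂ (b ![p 1]) * (c p * (e ![θ p 0] * f ![θ p 1]))) volume := by
  have hv : ∀ i : Fin 2, Measurable fun p : Fin 2 → Pt n => (![p i] : Fin 1 → Pt n) := fun i =>
    measurable_pi_iff.2 fun j => by fin_cases j; exact measurable_pi_apply i
  have hm : ∀ (u : HT n 1) (i : Fin 2), Measurable fun p : Fin 2 → Pt n => u ![p i] :=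
    fun u i => (Lp.stronglyMeasurable u).measurable.comp (hv i)
  have hs : Measurable (starRingEnd ℂ) := Complex.continuous_conj.measurable
  exact (((hs.comp (hm a 0)).mul (hs.comp (hm b 1))).mul (h.measurable_weight.mul
    (((hm e 0).comp h.measurable_map).mul ((hm f 1).comp h.measurable_map)))).aestronglyMeasurable

theorem coeFn_weightedComp_star {k : ℕ} {c : (Fin k → Pt n) → ℂ}
    {θ : (Fin k → Pt n) → Fin k → Pt n} (h : IsWeight c θ) (ξ : HT n k) :
    weightedComp h (star ξ) =ᵐ[volume] fun p => c p * starRingEnd ℂ (ξ (θ p)) := by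
  filter_upwards [coeFn_weightedComp h (star ξ), h.quasi.ae (Lp.coeFn_star ξ)] with p h1 h2
  rw [h1, h2]
  rfl

end Coefficients

/-! ### Adjoints of slices of X, and the partial transpose of X^*. -/

section Kac

variable (n : ℕ) (lam : ℝ)

theorem changes_shift_symm : Changes (n := n) (k := 2) (fun _ => 0)
    (fun p => ![((p 0).1, (p 0).2.1, (p 0).2.2 - (p 1).2.2), p 1]) := by
  refine ((changes_shift n).inverse (measurable_vecPair (by fun_prop) (by fun_prop))
    fun p => ?_).congr (fun p => by simp) (fun p => rfl)
  funext i
  fin_cases i <;> simp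

theorem changes_dilate : Changes (n := n) (k := 1) (fun p => lam * (p 0).2.2)
    (fun p => ![(Real.exp (lam * (p 0).2.2) • (p 0).1, Real.exp (lam * (p 0).2.2) • (p 0).2.1,
      -(p 0).2.2)]) :=
  ((acts_jop n lam).changes.comp (changes_neg n)).congr (fun p => by simp) (fun p => by
    funext i; fin_cases i; simp)

theorem measurable_phase_beta : Measurable fun p : Fin 1 → Pt n =>
    -(eta lam (p 0).2.2 * beta (p 0).1 (p 0).2.1) := by
  have h2 := measurable_eta lam
  have h3 : Measurable fun p : Fin 1 → Pt n => beta (p 0).1 (p 0).2.1 :=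
    measurable_beta (by fun_prop) (by fun_prop)
  fun_prop

/-- The antiunitary operator implementing the adjoint of left slices of `X`. -/
def conjNeg (ξ : HT n 1) : HT n 1 :=
  weightedComp ((changes_neg n).isWeight (measurable_phase_beta n lam)) (star ξ)

/-- The antiunitary operator implementing the adjoint of right slices of `X`. -/
def conjDilate (ξ : HT n 1) : HT n 1 :=
  weightedComp ((changes_dilate n lam).isWeight (φ := fun _ => 0) measurable_const) (star ξ)

theorem changes_reflect : Changes (n := n) (k := 2) (fun _ => 0)
    (fun p => ![(-(p 0).1, -(p 0).2.1, (p 0).2.2),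
      ((p 1).1 - Real.exp (lam * (p 0).2.2) • (p 0).1,
      (p 1).2.1 - Real.exp (lam * (p 0).2.2) • (p 0).2.1, (p 1).2.2)]) := by
  refine ((acts_X n lam).changes.comp ((changes_shift_symm n).comp
    ((changes_neg n).acts.leg_one (m := 2) 0 (by decide)).changes)).congr (fun p => by simp)
    fun p => ?_
  funext i
  fin_cases i <;> simp [mapX]

theorem changes_invert : Changes (n := n) (k := 2) (fun p => lam * (p 1).2.2)
    (fun p => ![((p 0).1, (p 0).2.1, (p 0).2.2 + (p 1).2.2),
      (Real.exp (lam * (p 1).2.2) • (p 1).1, Real.exp (lam * (p 1).2.2) • (p 1).2.1,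
      -(p 1).2.2)]) := by
  refine ((changes_shift n).comp
    ((changes_dilate n lam).acts.leg_one (m := 2) 1 (by decide)).changes).congr (fun p => by simp)
    fun p => ?_
  funext i
  fin_cases i <;> simp

set_option linter.unusedSimpArgs false

/-- The substitution `changes_reflect` carries the integral for the right hand coefficient to the
conjugate of the left hand one. In consequence the adjoint of a left slice of X is again a left
slice, exactly and not merely up to closure. -/
theorem conj_inner_X_left (ξ η α ζ : HT n 1) :
    starRingEnd ℂ (inner ℂ (tmul (firstLast 1 1) η α) (Xop n lam (tmul (firstLast 1 1) ξ ζ))) =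
      inner ℂ (tmul (firstLast 1 1) (conjNeg n lam η) ζ)
        (Xop n lam (tmul (firstLast 1 1) (conjNeg n lam ξ) α)) := by
  obtain ⟨h, hX⟩ := acts_X n lam
  have hτ := changes_reflect n lam
  rw [hX, inner_weightedComp, inner_weightedComp, ← integral_conj,
    ← hτ.integral_eq (measurable_coefficient h _ _ _ _)]
  apply integral_congr_ae
  have hJ := fun u => coeFn_weightedComp_star
    ((changes_neg n).isWeight (measurable_phase_beta n lam)) u
  filter_upwards [hτ.quasi.ae (ae_leg_zero (hJ η)),
    hτ.quasi.ae (h.quasi.ae (ae_leg_zero (hJ ξ)))] with p h1 h2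
  simp only [conjNeg]
  rw [h1, h2]
  have hp : (![((p 0).1, (p 0).2.1, (p 0).2.2)] : Fin 1 → Pt n) = ![p 0] := rfl
  have hp1 : (((p 1).1, (p 1).2.1, (p 1).2.2) : Pt n) = p 1 := rfl
  -- The three terms are the conjugated phase of the antiunitary at the reflected point, the phase
  -- of X there, and the phase of the antiunitary after the substitution of X, which has shifted r
  -- to r + r'.
  have key : -phX n lam p = eta lam (p 0).2.2 * beta (p 0).1 (p 0).2.1 +
      phX n lam ![(-(p 0).1, -(p 0).2.1, (p 0).2.2),
      ((p 1).1 - Real.exp (lam * (p 0).2.2) • (p 0).1,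
      (p 1).2.1 - Real.exp (lam * (p 0).2.2) • (p 0).2.1, (p 1).2.2)] +
      -(eta lam ((p 0).2.2 + (p 1).2.2) * beta (p 0).1 (p 0).2.1) := by
    rcases eq_or_ne lam 0 with rfl | hl
    · simp [phX, eta_zero_left, beta_smul_left, beta_smul_right, beta_neg_left, beta_neg_right,
        beta_sub_left, beta_sub_right]
      ring
    · simp [phX, eta_of_ne hl, beta_smul_left, beta_smul_right, beta_neg_left, beta_neg_right,
        beta_sub_left, beta_sub_right, mul_add, Real.exp_add]
      field_simp
      ring
  have key2 : expTwoPiI (-phX n lam p) = _ := congrArg expTwoPiI key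
  rw [expTwoPiI_add, expTwoPiI_add] at key2
  simp [mapX, conj_expTwoPiI, beta_neg_left, beta_neg_right, key2, Prod.mk.eta]
  ring

/-- The analogue for right slices, with the antiunitary on the second leg; its dilation by exp(λ r)
supplies the Jacobian of `changes_invert`, so no phase is needed. -/
theorem conj_inner_X_right (ξ η α ζ : HT n 1) :
    starRingEnd ℂ (inner ℂ (tmul (firstLast 1 1) η α) (Xop n lam (tmul (firstLast 1 1) ξ ζ))) =
      inner ℂ (tmul (firstLast 1 1) ξ (conjDilate n lam α))
        (Xop n lam (tmul (firstLast 1 1) η (conjDilate n lam ζ))) := by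
  obtain ⟨h, hX⟩ := acts_X n lam
  have hτ := changes_invert n lam
  rw [hX, inner_weightedComp, inner_weightedComp, ← integral_conj,
    ← hτ.integral_eq (measurable_coefficient h _ _ _ _)]
  apply integral_congr_ae
  have hJ := fun u => coeFn_weightedComp_star
    ((changes_dilate n lam).isWeight (φ := fun _ => 0) measurable_const) u
  filter_upwards [hτ.quasi.ae (ae_leg_one (hJ α)),
    hτ.quasi.ae (h.quasi.ae (ae_leg_one (hJ ζ)))] with p h1 h2
  simp only [conjDilate]
  rw [h1, h2]
  have hE := (Real.exp_pos (lam * (p 1).2.2)).ne'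
  have key : -phX n lam p = 
      phX n lam ![((p 0).1, (p 0).2.1, (p 0).2.2 + (p 1).2.2),
      (Real.exp (lam * (p 1).2.2) • (p 1).1, Real.exp (lam * (p 1).2.2) • (p 1).2.1,
      -(p 1).2.2)] := by
    rcases eq_or_ne lam 0 with rfl | hl
    · simp [phX, eta_zero_left, beta_smul_left, beta_smul_right, beta_neg_left, beta_neg_right,
        beta_sub_left, beta_sub_right]
    · simp [phX, eta_of_ne hl, beta_smul_left, beta_smul_right, beta_neg_left, beta_neg_right,
        beta_sub_left, beta_sub_right, mul_add, Real.exp_add, Real.exp_neg]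
      field_simp
      ring
  have e1 : ∀ v w : Fin n → ℝ, Real.exp (lam * (p 1).2.2) • v -
      Real.exp (lam * ((p 0).2.2 + (p 1).2.2)) • w = Real.exp (lam * (p 1).2.2) • (v -
      Real.exp (lam * (p 0).2.2) • w) := fun v w => by
    rw [smul_sub, smul_smul, ← Real.exp_add]; congr 3; ring
  simp [mapX, conj_expTwoPiI, key, Prod.mk.eta, expTwoPiI_zero, e1, Real.exp_neg, smul_smul, hE,
    -Complex.ofReal_exp]
  field_simp

/-- The change of variables in the partial transpose of `X^*`. -/
theorem changes_transpose : Changes (n := n) (k := 2) (fun _ => 0)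
    (fun p => ![((p 0).1, (p 0).2.1, (p 0).2.2 - (p 1).2.2),
      ((p 1).1 - Real.exp (lam * ((p 0).2.2 - (p 1).2.2)) • (p 0).1,
      (p 1).2.1 - Real.exp (lam * ((p 0).2.2 - (p 1).2.2)) • (p 0).2.1, (p 1).2.2)]) := by
  refine (((changes_shift_symm n).comp (acts_X n lam).changes).comp (changes_shift_symm n)).congr
    (fun p => by simp) fun p => ?_
  funext i
  fin_cases i <;> simp [mapX]

theorem acts_star_X : Acts (star (Xop n lam)) (fun _ => 0)
    (fun p => eta lam (p 1).2.2 * beta (Real.exp (lam * ((p 0).2.2 - (p 1).2.2)) • (p 0).1)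
      (p 1).2.1)
    (fun p => ![((p 0).1, (p 0).2.1, (p 0).2.2 - (p 1).2.2),
      ((p 1).1 + Real.exp (lam * ((p 0).2.2 - (p 1).2.2)) • (p 0).1,
      (p 1).2.1 + Real.exp (lam * ((p 0).2.2 - (p 1).2.2)) • (p 0).2.1, (p 1).2.2)]) := by
  rw [Xop, ← leg_star, star_star]
  refine ((acts_Y n lam).leg_two 1 0 (by decide)).congr (fun p => by simp) (fun p => by simp [phY])
    fun p => ?_
  funext i
  fin_cases i <;> simp [mapY]

theorem changes_shear : Changes (n := n) (k := 2) (fun _ => 0)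
    (fun p => ![p 0,
      ((p 1).1 + Real.exp (lam * ((p 0).2.2 - (p 1).2.2)) • (p 0).1,
      (p 1).2.1 + Real.exp (lam * ((p 0).2.2 - (p 1).2.2)) • (p 0).2.1, (p 1).2.2)]) := by
  refine ((acts_star_X n lam).changes.comp (changes_shift n)).congr (fun p => by simp) fun p => ?_
  funext i
  fin_cases i <;> simp

theorem measurable_phase_transpose : Measurable fun p : Fin 2 → Pt n =>
    eta lam (p 1).2.2 * beta (Real.exp (lam * ((p 0).2.2 - (p 1).2.2)) • (p 0).1)
      ((p 1).2.1 - Real.exp (lam * ((p 0).2.2 - (p 1).2.2)) • (p 0).2.1) := by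
  have h2 := measurable_eta lam
  have h3 : Measurable fun p : Fin 2 → Pt n =>
      beta (Real.exp (lam * ((p 0).2.2 - (p 1).2.2)) • (p 0).1)
      ((p 1).2.1 - Real.exp (lam * ((p 0).2.2 - (p 1).2.2)) • (p 0).2.1) :=
    measurable_beta (by fun_prop) (by fun_prop)
  fun_prop

/-- The partial transpose of `X^*`. -/
def transposeX : Op n 2 :=
  weightedComp ((changes_transpose n lam).isWeight (measurable_phase_transpose n lam))

theorem transposeX_mem_unitary : transposeX n lam ∈ unitary (Op n 2) := by
  have h : Acts (transposeX n lam) _ _ _ :=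
    ⟨(changes_transpose n lam).isWeight (measurable_phase_transpose n lam), rfl⟩
  refine h.mem_unitary (τ := fun p => ![((p 0).1, (p 0).2.1, (p 0).2.2 + (p 1).2.2),
      ((p 1).1 + Real.exp (lam * (p 0).2.2) • (p 0).1,
      (p 1).2.1 + Real.exp (lam * (p 0).2.2) • (p 0).2.1, (p 1).2.2)])
    (measurable_vecPair (by fun_prop) (by fun_prop)) fun p => ?_
  funext i
  fin_cases i <;> simp

/-- Exchanging the two vectors of the second leg, up to complex conjugation, amounts to the
substitution `changes_shear` in the integral. Regularity of X comes from the unitarity of the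
resulting operator. -/
theorem inner_star_X (a b e f : HT n 1) :
    inner ℂ (tmul (firstLast 1 1) a b) (star (Xop n lam) (tmul (firstLast 1 1) e f)) =
      inner ℂ (tmul (firstLast 1 1) a (star f))
        (transposeX n lam (tmul (firstLast 1 1) e (star b))) := by
  obtain ⟨h, hX⟩ := acts_star_X n lam
  have h' := (changes_transpose n lam).isWeight (measurable_phase_transpose n lam)
  have hτ := changes_shear n lam
  rw [hX, transposeX, inner_weightedComp, inner_weightedComp,
    ← hτ.integral_eq (measurable_coefficient h' _ _ _ _)]
  apply integral_congr_ae
  filter_upwards [hτ.quasi.ae (ae_leg_one (Lp.coeFn_star f)),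
    hτ.quasi.ae (h'.quasi.ae (ae_leg_one (Lp.coeFn_star b)))] with p h1 h2
  rw [h1, h2]
  simp [beta_add_right]
  ring

end Kac

/-! ## Regularity -/

section Regular

open InnerProductSpace

variable {n : ℕ}

theorem norm_tmulRight_le {k l m : ℕ} (d : Fin k ⊕ Fin l ≃ Fin m) (ζ : HT n l) :
    ‖tmulRight (k := k) d ζ‖ ≤ ‖ζ‖ :=
  ContinuousLinearMap.opNorm_le_bound _ (norm_nonneg _) fun ξ => by
    rw [tmulRight_apply, norm_tmul, mul_comm]

theorem tmulRight_add {k l m : ℕ} (d : Fin k ⊕ Fin l ≃ Fin m) (ζ ζ' : HT n l) :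
    tmulRight (k := k) d (ζ + ζ') = tmulRight d ζ + tmulRight d ζ' := by
  simp [tmulRight, ContinuousLinearMap.comp_add]

theorem tmulRight_smul {k l m : ℕ} (d : Fin k ⊕ Fin l ≃ Fin m) (r : ℂ) (ζ : HT n l) :
    tmulRight (k := k) d (r • ζ) = r • tmulRight d ζ := by
  simp [tmulRight]

theorem star_smul_Lp {k : ℕ} (r : ℂ) (ζ : HT n k) : star (r • ζ) = starRingEnd ℂ r • star ζ := by
  apply Lp.ext
  filter_upwards [Lp.coeFn_star (r • ζ), Lp.coeFn_smul r ζ, Lp.coeFn_star ζ,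
    Lp.coeFn_smul (starRingEnd ℂ r) (star ζ)] with p h1 h2 h3 h4
  rw [h1, h4, Pi.star_apply, h2, Pi.smul_apply, Pi.smul_apply, h3]
  simp

theorem star_add_Lp {k : ℕ} (ξ η : HT n k) : star (ξ + η) = star ξ + star η := by
  apply Lp.ext
  filter_upwards [Lp.coeFn_star (ξ + η), Lp.coeFn_add ξ η, Lp.coeFn_star ξ, Lp.coeFn_star η,
    Lp.coeFn_add (star ξ) (star η)] with p h1 h2 h3 h4 h5
  rw [h1, h5, Pi.star_apply, h2, Pi.add_apply, Pi.add_apply, h3, h4]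
  simp

theorem inner_star_star {k : ℕ} (ξ η : HT n k) : inner ℂ (star ξ) η = inner ℂ (star η) ξ := by
  rw [L2.inner_def, L2.inner_def]
  apply integral_congr_ae
  filter_upwards [Lp.coeFn_star ξ, Lp.coeFn_star η] with p h1 h2
  rw [h1, h2]
  simp [mul_comm]

theorem norm_star_Lp {k : ℕ} (ξ : HT n k) : ‖star ξ‖ = ‖ξ‖ := by
  have h : inner ℂ (star ξ) (star ξ) = inner ℂ ξ ξ := by
    rw [inner_star_star, star_star]
  rw [inner_self_eq_norm_sq_to_K, inner_self_eq_norm_sq_to_K] at h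
  have h2 : ‖star ξ‖ ^ 2 = ‖ξ‖ ^ 2 := by exact_mod_cast h
  exact (sq_eq_sq₀ (norm_nonneg _) (norm_nonneg _)).1 h2

theorem map_mem_of_tmul_mem {k l m : ℕ} {F : Type*} [NormedAddCommGroup F] [NormedSpace ℂ F]
    (d : Fin k ⊕ Fin l ≃ Fin m) (f : HT n m →L[ℂ] F) {V : Submodule ℂ F}
    (hV : IsClosed (V : Set F)) (h : ∀ a b, f (tmul d a b) ∈ V) (u : HT n m) : f u ∈ V :=
  mem_of_tmul_mem d (V := V.comap f.toLinearMap) (hV.preimage f.continuous) h u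

/-- The Hilbert-Schmidt operator with kernel `w`. -/
def kernelOp (n : ℕ) : HT n 2 →L[ℂ] Op n 1 :=
  LinearMap.mkContinuous₂
    (LinearMap.mk₂ ℂ (fun w δ => ContinuousLinearMap.adjoint
      (tmulRight (k := 1) (firstLast 1 1) (star δ)) w)
      (fun a b c => map_add _ _ _) (fun r a c => map_smul _ _ _)
      (fun c a b => by rw [star_add_Lp, tmulRight_add, map_add, add_apply])
      (fun r c a => by rw [star_smul_Lp, tmulRight_smul, map_smulₛₗ]; simp)) 1
    (fun w δ => by
      refine ((ContinuousLinearMap.adjoint (tmulRight (k := 1) (firstLast 1 1) (star δ))).le_opNorm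
        w).trans ?_
      rw [LinearIsometryEquiv.norm_map, one_mul, mul_comm]
      refine mul_le_mul_of_nonneg_left ((norm_tmulRight_le _ _).trans ?_) (norm_nonneg _)
      exact (norm_star_Lp δ).le)

theorem inner_kernelOp (w : HT n 2) (β δ : HT n 1) :
    inner ℂ β (kernelOp n w δ) = inner ℂ (tmul (firstLast 1 1) β (star δ)) w := by
  have : kernelOp n w δ = ContinuousLinearMap.adjoint
      (tmulRight (k := 1) (firstLast 1 1) (star δ)) w := rfl
  rw [this, ContinuousLinearMap.adjoint_inner_right, tmulRight_apply]

/-- The operator `γ ⊗ δ ↦ ⟨c, γ⟩ (kernelOp w δ) ⊗ a`. -/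
def kernelLeg (a c : HT n 1) : HT n 2 →L[ℂ] Op n 2 :=
  (ContinuousLinearMap.compL ℂ (HT n 2) (HT n 1) (HT n 2) (tmulRight (firstLast 1 1) a)).comp
    (((ContinuousLinearMap.compL ℂ (HT n 2) (HT n 1) (HT n 1)).flip
      (ContinuousLinearMap.adjoint (tmulRight (lastFirst 1 1) c))).comp (kernelOp n))

theorem inner_kernelLeg (a c β δ' γ δ : HT n 1) (w : HT n 2) :
    inner ℂ (tmul (firstLast 1 1) β δ') (kernelLeg a c w (tmul (firstLast 1 1) γ δ)) =
      inner ℂ (tmul (firstLast 1 1) β (star δ)) w * inner ℂ δ' a * inner ℂ c γ := by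
  have h1 : ContinuousLinearMap.adjoint (tmulRight (lastFirst 1 1) c)
      (tmul (firstLast 1 1) γ δ) = inner ℂ c γ • δ := by
    refine ext_inner_left ℂ fun u => ?_
    rw [ContinuousLinearMap.adjoint_inner_right, tmulRight_apply, ← tmul_swap (firstLast 1 1),
      inner_tmul, inner_smul_right, mul_comm]
  change inner ℂ _ (tmul (firstLast 1 1) (kernelOp n w (ContinuousLinearMap.adjoint
    (tmulRight (lastFirst 1 1) c) (tmul (firstLast 1 1) γ δ))) a) = _
  rw [h1, inner_tmul, map_smul, inner_smul_right, inner_kernelOp]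
  ring

/-- An elementary tensor as kernel gives a rank one operator, so by continuity and density every
square integrable kernel gives a limit of finite rank operators. -/
theorem kernelLeg_tmul (a c ρ σ : HT n 1) :
    kernelLeg a c (tmul (firstLast 1 1) ρ σ) =
      rankOne ℂ (tmul (firstLast 1 1) ρ a) (tmul (firstLast 1 1) c (star σ)) := by
  refine op_ext_inner_tmul (firstLast 1 1) (firstLast 1 1) fun γ δ β δ' => ?_
  rw [inner_kernelLeg, rankOne_apply, inner_smul_right, inner_tmul, inner_tmul, inner_tmul,
    inner_star_star]
  ring

/-- The compressions occurring in the regularity condition are Hilbert-Schmidt operators with kernel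
the transposed unitary applied to α ⊗ b̄, tensored with a fixed rank one part. -/
theorem rankOne_mul_star_X_mul_rankOne (lam : ℝ) (a b α c : HT n 1) :
    leg ![1] (rankOne ℂ a b) * star (Xop n lam) * leg ![0] (rankOne ℂ α c) =
      kernelLeg a c (transposeX n lam (tmul (firstLast 1 1) α (star b))) := by
  refine op_ext_inner_tmul (firstLast 1 1) (firstLast 1 1) fun γ δ β δ' => ?_
  have h0 : ∀ i : Fin 1, firstLast 1 1 (Sum.inl i) = (![0] : Fin 1 → Fin 2) i := by decide
  have h1 : ∀ i : Fin 1, firstLast 1 1 (Sum.inr i) = (![1] : Fin 1 → Fin 2) i := by decide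
  have h2 : star (leg ![1] (rankOne ℂ a b) : Op n 2) = leg ![1] (rankOne ℂ b a) := by
    rw [← leg_star, ContinuousLinearMap.star_eq_adjoint, adjoint_rankOne]
  rw [inner_kernelLeg, mul_apply_eq_comp, mul_apply_eq_comp, leg_fst_tmul _ _ h0,
    ← ContinuousLinearMap.adjoint_inner_left, ← ContinuousLinearMap.star_eq_adjoint, h2,
    leg_snd_tmul _ _ h1, rankOne_apply, rankOne_apply, tmul_smul_left, tmul_smul_right, map_smul,
    inner_smul_right, inner_smul_left, inner_conj_symm, inner_star_X]
  ring

/-- One inclusion holds because Hilbert-Schmidt operators are limits of finite rank ones; the other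
because the vectors α ⊗ b̄ span a dense subspace and the transposed operator is onto. -/
theorem regular_X (lam : ℝ) :
    Ceq (on 1 (FR n 1) * line (star (Xop n lam)) * on 0 (FR n 1)) (FR n 2) := by
  constructor
  · have : on 1 (FR n 1) * line (star (Xop n lam)) * on 0 (FR n 1) ≤
        (FR n 2).topologicalClosure := by
      simp only [on, LL, line]
      conv_lhs => rw [FR, Submodule.map_span, Submodule.map_span]
      rw [Submodule.span_mul_span, Submodule.span_mul_span, Submodule.span_le]
      rintro _ ⟨_, ⟨_, ⟨_, ⟨a, b, rfl⟩, rfl⟩, _, rfl, rfl⟩, _, ⟨_, ⟨α, c, rfl⟩, rfl⟩, rfl⟩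
      have h2 := rankOne_mul_star_X_mul_rankOne lam a b α c
      refine (congrArg (fun T : Op n 2 => T ∈ (FR n 2).topologicalClosure) h2).mpr ?_
      refine map_mem_of_tmul_mem (firstLast 1 1) (kernelLeg a c)
        (FR n 2).isClosed_topologicalClosure (fun ρ σ => ?_) _
      rw [kernelLeg_tmul]
      exact Submodule.le_topologicalClosure _ (rankOne_mem_FR _ _)
    exact this
  · refine FR_cle_of_tmul (firstLast 1 1) (firstLast 1 1) _ fun ρ a c σ => ?_
    rw [← star_star σ, ← kernelLeg_tmul]
    have h := (transposeX_mem_unitary n lam).2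
    have : ∀ u, kernelLeg a c (transposeX n lam u) ∈ (on 1 (FR n 1) *
        line (star (Xop n lam)) * on 0 (FR n 1)).topologicalClosure := by
      refine map_mem_of_tmul_mem (firstLast 1 1) ((kernelLeg a c).comp (transposeX n lam))
        (Submodule.isClosed_topologicalClosure _) fun ρ σ => ?_
      change kernelLeg a c (transposeX n lam _) ∈ _
      rw [← star_star σ, ← rankOne_mul_star_X_mul_rankOne]
      exact Submodule.le_topologicalClosure _ (Submodule.mul_mem_mul (Submodule.mul_mem_mul
        (leg_mem_LL _ (rankOne_mem_FR _ _)) (Submodule.mem_span_singleton_self _))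
        (leg_mem_LL _ (rankOne_mem_FR _ _)))
    -- Surjectivity of the transposed unitary: the prescribed kernel ρ ⊗ σ̄ is attained at its
    -- preimage.
    have h3 := this (star (transposeX n lam) (tmul (firstLast 1 1) ρ (star σ)))
    rwa [← mul_apply_eq_comp, h] at h3

theorem leg_injective {k l m : ℕ} (d : Fin k ⊕ Fin l ≃ Fin m) {f : Fin k → Fin m}
    (hf : Function.Injective f) (hd : ∀ i, d (Sum.inl i) = f i) {S T : Op n k}
    (h : leg f S hf = leg f T hf) : S = T := by
  obtain ⟨ζ, hζ⟩ := exists_unit n l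
  ext1 ξ
  refine ext_inner_left ℂ fun η => ?_
  have := congrArg (fun R : Op n m => inner ℂ (tmul d η ζ) (R (tmul d ξ ζ))) h
  simpa only [leg_fst_tmul d hf hd, inner_tmul, hζ, mul_one] using this

/-- Here the set of idle legs is empty, so the amplification is still not T by definition. After
adding a third leg both sides agree by functoriality, and leg numbering is injective. -/
theorem leg_id {T : Op n 2} : leg ![0, 1] T = T := by
  refine leg_injective (firstLast 2 1) (f := ![0, 1]) (by decide) (by decide) ?_
  rw [leg_leg_two]
  rfl

end Regular

/-! ## The algebras of slices -/

section SliceAlgebras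

variable (n : ℕ) (lam : ℝ)

theorem isRegular_X : IsRegular (Xop n lam) :=
  ⟨X_mem_unitary n lam, pentagon_X n lam, regular_X lam⟩

theorem star_X : star (Xop n lam) = leg ![1, 0] (Yop n lam) := by
  rw [Xop, ← leg_star, star_star]

theorem star_Y : star (Yop n lam) = leg ![1, 0] (Xop n lam) := by
  rw [Xop, leg_leg_two]
  exact leg_id.symm

/-- The span of the left slices of `X`. -/
def leftX : Submodule ℂ (Op n 1) := SL (lastFirst 1 1) (Xop n lam)

/-- The span of the right slices of `X`. -/
def rightX : Submodule ℂ (Op n 1) := SL (firstLast 1 1) (Xop n lam)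

theorem adj_eq_self {A : Type*} [NormedRing A] [NormedAlgebra ℂ A] [StarRing A] [StarModule ℂ A]
    {P : Submodule ℂ A} (h : P ≤ adj P) : adj P = P := by
  refine le_antisymm (fun a ha => ?_) h
  have := mem_adj.1 (h (mem_adj.1 ha))
  rwa [star_star] at this

theorem adj_leftX : adj (leftX n lam) = leftX n lam := by
  refine adj_eq_self (Submodule.span_le.2 ?_)
  rintro _ ⟨ξ, η, rfl⟩
  refine mem_adj.2 ?_
  have : star (sl (lastFirst 1 1) ξ η (Xop n lam)) =
      sl (lastFirst 1 1) (conjNeg n lam ξ) (conjNeg n lam η) (Xop n lam) := by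
    ext1 α
    refine ext_inner_left ℂ fun ζ => ?_
    rw [ContinuousLinearMap.star_eq_adjoint, ContinuousLinearMap.adjoint_inner_right,
      ← inner_conj_symm, inner_sl, inner_sl, tmul_swap, tmul_swap, tmul_swap, tmul_swap,
      conj_inner_X_left]
  rw [this]
  exact sl_mem_SL _ _ _ _

theorem adj_rightX : adj (rightX n lam) = rightX n lam := by
  refine adj_eq_self (Submodule.span_le.2 ?_)
  rintro _ ⟨ζ, α, rfl⟩
  refine mem_adj.2 ?_
  have : star (sl (firstLast 1 1) ζ α (Xop n lam)) =
      sl (firstLast 1 1) (conjDilate n lam ζ) (conjDilate n lam α) (Xop n lam) := by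
    ext1 η
    refine ext_inner_left ℂ fun ξ => ?_
    rw [ContinuousLinearMap.star_eq_adjoint, ContinuousLinearMap.adjoint_inner_right,
      ← inner_conj_symm, inner_sl, inner_sl, conj_inner_X_right]
  rw [this]
  exact sl_mem_SL _ _ _ _

/-- Taking adjoints and flipping turns (1 ⊗ K) X^* (K ⊗ 1) into (1 ⊗ K) Y^* (K ⊗ 1), because Y^* is
the flipped X. -/
theorem isRegular_Y : IsRegular (Yop n lam) := by
  refine ⟨Y_mem_unitary n lam, pentagon_Y n lam, ?_⟩
  have h0 : Function.Injective ![(1 : Fin 2), 0] := by decide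
  have hF : ∀ (i j : Fin 2) (h : Function.Injective ![i, j]),
      Ceq (LL ![i, j] (FR n 2) h) (on i (FR n 1) * on j (FR n 1)) := fun i j h =>
    (on_FR_mul_on_FR h).symm
  have h1 := regular_X (n := n) lam
  have h2 := (show Ceq _ _ from ⟨h1.1.adj, h1.2.adj⟩).LL _ h0
  rw [adj_FR, adj_mul, adj_mul, adj_on, adj_on, adj_FR, adj_line, star_star, LL_mul, LL_mul,
    LL_line, LL_on, LL_on, ← star_Y] at h2
  have h3 : Ceq (FR n 2) (on 0 (FR n 1) * on 1 (FR n 1)) :=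
    (LL_FR_mul_LL_FR (n := n) (firstLast 1 1) (f := ![0]) (g := ![1]) (by decide)
    (by decide) (by decide) (by decide)).symm
  have h4 : Ceq (on 1 (FR n 1) * on 0 (FR n 1)) (FR n 2) := by
    rw [on_comm (i := 1) (j := 0) (by decide)]
    exact h3.symm
  exact ((Ceq.of_eq (mul_assoc _ _ _)).trans (h2.trans (hF 1 0 h0))).trans h4

/-- The left slices of `Y` are the right slices of `X`. -/
theorem leftY_ceq : Ceq (SL (lastFirst 1 1) (Yop n lam)) (rightX n lam) := by
  have h0 : Function.Injective ![(1 : Fin 2), 0] := by decide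
  have h1 : Function.Injective ![(0 : Fin 2), 1] := by decide
  -- The operator X^* on the legs (0, 1) is Y on the legs (1, 0). Compressing leg 1 in both
  -- descriptions identifies the left slices of Y with the adjoints of the right slices of X.
  have e1 := compress_left (n := n) h0 (Yop n lam)
  have e2 := compress_right (n := n) h1 (star (Xop n lam))
  rw [← star_X] at e1
  rw [leg_id, e1, ← adj_SL] at e2
  have e3 := adj_rightX n lam
  rw [rightX] at e3
  rw [e3] at e2
  have e4 := Ceq.of_eq e2
  have h0 : ∀ i : Fin 1, firstLast 1 1 (Sum.inl i) = (![0] : Fin 1 → Fin 2) i := by decide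
  have h1 : ∀ i : Fin 1, firstLast 1 1 (Sum.inr i) = (![1] : Fin 1 → Fin 2) i := by decide
  exact ⟨cle_of_FR_mul _ _ _ h0 h1 e4.1, cle_of_FR_mul _ _ _ h0 h1 e4.2⟩

end SliceAlgebras

/-! ### The slices of X form algebras, of whose tensor product X is a multiplier. -/

section SliceAlgebras

variable (n : ℕ) (lam : ℝ)

theorem leftX_mul_leftX : Ceq (leftX n lam * leftX n lam) (leftX n lam) :=
  (isRegular_X n lam).slices_mul

theorem rightX_mul_rightX : Ceq (rightX n lam * rightX n lam) (rightX n lam) :=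
  ((leftY_ceq n lam).symm.mul (leftY_ceq n lam).symm).trans
    ((isRegular_Y n lam).slices_mul.trans (leftY_ceq n lam))

variable {n lam}

theorem IsRegular.cls_line_mul {W : Op n 2} (hW : IsRegular W) {m : ℕ} {i j : Fin m}
    (h : Function.Injective ![i, j]) :
    cls (line (leg ![i, j] W h)) * (cls (on i (FR n 1)) * cls (on j (SL (lastFirst 1 1) W))) =
      cls (on i (FR n 1)) * cls (on j (SL (lastFirst 1 1) W)) := by
  have := hW.line_mul.LL ![i, j] h
  rw [LL_mul, LL_mul, LL_line, LL_on, LL_on] at this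
  simp only [← map_mul]
  exact cls_eq.2 this

theorem cls_line_star_mul {m : ℕ} {T : Op n m} (hT : T ∈ unitary (Op n m))
    {P : (ceqCon (Op n m)).Quotient} (h : cls (line T) * P = P) : cls (line (star T)) * P = P := by
  conv_lhs => rw [← h]
  rw [← mul_assoc, ← map_mul, line_mul_line, hT.1, line, ← Submodule.one_eq_span, map_one, one_mul]

theorem cls_X_mul_left {m : ℕ} {i j : Fin m} (h : Function.Injective ![i, j]) :
    cls (line (leg ![i, j] (Xop n lam) h)) * (cls (on i (FR n 1)) * cls (on j (leftX n lam))) =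
      cls (on i (FR n 1)) * cls (on j (leftX n lam)) :=
  (isRegular_X n lam).cls_line_mul h

/-- This is regularity of Y: X on the legs (i, j) is the adjoint of Y on (j, i), and the left slices
of Y are the right slices of X. -/
theorem cls_X_mul_right {m : ℕ} {i j : Fin m} (h : Function.Injective ![i, j])
    (h' : Function.Injective ![j, i]) :
    cls (line (leg ![i, j] (Xop n lam) h)) * (cls (on j (FR n 1)) * cls (on i (rightX n lam))) =
      cls (on j (FR n 1)) * cls (on i (rightX n lam)) := by
  have := (isRegular_Y n lam).cls_line_mul h'
  rw [cls_eq.2 ((leftY_ceq n lam).on i)] at this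
  have := cls_line_star_mul (leg_mem_unitary (Y_mem_unitary n lam) _) this
  rwa [leg_Y n lam j i h' h, star_star] at this

/-- Applied with k on leg 1, b the right slices on leg 0, a the left slices on leg 2, x = X₀₁ and y
= X₁₂. Each of the four unitaries fixes k b or k a and commutes with the remaining factor. -/
theorem absorb_aux {M : Type*} [Monoid M] {x y x' y' k a b : M}
    (ha : y' * (k * a) = k * a) (ha' : y * (k * a) = k * a) (hb : x * (k * b) = k * b)
    (hb' : x' * (k * b) = k * b) (cab : b * a = a * b) (ckb : k * b = b * k) (ckc : k * a = a * k)
    (cb : y * b = b * y) (cb' : y' * b = b * y') (ca : x * a = a * x) (ca' : x' * a = a * x') :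
    x' * y * x * y' * (k * (b * a)) = k * (b * a) := by
  have e : k * (b * a) = b * (k * a) := by rw [← mul_assoc, ckb, mul_assoc]
  have e' : k * (b * a) = a * (k * b) := by rw [cab, ← mul_assoc, ckc, mul_assoc]
  have hy : y * (k * (b * a)) = k * (b * a) := by rw [e, ← mul_assoc, cb, mul_assoc, ha']
  have hy' : y' * (k * (b * a)) = k * (b * a) := by rw [e, ← mul_assoc, cb', mul_assoc, ha]
  have hx : x * (k * (b * a)) = k * (b * a) := by rw [e', ← mul_assoc, ca, mul_assoc, hb]
  have hx' : x' * (k * (b * a)) = k * (b * a) := by rw [e', ← mul_assoc, ca', mul_assoc, hb']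
  rw [mul_assoc, mul_assoc, mul_assoc, hy', hx, hy, hx']

variable (n lam)

/-- `X (B ⊗ A) = B ⊗ A` for the slice algebras of `X`. -/
theorem X_mul_slices :
    Ceq (line (Xop n lam) * (on 0 (rightX n lam) * on 1 (leftX n lam)))
      (on 0 (rightX n lam) * on 1 (leftX n lam)) := by
  have h02 : Function.Injective ![(0 : Fin 3), 2] := by decide
  have h12 : Function.Injective ![(1 : Fin 3), 2] := by decide
  have h01 : Function.Injective ![(0 : Fin 3), 1] := by decide
  have h10 : Function.Injective ![(1 : Fin 3), 0] := by decide
  have hu := X_mem_unitary n lam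
  -- The pentagon equation solved for X₀₂: every factor on the right meets the compact leg 1, where
  -- the absorption rules apply.
  have hp : leg ![0, 2] (Xop n lam) h02 = star (leg ![0, 1] (Xop n lam) h01) *
      leg ![1, 2] (Xop n lam) h12 * leg ![0, 1] (Xop n lam) h01 *
      star (leg ![1, 2] (Xop n lam) h12) := by
    have hp := pentagon_X n lam
    rw [mul_assoc (star _), ← hp, ← mul_assoc, ← mul_assoc,
      (leg_mem_unitary hu _).1, one_mul, mul_assoc, (leg_mem_unitary hu _).2, mul_one]
  have hL := cls_X_mul_left (n := n) (lam := lam) h12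
  have hR := cls_X_mul_right (n := n) (lam := lam) h01 h10
  have key := absorb_aux (cls_line_star_mul (leg_mem_unitary hu _) hL) hL hR
    (cls_line_star_mul (leg_mem_unitary hu _) hR)
    (cls_mul_eq (on_comm (i := 0) (j := 2) (by decide) _ _))
    (cls_mul_eq (on_comm (i := 1) (j := 0) (by decide) _ _))
    (cls_mul_eq (on_comm (i := 1) (j := 2) (by decide) _ _))
    (cls_mul_eq (on_line_comm h12 (i := 0) (by decide) _ _).symm)
    (by rw [← leg_star]; exact cls_mul_eq (on_line_comm h12 (i := 0) (by decide) _ _).symm)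
    (cls_mul_eq (on_line_comm h01 (i := 2) (by decide) _ _).symm)
    (by rw [← leg_star]; exact cls_mul_eq (on_line_comm h01 (i := 2) (by decide) _ _).symm)
  simp only [← map_mul, line_mul_line] at key
  rw [← hp] at key
  have key := cls_eq.1 key
  have e2 : LL ![(0 : Fin 3), 2] (on 0 (rightX n lam) * on 1 (leftX n lam)) h02 =
      on 0 (rightX n lam) * on 2 (leftX n lam) := by
    rw [LL_mul, LL_on, LL_on]; rfl
  have e3 : LL ![(0 : Fin 3), 2] (line (Xop n lam) *
      (on 0 (rightX n lam) * on 1 (leftX n lam))) h02 =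
      line (leg ![0, 2] (Xop n lam) h02) * (on 0 (rightX n lam) * on 2 (leftX n lam)) := by
    rw [LL_mul, e2, LL_line]
  rw [← mul_assoc, ← on_line_comm (i := 1) h02 (by decide), mul_assoc, ← e3, ← e2] at key
  have hd : ∀ i : Fin 2, (Equiv.ofBijective (Sum.elim ![0, 2] ![1]) (by decide) :
      Fin 2 ⊕ Fin 1 ≃ Fin 3) (Sum.inl i) = (![0, 2] : Fin 2 → Fin 3) i := by decide
  have hd' : ∀ i : Fin 1, (Equiv.ofBijective (Sum.elim ![0, 2] ![1]) (by decide) :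
      Fin 2 ⊕ Fin 1 ≃ Fin 3) (Sum.inr i) = (![1] : Fin 1 → Fin 3) i := by decide
  exact ⟨cle_of_FR_mul _ _ _ hd hd' key.1, cle_of_FR_mul _ _ _ hd hd' key.2⟩

end SliceAlgebras

/-! ## Slices by normal functionals -/

section NormalSlices

variable {n k l m : ℕ}

theorem slice_mem_closure (d : Fin k ⊕ Fin l ≃ Fin m) (ω : NormalFunctional n l) (T : Op n m) :
    slice d ω T ∈ (SL d T).topologicalClosure := by
  by_cases h : Summable fun i => sl d (ω.ξ i) (ω.η i) T
  · refine (SL d T).isClosed_topologicalClosure.mem_of_tendsto h.hasSum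
      (Filter.Eventually.of_forall fun s => ?_)
    exact Submodule.sum_mem _ fun i _ => Submodule.le_topologicalClosure _ (sl_mem_SL _ _ _ _)
  -- A sum that is not summable is 0 by convention, and 0 lies in every subspace, so convergence of
  -- the series need not be shown for this inclusion.
  · have : slice d ω T = 0 := tsum_eq_zero_of_not_summable h
    rw [this]
    exact zero_mem _

theorem sl_smul_left (d : Fin k ⊕ Fin l ≃ Fin m) (r : ℂ) (ζ ζ' : HT n l) (T : Op n m) :
    sl d (r • ζ) ζ' T = r • sl d ζ ζ' T := by
  ext1 ξ
  refine ext_inner_left ℂ fun η => ?_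
  rw [inner_sl, tmul_smul_right, map_smul, inner_smul_right, smul_apply, inner_smul_right,
    inner_sl]

theorem exists_slice_of_mem (d : Fin k ⊕ Fin l ≃ Fin m) (T : Op n m) {S : Op n k}
    (hS : S ∈ SL d T) : ∃ ω : NormalFunctional n l, S = slice d ω T := by
  obtain ⟨N, c, g, rfl⟩ := Submodule.mem_span_set'.1 hS
  choose ζ ζ' hζ using fun i => (g i).2
  have hfin : ∀ u : Fin N → HT n l,
      Summable fun i => ‖if h : i < N then u ⟨i, h⟩ else 0‖ ^ 2 := fun u =>
    summable_of_ne_finset_zero (s := Finset.range N) fun i hi => by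
      rw [dif_neg (by simpa using hi)]; simp
  -- A finite combination of vector functionals is padded by zero vectors, its coefficients being
  -- absorbed into the first family, where the slice is linear.
  refine ⟨⟨fun i => if h : i < N then c ⟨i, h⟩ • ζ ⟨i, h⟩ else 0,
    fun i => if h : i < N then ζ' ⟨i, h⟩ else 0, hfin fun i => c i • ζ i, hfin ζ'⟩, ?_⟩
  have h1 := tsum_eq_sum (L := SummationFilter.unconditional ℕ) (f := fun i => sl d (if h : i < N then c ⟨i, h⟩ • ζ ⟨i, h⟩ else 0)
    (if h : i < N then ζ' ⟨i, h⟩ else 0) T) (s := Finset.range N) fun i hi => by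
      rw [dif_neg (by simpa using hi), ← zero_smul ℂ (0 : HT n l), sl_smul_left, zero_smul]
  refine Eq.trans ?_ h1.symm
  rw [← Fin.sum_univ_eq_sum_range (fun i => sl d (if h : i < N then c ⟨i, h⟩ • ζ ⟨i, h⟩ else 0)
    (if h : i < N then ζ' ⟨i, h⟩ else 0) T)]
  refine Finset.sum_congr rfl fun i _ => ?_
  rw [dif_pos i.2, dif_pos i.2, sl_smul_left, hζ]

/-- Normal functionals and finite sums of vector functionals thus give the same closure, and all
later work may use the latter. -/
theorem closure_slices (d : Fin k ⊕ Fin l ≃ Fin m) (T : Op n m) :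
    closure {a | ∃ ω : NormalFunctional n l, a = slice d ω T} =
      ((SL d T).topologicalClosure : Set (Op n k)) := by
  refine subset_antisymm (closure_minimal ?_ (SL d T).isClosed_topologicalClosure)
    (closure_mono fun S hS => exists_slice_of_mem d T hS)
  rintro _ ⟨ω, rfl⟩
  exact slice_mem_closure d ω T

variable (n) (lam : ℝ)

theorem algAhatOp_eq : algAhatOp n lam = ((rightX n lam).topologicalClosure : Set (Op n 1)) :=
  closure_slices _ _

theorem algAD_eq : algAD n lam =
    ((SL (firstLast 2 2) (VD n lam)).topologicalClosure : Set (Op n 2)) :=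
  closure_slices _ _

/-- Conjugating the sliced leg by j only replaces the vectors ζ, ζ' of the functional by jζ, jζ'. -/
theorem SL_conj_le (j : Op n 1) (T : Op n 2) :
    SL (lastFirst 1 1) (star (leg ![0] j) * T * leg ![0] j) ≤ SL (lastFirst 1 1) T := by
  refine Submodule.span_le.2 ?_
  rintro _ ⟨ζ, ζ', rfl⟩
  have h0 : ∀ i : Fin 1, lastFirst 1 1 (Sum.inr i) = (![0] : Fin 1 → Fin 2) i := by decide
  have : sl (lastFirst 1 1) ζ ζ' (star (leg ![0] j) * T * leg ![0] j) =
      sl (lastFirst 1 1) (j ζ) (j ζ') T := by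
    ext1 ξ
    refine ext_inner_left ℂ fun η => ?_
    rw [inner_sl, inner_sl, mul_apply_eq_comp, mul_apply_eq_comp,
      ContinuousLinearMap.star_eq_adjoint, ContinuousLinearMap.adjoint_inner_right,
      leg_snd_tmul _ _ h0, leg_snd_tmul _ _ h0]
  rw [this]
  exact sl_mem_SL _ _ _ _

theorem algA_eq : algA n lam = ((leftX n lam).topologicalClosure : Set (Op n 1)) := by
  have hj : (leg ![0] (jop n lam) * leg ![0] (jop n lam) : Op n 2) = 1 := by
    rw [← leg_mul, jop_mul_self, leg_one]
  have hs : star (leg ![0] (jop n lam) : Op n 2) = leg ![0] (jop n lam) := by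
    rw [← leg_star, star_jop]
  -- Thus U_A and X^* have the same left slices, and those of X^* are the adjoints of those of X, a
  -- selfadjoint space.
  have hX : star (Xop n lam) = leg ![0] (jop n lam) * UA n lam * leg ![0] (jop n lam) := by
    rw [star_X, Yop, leg_leg_two]
    exact leg_id
  have h1 := SL_conj_le n (jop n lam) (UA n lam)
  have h2 := SL_conj_le n (jop n lam) (star (Xop n lam))
  rw [hs] at h1 h2
  rw [← hX, ← adj_SL] at h1
  rw [← adj_SL, hX, mul_assoc, mul_assoc, mul_assoc, hj, mul_one, ← mul_assoc, hj, one_mul] at h2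
  have h3 : SL (lastFirst 1 1) (UA n lam) = leftX n lam := by
    rw [← adj_leftX]
    exact le_antisymm h2 h1
  rw [← h3]
  exact closure_slices _ _

end NormalSlices

/-! ## Tensor products, multipliers and extensions -/

section Multipliers

variable {n k l k' l' m : ℕ}

theorem cstarTensor_eq (P : Submodule ℂ (Op n k)) (Q : Submodule ℂ (Op n l))
    (h1 : Function.Injective (Fin.castAdd l : Fin k → _))
    (h2 : Function.Injective (Fin.natAdd k : Fin l → _)) :
    cstarTensor (P.topologicalClosure : Set (Op n k)) (Q.topologicalClosure : Set (Op n l)) =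
      (LL (Fin.castAdd l) P h1 * LL (Fin.natAdd k) Q h2).topologicalClosure := by
  have e : Submodule.span ℂ {T | ∃ b ∈ (P.topologicalClosure : Set (Op n k)),
      ∃ c ∈ (Q.topologicalClosure : Set (Op n l)), T = opTensor b c} =
      LL (Fin.castAdd l) P.topologicalClosure h1 * LL (Fin.natAdd k) Q.topologicalClosure h2 := by
    refine le_antisymm (Submodule.span_le.2 ?_) (Submodule.mul_le.2 ?_)
    · rintro _ ⟨b, hb, c, hc, rfl⟩
      rw [opTensor_eq b c h1 h2]
      exact Submodule.mul_mem_mul (leg_mem_LL _ hb) (leg_mem_LL _ hc)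
    · rintro _ ⟨b, hb, rfl⟩ _ ⟨c, hc, rfl⟩
      exact Submodule.subset_span ⟨b, hb, c, hc, (opTensor_eq b c h1 h2).symm⟩
  rw [cstarTensor, e]
  have hP : Ceq P.topologicalClosure P := ⟨le_rfl, Cle.of_le P.le_topologicalClosure⟩
  have hQ : Ceq Q.topologicalClosure Q := ⟨le_rfl, Cle.of_le Q.le_topologicalClosure⟩
  have h := (hP.LL (Fin.castAdd l) h1).mul (hQ.LL (Fin.natAdd k) h2)
  exact le_antisymm
    (Submodule.topologicalClosure_minimal _ h.1 (Submodule.isClosed_topologicalClosure _))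
    (Submodule.topologicalClosure_minimal _ h.2 (Submodule.isClosed_topologicalClosure _))

theorem Cle.mul_mul_of_comm {A : Type*} [NormedRing A] [NormedAlgebra ℂ A] {P Q : Submodule ℂ A}
    (hP : Cle (P * P) P) (hQ : Cle (Q * Q) Q) (h : Q * P = P * Q) :
    Cle (P * Q * (P * Q)) (P * Q) := by
  have e : P * Q * (P * Q) = P * P * (Q * Q) := by
    calc _ = P * (Q * P) * Q := by simp only [mul_assoc]
      _ = _ := by rw [h]; simp only [mul_assoc]
  rw [e]
  exact hP.mul hQ

theorem mul_mem_closure {P Q R : Submodule ℂ (Op n k)} (h : Cle (P * Q) R) {a b : Op n k}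
    (ha : a ∈ P.topologicalClosure) (hb : b ∈ Q.topologicalClosure) :
    a * b ∈ R.topologicalClosure := by
  have h1 : Cle (P.topologicalClosure * Q.topologicalClosure) (P * Q) :=
    Cle.mul (show Cle P.topologicalClosure P from le_rfl)
      (show Cle Q.topologicalClosure Q from le_rfl)
  exact (h1.trans h) (Submodule.mul_mem_mul ha hb)

theorem star_mem_closure {P : Submodule ℂ (Op n k)} (h : Cle (adj P) P) {a : Op n k}
    (ha : a ∈ P.topologicalClosure) : star a ∈ P.topologicalClosure := by
  have h1 : Cle (adj P.topologicalClosure) (adj P) :=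
    Cle.adj (show Cle P.topologicalClosure P from le_rfl)
  exact (h1.trans h) (mem_adj.2 (by rwa [star_star]))

/-- Right multiplication is reduced to left multiplication by b T = (T^* b^*)^*. -/
theorem mem_multiplierAlgebra {P : Submodule ℂ (Op n k)} (hP : Cle (adj P) P) {T : Op n k}
    (h1 : Cle (line T * P) P) (h2 : Cle (line (star T) * P) P) :
    T ∈ multiplierAlgebra P.topologicalClosure := by
  have hm : ∀ S : Op n k, S ∈ (line S).topologicalClosure := fun S =>
    Submodule.le_topologicalClosure _ (Submodule.mem_span_singleton_self S)
  have key : ∀ S : Op n k, Cle (line S * P) P → Cle (line (star S) * P) P →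
      ∀ b ∈ P.topologicalClosure, S * b ∈ P.topologicalClosure ∧ b * S ∈ P.topologicalClosure := by
    intro S hS hS' b hb
    refine ⟨mul_mem_closure hS (hm S) hb, ?_⟩
    have := star_mem_closure hP (mul_mem_closure hS' (hm _) (star_mem_closure hP hb))
    rwa [star_mul, star_star, star_star] at this
  exact ⟨key T h1 h2, key (star T) h2 (by rwa [star_star])⟩

theorem isClosed_multiplierAlgebra {E : Submodule ℂ (Op n k)} (hE : IsClosed (E : Set (Op n k))) :
    IsClosed (multiplierAlgebra E : Set (Op n k)) := by
  have : (multiplierAlgebra E : Set (Op n k)) = ⋂ b ∈ E, {T : Op n k | T * b ∈ E} ∩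
      {T | b * T ∈ E} ∩ ({T | star T * b ∈ E} ∩ {T | b * star T ∈ E}) := by
    ext T
    simp only [Set.mem_iInter, Set.mem_inter_iff]
    exact ⟨fun h b hb => ⟨h.1 b hb, h.2 b hb⟩,
      fun h => ⟨fun b hb => (h b hb).1, fun b hb => (h b hb).2⟩⟩
  rw [this]
  refine isClosed_biInter fun b _ => ((hE.preimage ?_).inter (hE.preimage ?_)).inter
    ((hE.preimage ?_).inter (hE.preimage ?_)) <;> fun_prop

/-- A space of operators with dense range. -/
def Nondeg (P : Submodule ℂ (Op n k)) : Prop := Cle (FR n k) (P * FR n k)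

/-- D kills the dense range of P, expressed through finite rank operators; evaluating at |ξ⟩⟨ζ|
gives Dξ = 0 for every ξ. -/
theorem Nondeg.eq_zero {P : Submodule ℂ (Op n k)} (h : Nondeg P) {D : Op n k}
    (hD : ∀ p ∈ P, D * p = 0) : D = 0 := by
  have h1 : ∀ T ∈ FR n k, D * T = 0 := by
    intro T hT
    have : (P * FR n k).topologicalClosure ≤ LinearMap.ker (LinearMap.mulLeft ℂ D) := by
      refine Submodule.topologicalClosure_minimal _ (Submodule.mul_le.2 fun p hp q _ => ?_) ?_
      · rw [LinearMap.mem_ker, LinearMap.mulLeft_apply, ← mul_assoc, hD p hp, zero_mul]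
      · exact isClosed_singleton.preimage (continuous_const_mul D)
    exact this (h hT)
  obtain ⟨ζ, hζ⟩ := exists_unit n k
  ext1 ξ
  have h2 := congrArg (fun T : Op n k => T ζ) (h1 _ (rankOne_mem_FR ξ ζ))
  simp only [mul_apply_eq_comp, InnerProductSpace.rankOne_apply, hζ, one_smul] at h2
  simpa using h2

/-- A `*`-homomorphism on a closed `*`-subalgebra is determined by its values on a set on the closed
span of the latter. -/
theorem exists_eq_of_mem_closure_span {A B : Type*} [CStarAlgebra A] [CStarAlgebra B]
    {S : StarSubalgebra ℂ A} (hS : IsClosed (S : Set A)) (Ψ : S →⋆ₐ[ℂ] B) (Φ : A →⋆ₐ[ℂ] B)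
    {s : Set A} (hs : ∀ x ∈ s, ∃ h : x ∈ S, Ψ ⟨x, h⟩ = Φ x) {x : A}
    (hx : x ∈ (Submodule.span ℂ s).topologicalClosure) : ∃ h : x ∈ S, Ψ ⟨x, h⟩ = Φ x := by
  -- Being closed, S is itself a C*-algebra, so the *-homomorphism is automatically contractive.
  have hcΨ : Continuous Ψ := by
    refine AddMonoidHomClass.continuous_of_bound Ψ 1 fun a => ?_
    rw [one_mul]
    exact NonUnitalStarAlgHom.norm_apply_le Ψ a
  have hcΦ : Continuous Φ := by
    refine AddMonoidHomClass.continuous_of_bound Φ 1 fun a => ?_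
    rw [one_mul]
    exact NonUnitalStarAlgHom.norm_apply_le Φ a
  have hclosed : IsClosed (Subtype.val '' {y : S | Ψ y = Φ y}) :=
    hS.isClosedEmbedding_subtypeVal.isClosedMap _
      (isClosed_eq hcΨ (hcΦ.comp continuous_subtype_val))
  have hspan : (Submodule.span ℂ s : Set A) ⊆ Subtype.val '' {y : S | Ψ y = Φ y} := by
    intro y hy
    induction hy using Submodule.span_induction with
    | mem y hy =>
      obtain ⟨h, h'⟩ := hs y hy
      exact ⟨⟨y, h⟩, h', rfl⟩
    | zero => exact ⟨0, by simp, rfl⟩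
    | add y z _ _ hy hz =>
      obtain ⟨y, hy, rfl⟩ := hy
      obtain ⟨z, hz, rfl⟩ := hz
      refine ⟨y + z, ?_, rfl⟩
      change Ψ (y + z) = Φ ((y : A) + z)
      rw [map_add, map_add]
      exact congrArg₂ _ hy hz
    | smul r y _ hy =>
      obtain ⟨y, hy, rfl⟩ := hy
      refine ⟨r • y, ?_, rfl⟩
      change Ψ (r • y) = Φ (r • (y : A))
      rw [map_smul, map_smul]
      exact congrArg _ hy
  obtain ⟨y, hy, rfl⟩ := closure_minimal hspan hclosed hx
  exact ⟨y.2, hy⟩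

/-- A `*`-homomorphism defined on all operators restricts to the unique extension of `φ ⊗ ψ`. -/
theorem isTensorValue_of_hom {P : Submodule ℂ (Op n k)} {Q : Submodule ℂ (Op n l)}
    (hP : Cle (P * P) P) (hP' : Cle (adj P) P) (hQ : Cle (Q * Q) Q) (hQ' : Cle (adj Q) Q)
    (h1 : Function.Injective (Fin.castAdd l : Fin k → _))
    (h2 : Function.Injective (Fin.natAdd k : Fin l → _))
    {φ : Op n k → Op n k'} {ψ : Op n l → Op n l'} (Φ : Op n (k + l) →⋆ₐ[ℂ] Op n (k' + l'))
    (hΦ : ∀ b ∈ P.topologicalClosure, ∀ c ∈ Q.topologicalClosure,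
      Φ (opTensor b c) = opTensor (φ b) (ψ c))
    (hnd : Nondeg ((LL (Fin.castAdd l) P h1 * LL (Fin.natAdd k) Q h2).map
      Φ.toAlgHom.toLinearMap))
    (m : multiplierAlgebra (cstarTensor (P.topologicalClosure : Set (Op n k))
      (Q.topologicalClosure : Set (Op n l)))) :
    IsTensorValue (P.topologicalClosure : Set (Op n k)) (Q.topologicalClosure : Set (Op n l))
      φ ψ m (Φ m) := by
  obtain ⟨E, hE⟩ : ∃ E, E = cstarTensor (P.topologicalClosure : Set (Op n k))
    (Q.topologicalClosure : Set (Op n l)) := ⟨_, rfl⟩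
  have hEeq := cstarTensor_eq P Q h1 h2
  rw [← hE] at hEeq
  have hcomm : LL (Fin.natAdd k) Q h2 * LL (Fin.castAdd l) P h1 =
      LL (Fin.castAdd l) P h1 * LL (Fin.natAdd k) Q h2 := by
    refine LL_comm Q P h2 h1 fun i j h => ?_
    have := congrArg Fin.val h
    simp at this
    omega
  have hmul : Cle (LL (Fin.castAdd l) P h1 * LL (Fin.natAdd k) Q h2 *
      (LL (Fin.castAdd l) P h1 * LL (Fin.natAdd k) Q h2))
      (LL (Fin.castAdd l) P h1 * LL (Fin.natAdd k) Q h2) := by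
    have h3 := hP.LL (Fin.castAdd l) h1
    have h4 := hQ.LL (Fin.natAdd k) h2
    rw [LL_mul] at h3 h4
    exact h3.mul_mul_of_comm h4 hcomm
  have hadj : Cle (adj (LL (Fin.castAdd l) P h1 * LL (Fin.natAdd k) Q h2))
      (LL (Fin.castAdd l) P h1 * LL (Fin.natAdd k) Q h2) := by
    rw [adj_mul, adj_LL, adj_LL, ← hcomm]
    exact (hQ'.LL _ _).mul (hP'.LL _ _)
  have hsub : ∀ e ∈ E, e ∈ multiplierAlgebra E := by
    intro e he
    rw [hEeq] at he ⊢
    exact ⟨fun b hb => ⟨mul_mem_closure hmul he hb, mul_mem_closure hmul hb he⟩, fun b hb =>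
      ⟨mul_mem_closure hmul (star_mem_closure hadj he) hb,
        mul_mem_closure hmul hb (star_mem_closure hadj he)⟩⟩
  have hten : ∀ b ∈ P.topologicalClosure, ∀ c ∈ Q.topologicalClosure, opTensor b c ∈ E :=
    fun b hb c hc => hE ▸ Submodule.le_topologicalClosure _
      (Submodule.subset_span ⟨b, hb, c, hc, rfl⟩)
  have hEc : IsClosed (E : Set (Op n (k + l))) := hE ▸ Submodule.isClosed_topologicalClosure _
  have hM : IsClosed (multiplierAlgebra E : Set (Op n (k + l))) := isClosed_multiplierAlgebra hEc
  have huniq : ∀ Ψ : multiplierAlgebra E →⋆ₐ[ℂ] Op n (k' + l'),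
      (∀ b ∈ P.topologicalClosure, ∀ c ∈ Q.topologicalClosure,
        ∃ h : opTensor b c ∈ multiplierAlgebra E, Ψ ⟨opTensor b c, h⟩ = opTensor (φ b) (ψ c)) →
      ∀ x, Ψ x = Φ x := by
    intro Ψ hΨ x
    have hagree : ∀ e ∈ E, ∃ h : e ∈ multiplierAlgebra E, Ψ ⟨e, h⟩ = Φ e := by
      intro e he
      refine exists_eq_of_mem_closure_span hM Ψ Φ (s := {T | ∃ b ∈ (P.topologicalClosure :
        Set (Op n k)), ∃ c ∈ (Q.topologicalClosure : Set (Op n l)), T = opTensor b c}) ?_ (by rw [hE] at he; exact he)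
      rintro _ ⟨b, hb, c, hc, rfl⟩
      rw [hΦ b hb c hc]
      exact hΨ b hb c hc
    -- For e in the tensor product, x e lies there too, where Ψ and Φ agree; so (Ψ x - Φ x) Φ(e) =
    -- 0, and nondegeneracy of the image of Φ forces equality.
    rw [← sub_eq_zero]
    refine hnd.eq_zero ?_
    rintro _ ⟨e, he, rfl⟩
    have he' : e ∈ E := hEeq ▸ Submodule.le_topologicalClosure _ he
    obtain ⟨h, h3⟩ := hagree e he'
    obtain ⟨h', h4⟩ := hagree _ (x.2.1 e he').1
    change (Ψ x - Φ x) * Φ e = 0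
    have h5 : Ψ x * Ψ ⟨e, h⟩ = Ψ ⟨x.1 * e, h'⟩ := (map_mul Ψ x ⟨e, h⟩).symm
    rw [sub_mul, ← map_mul, ← h4, ← h5, h3, sub_self]
  subst hE
  exact ⟨Φ.comp (multiplierAlgebra _).subtype, fun b hb c hc =>
    ⟨hsub _ (hten b hb c hc), hΦ b hb c hc⟩, fun Ψ hΨ => by ext1 x; exact huniq Ψ hΨ x, rfl⟩

end Multipliers

/-! ## The algebra of the quantum double -/

section Double

variable {n k l m : ℕ}

theorem Ceq.closure_eq {A : Type*} [NormedRing A] [NormedAlgebra ℂ A] {P Q : Submodule ℂ A}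
    (h : Ceq P Q) : P.topologicalClosure = Q.topologicalClosure :=
  le_antisymm
    (Submodule.topologicalClosure_minimal _ h.1 (Submodule.isClosed_topologicalClosure _))
    (Submodule.topologicalClosure_minimal _ h.2 (Submodule.isClosed_topologicalClosure _))

theorem cls_line_star_mul_cls_line {T : Op n m} (hT : T ∈ unitary (Op n m)) :
    cls (line (star T)) * cls (line T) = 1 := by
  rw [← map_mul, line_mul_line, hT.1, line, ← Submodule.one_eq_span, map_one]

theorem cls_on_mul (i : Fin m) {P Q R : Submodule ℂ (Op n 1)} (h : Ceq (P * Q) R) :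
    cls (on i P) * cls (on i Q) = cls (on i R : Submodule ℂ (Op n m)) := by
  rw [← map_mul, ← on_mul]
  exact cls_eq.2 (h.on i)

variable (n) (lam : ℝ)

/-- `π(A)` for the left slices of `X`. -/
def piLeftX : Submodule ℂ (Op n 2) :=
  line (Zop n lam) * on 1 (leftX n lam) * line (star (Zop n lam))

/-- `π(A) (Â^op ⊗ 1)`, for the slices of `X`. -/
def doubleX : Submodule ℂ (Op n 2) := piLeftX n lam * on 0 (rightX n lam)

theorem LL_piLeftX {f : Fin 2 → Fin m} (hf : Function.Injective f) :
    LL f (piLeftX n lam) hf = line (leg f (Zop n lam) hf) * on (f 1) (leftX n lam) *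
      line (star (leg f (Zop n lam) hf)) := by
  rw [piLeftX, LL_mul, LL_mul, LL_line, LL_line, LL_on, leg_star]

theorem LL_doubleX {f : Fin 2 → Fin m} (hf : Function.Injective f) :
    LL f (doubleX n lam) hf = LL f (piLeftX n lam) hf * on (f 0) (rightX n lam) := by
  rw [doubleX, LL_mul, LL_on]

/-- The right slices of `Y` are the left slices of `X`. -/
theorem rightY_ceq : Ceq (SL (firstLast 1 1) (Yop n lam)) (leftX n lam) := by
  have h0 : Function.Injective ![(1 : Fin 2), 0] := by decide
  have h1 : Function.Injective ![(0 : Fin 2), 1] := by decide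
  have e1 := compress_right (n := n) h0 (Yop n lam)
  have e2 := compress_left (n := n) h1 (star (Xop n lam))
  rw [← star_X] at e1
  rw [leg_id, e1, ← adj_SL] at e2
  have e3 := adj_leftX n lam
  rw [leftX] at e3
  rw [e3] at e2
  have e4 := Ceq.of_eq e2
  have h0 : ∀ i : Fin 1, lastFirst 1 1 (Sum.inl i) = (![1] : Fin 1 → Fin 2) i := by decide
  have h1 : ∀ i : Fin 1, lastFirst 1 1 (Sum.inr i) = (![0] : Fin 1 → Fin 2) i := by decide
  exact ⟨cle_of_FR_mul _ _ _ h0 h1 e4.1, cle_of_FR_mul _ _ _ h0 h1 e4.2⟩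

variable {n lam}

theorem cls_compress_Y {i j : Fin m} (h : Function.Injective ![i, j]) :
    cls (on j (FR n 1)) * cls (line (leg ![i, j] (Yop n lam) h)) * cls (on j (FR n 1)) =
      cls (on j (FR n 1)) * cls (on i (leftX n lam)) := by
  rw [← cls_eq.2 ((rightY_ceq n lam).on i)]
  simp only [← map_mul, compress_right]

theorem cls_compress_X {i j : Fin m} (h : Function.Injective ![i, j]) :
    cls (on j (FR n 1)) * cls (line (leg ![i, j] (Xop n lam) h)) * cls (on j (FR n 1)) =
      cls (on j (FR n 1)) * cls (on i (rightX n lam)) := by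
  simp only [← map_mul, compress_right, rightX]

/-- Z does not touch the compressed leg, so the slices of Ỹ are the conjugates by Z of the right
slices of Y, that is, of the left slices of X. -/
theorem cls_compress_Yt {i j l : Fin m} (h : Function.Injective ![i, j, l])
    (h1 : Function.Injective ![i, j]) (h2 : Function.Injective ![j, l]) :
    cls (on l (FR n 1)) * cls (line (leg ![i, j, l] (Yt n lam) h)) * cls (on l (FR n 1)) =
      cls (on l (FR n 1)) * cls (LL ![i, j] (piLeftX n lam) h1) := by
  have hil : l ≠ i := fun e => by
    have := @h 2 0 (by simp [e])
    simp at this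
  have hjl : l ≠ j := fun e => by
    have := @h 2 1 (by simp [e])
    simp at this
  have c1 : cls (on l (FR n 1)) * cls (line (leg ![i, j] (Zop n lam) h1)) =
      cls (line (leg ![i, j] (Zop n lam) h1)) * cls (on l (FR n 1)) :=
    cls_mul_eq (on_line_comm h1 (by intro a; fin_cases a <;> simpa) _ _)
  have c2 : cls (on l (FR n 1)) * cls (line (star (leg ![i, j] (Zop n lam) h1))) =
      cls (line (star (leg ![i, j] (Zop n lam) h1))) * cls (on l (FR n 1)) := by
    rw [← leg_star]
    exact cls_mul_eq (on_line_comm h1 (by intro a; fin_cases a <;> simpa) _ _)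
  rw [leg_Yt n lam i j l h h1 h2, ← line_mul_line, ← line_mul_line, LL_piLeftX]
  simp only [map_mul]
  have := cls_compress_Y (n := n) (lam := lam) h2
  calc _ = (cls (on l (FR n 1)) * cls (line (leg ![i, j] (Zop n lam) h1))) *
        cls (line (leg ![j, l] (Yop n lam) h2)) *
        (cls (line (star (leg ![i, j] (Zop n lam) h1))) * cls (on l (FR n 1))) := by
          simp only [mul_assoc]
    _ = cls (line (leg ![i, j] (Zop n lam) h1)) * (cls (on l (FR n 1)) *
        cls (line (leg ![j, l] (Yop n lam) h2)) * cls (on l (FR n 1))) *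
        cls (line (star (leg ![i, j] (Zop n lam) h1))) := by
          rw [c1, ← c2]; simp only [mul_assoc]
    _ = (cls (line (leg ![i, j] (Zop n lam) h1)) * cls (on l (FR n 1))) *
        cls (on j (leftX n lam)) * cls (line (star (leg ![i, j] (Zop n lam) h1))) := by
          rw [this]; simp only [mul_assoc]
    _ = _ := by rw [← c1]; simp only [mul_assoc]; rfl

/-- For V_D = y x with y = Ỹ₀₁₃ and x = X₀₂ the two compressed legs are independent, so the slices
are products of the slices p of y and b of x. The next lemma treats the reversed order. -/
theorem compress_double_aux {M : Type*} [Monoid M] {k2 k3 y x b p : M} (c : k2 * k3 = k3 * k2)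
    (cy : k2 * y = y * k2) (cx : k3 * x = x * k3) (cp : k2 * p = p * k2)
    (hy : k3 * y * k3 = k3 * p) (hx : k2 * x * k2 = k2 * b) :
    k2 * k3 * (y * x) * (k2 * k3) = k2 * k3 * (p * b) := by
  calc _ = k2 * k3 * (y * x) * (k3 * k2) := by rw [c]
    _ = k3 * (k2 * y) * (x * k3) * k2 := by rw [c]; simp only [mul_assoc]
    _ = k3 * y * (k2 * k3) * x * k2 := by rw [cy, ← cx]; simp only [mul_assoc]
    _ = (k3 * y * k3) * (k2 * x * k2) := by rw [c]; simp only [mul_assoc]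
    _ = k3 * (p * k2) * b := by rw [hy, hx]; simp only [mul_assoc]
    _ = _ := by rw [← cp, c]; simp only [mul_assoc]

theorem compress_double_aux' {M : Type*} [Monoid M] {k2 k3 y x b p : M} (c : k2 * k3 = k3 * k2)
    (cy : k2 * y = y * k2) (cx : k3 * x = x * k3) (cb : k3 * b = b * k3)
    (hy : k3 * y * k3 = k3 * p) (hx : k2 * x * k2 = k2 * b) :
    k2 * k3 * (x * y) * (k2 * k3) = k2 * k3 * (b * p) := by
  calc _ = k2 * (k3 * x) * (y * k2) * k3 := by simp only [mul_assoc]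
    _ = k2 * x * (k3 * k2) * y * k3 := by rw [cx, ← cy]; simp only [mul_assoc]
    _ = (k2 * x * k2) * (k3 * y * k3) := by rw [← c]; simp only [mul_assoc]
    _ = k2 * (b * k3) * p := by rw [hy, hx]; simp only [mul_assoc]
    _ = _ := by rw [← cb]; simp only [mul_assoc]

theorem cle_of_cls_on_mul {P Q : Submodule ℂ (Op n 2)}
    (h : cls (on 2 (FR n 1)) * cls (on 3 (FR n 1)) * cls (LL ![(0 : Fin 4), 1] P) =
      cls (on 2 (FR n 1)) * cls (on 3 (FR n 1)) * cls (LL ![(0 : Fin 4), 1] Q)) : Ceq P Q := by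
  have h23 : Function.Injective ![(2 : Fin 4), 3] := by decide
  rw [← map_mul, cls_eq.2 (on_FR_mul_on_FR h23), ← map_mul, ← map_mul] at h
  have h := cls_eq.1 h
  have hd : ∀ i : Fin 2, firstLast 2 2 (Sum.inl i) = (![0, 1] : Fin 2 → Fin 4) i := by decide
  have hd' : ∀ i : Fin 2, firstLast 2 2 (Sum.inr i) = (![2, 3] : Fin 2 → Fin 4) i := by decide
  exact ⟨cle_of_FR_mul _ _ _ hd hd' h.1, cle_of_FR_mul _ _ _ hd hd' h.2⟩

variable (n lam)

/-- `A_D` is spanned by the products of the slices of `X`. -/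
theorem SL_VD : Ceq (SL (firstLast 2 2) (VD n lam)) (doubleX n lam) := by
  have h013 : Function.Injective ![(0 : Fin 4), 1, 3] := by decide
  have h01 : Function.Injective ![(0 : Fin 4), 1] := by decide
  have h02 : Function.Injective ![(0 : Fin 4), 2] := by decide
  have h23 : Function.Injective ![(2 : Fin 4), 3] := by decide
  have hd : ∀ i : Fin 2, firstLast 2 2 (Sum.inl i) = (![0, 1] : Fin 2 → Fin 4) i := by decide
  have hd' : ∀ i : Fin 2, firstLast 2 2 (Sum.inr i) = (![2, 3] : Fin 2 → Fin 4) i := by decide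
  have h := compress_double_aux
    (cls_mul_eq (on_comm (i := 2) (j := 3) (by decide) (FR n 1) (FR n 1)))
    (cls_mul_eq (on_line_comm (i := 2) h013 (by decide) (FR n 1) (Yt n lam)))
    (cls_mul_eq (on_line_comm (i := 3) h02 (by decide) (FR n 1) (Xop n lam)))
    (cls_mul_eq (LL_comm (f := ![2]) (FR n 1) (piLeftX n lam) _ h01 (by decide)))
    (cls_compress_Yt h013 h01 (by decide)) (cls_compress_X h02)
  have h2 := congrArg cls (FR_mul_mul_FR (n := n) (firstLast 2 2) h01 h23 hd hd' (VD n lam))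
  rw [map_mul, map_mul, map_mul, ← cls_eq.2 (on_FR_mul_on_FR h23), VD_eq, ← line_mul_line,
    map_mul, map_mul, h] at h2
  refine cle_of_cls_on_mul ?_
  rw [LL_doubleX, map_mul]
  rw [VD_eq]
  exact h2.symm

/-- The interchange that makes A_D a *-algebra. The two orders of multiplication are the slices of
X₀₂Ỹ₀₁₃ and of Ỹ₀₁₃X₀₂, which are conjugate by Z₂₃; on compressed legs Z₂₃ is absorbed. -/
theorem rightX_mul_piLeftX : Ceq (on 0 (rightX n lam) * piLeftX n lam) (doubleX n lam) := by
  have h013 : Function.Injective ![(0 : Fin 4), 1, 3] := by decide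
  have h01 : Function.Injective ![(0 : Fin 4), 1] := by decide
  have h02 : Function.Injective ![(0 : Fin 4), 2] := by decide
  have h23 : Function.Injective ![(2 : Fin 4), 3] := by decide
  have hZ := leg_mem_unitary (Z_mem_unitary n lam) h23
  have c := cls_mul_eq (on_comm (i := (2 : Fin 4)) (j := 3) (by decide) (FR n 1) (FR n 1))
  have cy := cls_mul_eq (on_line_comm (i := 2) h013 (by decide) (FR n 1) (Yt n lam))
  have cx := cls_mul_eq (on_line_comm (i := 3) h02 (by decide) (FR n 1) (Xop n lam))
  have h := compress_double_aux c cy cx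
    (cls_mul_eq (LL_comm (f := ![2]) (FR n 1) (piLeftX n lam) _ h01 (by decide)))
    (cls_compress_Yt h013 h01 (by decide)) (cls_compress_X h02)
  have h' := compress_double_aux' c cy cx
    (cls_mul_eq (on_comm (i := 3) (j := 0) (by decide) (FR n 1) (rightX n lam)))
    (cls_compress_Yt h013 h01 (by decide)) (cls_compress_X h02)
  refine cle_of_cls_on_mul ?_
  rw [LL_doubleX, map_mul, LL_mul, LL_on, map_mul]
  refine h'.symm.trans (Eq.trans ?_ h)
  have e := leg_Z_X_Yt n lam 0 1 2 3 (by decide) h02 h013 h23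
  have e' : leg ![0, 2] (Xop n lam) h02 * leg ![0, 1, 3] (Yt n lam) h013 =
      star (leg ![2, 3] (Zop n lam) h23) * (leg ![0, 1, 3] (Yt n lam) h013 *
        leg ![0, 2] (Xop n lam) h02) * leg ![2, 3] (Zop n lam) h23 := by
    rw [mul_assoc, ← e, ← mul_assoc, hZ.1, one_mul]
  have e2 : cls (line (leg ![0, 2] (Xop n lam) h02)) * cls (line (leg ![0, 1, 3] (Yt n lam) h013)) =
      cls (line (leg ![2, 3] (star (Zop n lam)) h23)) * (cls (line (leg ![0, 1, 3] (Yt n lam) h013)) *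
        cls (line (leg ![0, 2] (Xop n lam) h02))) * cls (line (leg ![2, 3] (Zop n lam) h23)) := by
    rw [leg_star]
    simp only [← map_mul, line_mul_line]
    rw [e']
  rw [e2]
  calc _ = cls (on 2 (FR n 1)) * cls (on 3 (FR n 1)) * cls (line (leg ![2, 3] (star (Zop n lam)) h23)) *
        (cls (line (leg ![0, 1, 3] (Yt n lam) h013)) * cls (line (leg ![0, 2] (Xop n lam) h02))) *
        (cls (line (leg ![2, 3] (Zop n lam) h23)) * (cls (on 2 (FR n 1)) * cls (on 3 (FR n 1)))) := by
        simp only [mul_assoc]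
    _ = _ := by
      rw [cls_on_FR_mul_line h23 (Unitary.star_mem (Z_mem_unitary n lam)),
        cls_line_mul_on_FR h23 (Z_mem_unitary n lam)]

theorem adj_piLeftX : adj (piLeftX n lam) = piLeftX n lam := by
  rw [piLeftX, adj_mul, adj_mul, adj_line, adj_line, adj_on, adj_leftX, star_star, mul_assoc]

theorem adj_doubleX : Ceq (adj (doubleX n lam)) (doubleX n lam) := by
  rw [doubleX, adj_mul, adj_piLeftX, adj_on, adj_rightX]
  exact rightX_mul_piLeftX n lam

theorem doubleX_mul_doubleX : Ceq (doubleX n lam * doubleX n lam) (doubleX n lam) := by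
  have hp : cls (piLeftX n lam) * cls (piLeftX n lam) = cls (piLeftX n lam) := by
    rw [piLeftX]
    simp only [map_mul]
    have h1 := cls_line_star_mul_cls_line (Z_mem_unitary n lam)
    have h2 := cls_on_mul (1 : Fin 2) (leftX_mul_leftX n lam)
    calc _ = cls (line (Zop n lam)) * cls (on 1 (leftX n lam)) *
          (cls (line (star (Zop n lam))) * cls (line (Zop n lam))) * cls (on 1 (leftX n lam)) *
          cls (line (star (Zop n lam))) := by simp only [mul_assoc]
      _ = cls (line (Zop n lam)) * (cls (on 1 (leftX n lam)) * cls (on 1 (leftX n lam))) *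
          cls (line (star (Zop n lam))) := by rw [h1, mul_one]; simp only [mul_assoc]
      _ = _ := by rw [h2]
  have hb := cls_on_mul (0 : Fin 2) (rightX_mul_rightX n lam)
  have hc : cls (on 0 (rightX n lam)) * cls (piLeftX n lam) =
      cls (piLeftX n lam) * cls (on 0 (rightX n lam)) := by
    rw [← map_mul, cls_eq.2 (rightX_mul_piLeftX n lam), doubleX, map_mul]
  apply cls_eq.1
  rw [map_mul, doubleX, map_mul]
  calc _ = cls (piLeftX n lam) * (cls (on 0 (rightX n lam)) * cls (piLeftX n lam)) *
        cls (on 0 (rightX n lam)) := by simp only [mul_assoc]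
    _ = (cls (piLeftX n lam) * cls (piLeftX n lam)) *
        (cls (on 0 (rightX n lam)) * cls (on 0 (rightX n lam))) := by
        rw [hc]; simp only [mul_assoc]
    _ = _ := by rw [hp, hb]

end Double

/-! ## Nondegeneracy -/

section Nondegenerate

variable {n k l m : ℕ} {P Q : Submodule ℂ (Op n k)}

theorem mul_FR_le (P : Submodule ℂ (Op n k)) : P * FR n k ≤ FR n k :=
  Submodule.mul_le.2 fun p _ _ hq =>
    line_mul_FR_le p (Submodule.mul_mem_mul (Submodule.mem_span_singleton_self p) hq)

theorem nondeg_iff : Nondeg P ↔ cls P * cls (FR n k) = cls (FR n k) := by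
  rw [← map_mul, cls_eq]
  exact ⟨fun h => ⟨Cle.of_le (mul_FR_le P), h⟩, fun h => h.2⟩

theorem Nondeg.mul (hP : Nondeg P) (hQ : Nondeg Q) : Nondeg (P * Q) := by
  rw [nondeg_iff] at *
  rw [map_mul, mul_assoc, hQ, hP]

theorem nondeg_line {T : Op n k} (hT : T ∈ unitary (Op n k)) : Nondeg (line T) := by
  rw [nondeg_iff, ← map_mul, line_mul_FR hT]

theorem Nondeg.congr (hP : Nondeg P) (h : Ceq P Q) : Nondeg Q := by
  rw [nondeg_iff] at *
  rw [← cls_eq.2 h, hP]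

theorem Nondeg.LL (hP : Nondeg P) (d : Fin k ⊕ Fin l ≃ Fin m) {f : Fin k → Fin m}
    (hf : Function.Injective f) (hd : ∀ i, d (Sum.inl i) = f i) : Nondeg (LL f P hf) := by
  have hg : Function.Injective fun i => d (Sum.inr i) := d.injective.comp Sum.inr_injective
  have h1 := cls_eq.2 (LL_FR_mul_LL_FR (n := n) d hf hg hd fun _ => rfl)
  have h2 := cls_eq.2 (Ceq.LL (cls_eq.1 ((map_mul _ _ _).trans (nondeg_iff.1 hP))) f hf)
  rw [LL_mul, map_mul] at h2
  rw [nondeg_iff, ← h1, map_mul, ← mul_assoc, h2]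

/-- With K the finite rank operators on the sliced legs and K' those on the others, K·slices·K' is K
T (K K'), and the unitary T preserves K K' up to closure; finally K is removed. -/
theorem nondeg_SL (d : Fin k ⊕ Fin l ≃ Fin m) {T : Op n m} (hT : T ∈ unitary (Op n m)) :
    Nondeg (SL d T) := by
  have hf : Function.Injective fun i => d (Sum.inl i) := d.injective.comp Sum.inl_injective
  have hg : Function.Injective fun i => d (Sum.inr i) := d.injective.comp Sum.inr_injective
  have h1 := cls_eq.2 (LL_FR_mul_LL_FR (n := n) d hf hg (fun _ => rfl) fun _ => rfl)
  have hc := cls_mul_eq (LL_comm (FR n k) (FR n l) hf hg fun i j h => by simpa using d.injective h)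
  have h2 := congrArg cls (FR_mul_mul_FR (n := n) d hf hg (fun _ => rfl) (fun _ => rfl) T)
  have h3 := cls_eq.2 ((Ceq.of_eq (FR_mul_FR n l)).LL _ hg)
  have h4 := congrArg cls (line_mul_FR hT)
  rw [LL_mul] at h3
  simp only [map_mul] at h1 h2 h3 h4
  rw [hc] at h1
  have key : cls (LL _ (FR n l) hg) * (cls (LL _ (SL d T) hf) * cls (LL _ (FR n k) hf)) =
      cls (LL _ (FR n l) hg) * cls (LL _ (FR n k) hf) := by
    rw [← mul_assoc, ← h2, mul_assoc, h1, mul_assoc, h4, ← h1, ← mul_assoc, h3]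
  rw [← map_mul, ← map_mul, ← map_mul, ← LL_mul] at key
  exact cle_of_FR_mul d hf hg (fun _ => rfl) (fun _ => rfl) (cls_eq.1 key).2

variable (n) (lam : ℝ)

theorem nondeg_leftX : Nondeg (leftX n lam) := nondeg_SL _ (X_mem_unitary n lam)

theorem nondeg_rightX : Nondeg (rightX n lam) := nondeg_SL _ (X_mem_unitary n lam)

theorem nondeg_doubleX : Nondeg (doubleX n lam) :=
  (nondeg_SL _ (VD_mem_unitary n lam)).congr (SL_VD n lam)

end Nondegenerate

/-! ## The universal R-matrix as a multiplier -/

section RMatrix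

variable {n k l m : ℕ}

theorem LL_congr {f g : Fin k → Fin m} (hf : Function.Injective f) (hg : Function.Injective g)
    (h : ∀ i, f i = g i) (P : Submodule ℂ (Op n k)) : LL f P hf = LL g P hg := by
  obtain rfl : f = g := funext h
  rfl

theorem leg_congr {f g : Fin k → Fin m} (hf : Function.Injective f) (hg : Function.Injective g)
    (h : ∀ i, f i = g i) (T : Op n k) : leg f T hf = leg g T hg := by
  obtain rfl : f = g := funext h
  rfl

theorem mem_multiplierAlgebra_of_unitary {P : Submodule ℂ (Op n k)} {T : Op n k}
    (hT : T ∈ unitary (Op n k)) (hP : Cle (adj P) P) (h : Ceq (line T * P) P) :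
    T ∈ multiplierAlgebra P.topologicalClosure :=
  mem_multiplierAlgebra hP h.1 (line_star_mul hT h).1

/-- To be read with z = Z₂₃, x = X₀₃, b and b2 the right slices on the legs 0 and 2, p = π(A) on the
legs 0, 1, and a the left slices on leg 3. The conjugation by z passes through b p and cancels the
one in a, after which x only meets b a. -/
theorem Rmat_aux {M : Type*} [Monoid M] {z z' x b p a b2 : M} (hz : z' * z = 1)
    (c1 : z' * b = b * z') (c2 : z' * p = p * z') (c3 : z * b = b * z) (c4 : z * p = p * z)
    (c5 : p * a = a * p) (hx : x * (b * a) = b * a) :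
    z * x * z' * (b * p * (z * a * z' * b2)) = b * p * (z * a * z' * b2) := by
  calc _ = z * x * (z' * b) * p * z * a * z' * b2 := by simp only [mul_assoc]
    _ = z * x * b * (z' * p) * z * a * z' * b2 := by rw [c1]; simp only [mul_assoc]
    _ = z * x * b * p * (z' * z) * a * z' * b2 := by rw [c2]; simp only [mul_assoc]
    _ = z * x * b * (p * a) * z' * b2 := by rw [hz, mul_one]; simp only [mul_assoc]
    _ = z * (x * (b * a)) * p * z' * b2 := by rw [c5]; simp only [mul_assoc]
    _ = (z * b) * (a * p) * z' * b2 := by rw [hx]; simp only [mul_assoc]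
    _ = b * (z * p) * a * z' * b2 := by rw [c3, ← c5]; simp only [mul_assoc]
    _ = _ := by rw [c4]; simp only [mul_assoc]

variable (n) (lam : ℝ)

theorem adj_tensor_X : Ceq
    (adj (on 0 (rightX n lam) * on 1 (leftX n lam) : Submodule ℂ (Op n 2)))
    (on 0 (rightX n lam) * on 1 (leftX n lam)) := by
  rw [adj_mul, adj_on, adj_on, adj_leftX, adj_rightX, on_comm (by decide)]
  exact Ceq.refl _

theorem X_mem_multiplierAlgebra :
    Xop n lam ∈ multiplierAlgebra (cstarTensor (algAhatOp n lam) (algA n lam)) := by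
  rw [algAhatOp_eq, algA_eq, cstarTensor_eq _ _ (by decide) (by decide),
    LL_congr (f := Fin.castAdd 1) (g := ![0]) _ (by decide) (by decide),
    LL_congr (f := Fin.natAdd 1) (g := ![1]) _ (by decide) (by decide)]
  exact mem_multiplierAlgebra_of_unitary (X_mem_unitary n lam) (adj_tensor_X n lam).1
    (X_mul_slices n lam)

/-- The span of `A_D ⊗ A_D`, up to closure. -/
def doubleTensor : Submodule ℂ (Op n 4) :=
  LL ![0, 1] (doubleX n lam) * LL ![2, 3] (doubleX n lam)

theorem adj_doubleTensor : Cle (adj (doubleTensor n lam)) (doubleTensor n lam) := by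
  have h := (adj_doubleX n lam).1
  rw [doubleTensor, adj_mul, adj_LL, adj_LL]
  rw [LL_comm (f := ![2, 3]) _ _ _ _ (by decide)]
  exact (h.LL _ _).mul (h.LL _ _)

theorem Rmat_mul_doubleTensor :
    Ceq (line (Rmat n lam) * doubleTensor n lam) (doubleTensor n lam) := by
  have h23 : Function.Injective ![(2 : Fin 4), 3] := by decide
  have h01 : Function.Injective ![(0 : Fin 4), 1] := by decide
  have h03 : Function.Injective ![(0 : Fin 4), 3] := by decide
  have hZ := leg_mem_unitary (Z_mem_unitary n lam) h23
  have hx : cls (line (leg ![0, 3] (Xop n lam) h03)) * (cls (on 0 (rightX n lam)) *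
      cls (on 3 (leftX n lam))) = cls (on 0 (rightX n lam)) * cls (on 3 (leftX n lam)) := by
    have := (X_mul_slices n lam).LL ![(0 : Fin 4), 3] h03
    rw [LL_mul, LL_mul, LL_line, LL_on, LL_on] at this
    simp only [← map_mul]
    exact cls_eq.2 this
  have hcomm : ∀ T : Op n 2, cls (line (leg ![2, 3] T h23)) *
      cls (LL ![0, 1] (piLeftX n lam) h01) = cls (LL ![0, 1] (piLeftX n lam) h01) *
      cls (line (leg ![2, 3] T h23)) := fun T => by
    rw [← LL_line]
    exact cls_mul_eq (LL_comm _ _ _ _ (by decide))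
  have key := Rmat_aux (cls_line_star_mul_cls_line hZ)
    (by rw [← leg_star]; exact (cls_mul_eq (on_line_comm h23 (i := 0) (by decide) _ _)).symm)
    (by rw [← leg_star]; exact hcomm _)
    (cls_mul_eq (on_line_comm h23 (i := 0) (by decide) _ _)).symm (hcomm _)
    (cls_mul_eq (LL_comm (g := ![3]) (piLeftX n lam) (leftX n lam) h01
      (Function.injective_of_subsingleton _) (by decide))) hx (b2 := cls (on 2 (rightX n lam)))
  -- The first copy of A_D is written as (Â^op ⊗ 1)π(A), the second as π(A)(Â^op ⊗ 1), so that X₀₃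
  -- can reach Â^op on leg 0 and A on leg 3.
  have e1 : cls (doubleTensor n lam) = cls (on 0 (rightX n lam)) *
      cls (LL ![0, 1] (piLeftX n lam) h01) * (cls (line (leg ![2, 3] (Zop n lam) h23)) *
      cls (on 3 (leftX n lam)) * cls (line (star (leg ![2, 3] (Zop n lam) h23))) *
      cls (on 2 (rightX n lam))) := by
    have h1 := (rightX_mul_piLeftX n lam).LL ![(0 : Fin 4), 1] h01
    rw [LL_mul, LL_on] at h1
    rw [doubleTensor, map_mul, ← cls_eq.2 h1, LL_doubleX _ _ h23, LL_piLeftX _ _ h23]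
    simp only [map_mul]
    rfl
  apply cls_eq.1
  rw [map_mul, e1, Rmat, ← line_mul_line, ← line_mul_line, map_mul, map_mul]
  exact key

theorem algAD_eq_double : algAD n lam = ((doubleX n lam).topologicalClosure : Set (Op n 2)) := by
  rw [algAD_eq, (SL_VD n lam).closure_eq]

theorem Rmat_mem_multiplierAlgebra :
    Rmat n lam ∈ multiplierAlgebra (cstarTensor (algAD n lam) (algAD n lam)) := by
  rw [algAD_eq_double, cstarTensor_eq _ _ (by decide) (by decide),
    LL_congr (f := Fin.castAdd 2) (g := ![0, 1]) _ (by decide) (by decide),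
    LL_congr (f := Fin.natAdd 2) (g := ![2, 3]) _ (by decide) (by decide)]
  exact mem_multiplierAlgebra_of_unitary (Rmat_mem_unitary n lam) (adj_doubleTensor n lam)
    (Rmat_mul_doubleTensor n lam)

end RMatrix

/-! ## Values of extended tensor product homomorphisms -/

section ConjLeg

variable {n k l k' l' m a b : ℕ}

/-- The homomorphism `T ↦ U T_f U^*`. -/
def conjLeg {U : Op n m} (hU : U ∈ unitary (Op n m)) (f : Fin k → Fin m)
    (hf : Function.Injective f) : Op n k →⋆ₐ[ℂ] Op n m :=
  ((Unitary.conjStarAlgAut ℂ (Op n m) ⟨U, hU⟩ : Op n m ≃⋆ₐ[ℂ] Op n m) :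
    Op n m →⋆ₐ[ℂ] Op n m).comp (legHom n f hf)

theorem Nondeg.mono {P Q : Submodule ℂ (Op n k)} (hP : Nondeg P) (h : P ≤ Q) : Nondeg Q :=
  hP.trans (Cle.of_le (Submodule.mul_le.2 fun _ hp _ hq => Submodule.mul_mem_mul (h hp) hq))

theorem line_mul_LL_mul_line_le {U : Op n m} (hU : U ∈ unitary (Op n m)) {f : Fin k → Fin m}
    (hf : Function.Injective f) (P : Submodule ℂ (Op n k)) :
    line U * LL f P hf * line (star U) ≤ P.map (conjLeg hU f hf).toAlgHom.toLinearMap := by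
  rw [Submodule.mul_le]
  intro x hx y hy
  obtain ⟨r, rfl⟩ := Submodule.mem_span_singleton.1 hy
  rw [mul_smul_comm]
  refine Submodule.smul_mem _ _ ?_
  induction hx using Submodule.mul_induction_on' with
  | mem_mul_mem u hu t ht =>
    obtain ⟨s, rfl⟩ := Submodule.mem_span_singleton.1 hu
    obtain ⟨p, hp, rfl⟩ := ht
    rw [smul_mul_assoc, smul_mul_assoc]
    exact Submodule.smul_mem _ _ (Submodule.mem_map_of_mem (f := (conjLeg hU f hf).toAlgHom.toLinearMap) hp)
  | add x _ y _ hx hy =>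
    rw [add_mul]
    exact Submodule.add_mem _ hx hy

/-- The extension is implemented by U on all bounded operators. Its image on the tensor product is
nondegenerate, because both algebras are and U is unitary; this settles uniqueness. -/
theorem isTensorValue_conjLeg {P : Submodule ℂ (Op n k)} {Q : Submodule ℂ (Op n l)}
    (hP : Cle (P * P) P) (hP' : Cle (adj P) P) (hQ : Cle (Q * Q) Q) (hQ' : Cle (adj Q) Q)
    (nP : Nondeg P) (nQ : Nondeg Q) {B : Set (Op n k)} {C : Set (Op n l)}
    (hB : B = P.topologicalClosure) (hC : C = Q.topologicalClosure)
    {φ : Op n k → Op n k'} {ψ : Op n l → Op n l'} {U : Op n (k' + l')}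
    (hU : U ∈ unitary (Op n (k' + l'))) {f : Fin (k + l) → Fin (k' + l')}
    (hf : Function.Injective f)
    (h : ∀ b c, U * leg f (opTensor b c) hf * star U = opTensor (φ b) (ψ c))
    (d : Fin k ⊕ Fin a ≃ Fin (k' + l')) (hd : ∀ i, d (Sum.inl i) = f (Fin.castAdd l i))
    (d' : Fin l ⊕ Fin b ≃ Fin (k' + l')) (hd' : ∀ i, d' (Sum.inl i) = f (Fin.natAdd k i))
    (m : multiplierAlgebra (cstarTensor B C)) :
    IsTensorValue B C φ ψ m (U * leg f (m : Op n (k + l)) hf * star U) := by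
  subst hB hC
  have h1 : Function.Injective (Fin.castAdd l : Fin k → _) := Fin.castAdd_injective k l
  have h2 : Function.Injective (Fin.natAdd k : Fin l → _) := Fin.natAdd_injective l k
  refine isTensorValue_of_hom hP hP' hQ hQ' h1 h2 (conjLeg hU f hf) (fun b _ c _ => h b c) ?_ m
  refine Nondeg.mono ?_ (line_mul_LL_mul_line_le hU hf _)
  refine ((nondeg_line hU).mul ?_).mul (nondeg_line (Unitary.star_mem hU))
  rw [LL_mul, LL_LL, LL_LL]
  exact (nP.LL d _ hd).mul (nQ.LL d' _ hd')

theorem conj_mul_of_comm {M : Type*} [Monoid M] {u b c us : M} (h : b * u = u * b) :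
    u * (b * c) * us = b * (u * c * us) := by
  rw [← mul_assoc u, ← h]
  simp only [mul_assoc]

theorem conj_mul_of_comm' {M : Type*} [Monoid M] {u b c us : M} (h : c * us = us * c) :
    u * (b * c) * us = u * b * us * c := by
  rw [← mul_assoc u, mul_assoc _ c, h]
  simp only [mul_assoc]

variable (n) (lam : ℝ)

/-- A bijection of `Fin a ⊕ Fin b` given on the two parts. -/
def sumEquiv (f : Fin a → Fin m) (g : Fin b → Fin m)
    (h : Function.Bijective (Sum.elim f g) := by decide) : Fin a ⊕ Fin b ≃ Fin m :=
  Equiv.ofBijective _ h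

/-- Implemented by U = Z₂₃ with b on leg 0 and a on leg 3, as Z₂₃ commutes with leg 0. -/
theorem isTensorValue_Rmat
    (hX : Xop n lam ∈ multiplierAlgebra (cstarTensor (algAhatOp n lam) (algA n lam))) :
    IsTensorValue (algAhatOp n lam) (algA n lam) (piHat n) (piA n lam)
      ⟨Xop n lam, hX⟩ (Rmat n lam) := by
  refine isTensorValue_conjLeg (k' := 2) (l' := 2) (rightX_mul_rightX n lam).1
    (Ceq.of_eq (adj_rightX n lam)).1
    (leftX_mul_leftX n lam).1 (Ceq.of_eq (adj_leftX n lam)).1 (nondeg_rightX n lam)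
    (nondeg_leftX n lam) (algAhatOp_eq n lam) (algA_eq n lam)
    (leg_mem_unitary (f := ![2, 3]) (Z_mem_unitary n lam) (by decide)) (f := ![0, 3]) (by decide)
    (fun b c => ?_) (sumEquiv ![(0 : Fin 4)] ![1, 2, 3]) (by decide)
    (sumEquiv ![(3 : Fin 4)] ![0, 1, 2]) (by decide) ⟨Xop n lam, hX⟩
  have hc := (leg_commute (f := ![(0 : Fin 4)]) (g := ![2, 3]) b (Zop n lam)
    (by decide) (by decide) (by decide)).eq
  rw [opTensor_eq _ _ (by decide) (by decide), opTensor_eq _ _ (by decide) (by decide), leg_mul,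
    piHat, piA, leg_mul, leg_mul, leg_star, leg_leg, leg_leg, leg_leg, leg_leg,
    leg_congr (f := ![0, 3] ∘ Fin.castAdd 1) (g := ![0]) _ (by decide) (by decide),
    leg_congr (f := ![0, 3] ∘ Fin.natAdd 1) (g := ![3]) _ (by decide) (by decide),
    leg_congr (f := Fin.castAdd 2 ∘ ![0]) (g := ![0]) _ (by decide) (by decide),
    leg_congr (f := Fin.natAdd 2 ∘ ![1]) (g := ![3]) _ (by decide) (by decide),
    leg_congr (f := Fin.natAdd 2) (g := ![2, 3]) _ (by decide) (by decide)]
  exact conj_mul_of_comm hc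

/-- Implemented by U = V₁₂^* on operators on the copies 2, 3; the value is V₁₂^*𝓡₂₃V₁₂, known from
`Rmat_VD_left`. -/
theorem isTensorValue_DeltaD_id
    (hR : Rmat n lam ∈ multiplierAlgebra (cstarTensor (algAD n lam) (algAD n lam))) :
    IsTensorValue (algAD n lam) (algAD n lam) (DeltaD n lam) id ⟨Rmat n lam, hR⟩
        (leg ![0, 1, 4, 5] (Rmat n lam) * leg ![2, 3, 4, 5] (Rmat n lam)) := by
  have hV := leg_mem_unitary (f := ![(0 : Fin 6), 1, 2, 3]) (VD_mem_unitary n lam) (by decide)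
  have key := isTensorValue_conjLeg (k' := 4) (l' := 2) (doubleX_mul_doubleX n lam).1
    (adj_doubleX n lam).1 (doubleX_mul_doubleX n lam).1
    (adj_doubleX n lam).1 (nondeg_doubleX n lam)
    (nondeg_doubleX n lam) (algAD_eq_double n lam) (algAD_eq_double n lam)
    (φ := DeltaD n lam) (ψ := id)
    (Unitary.star_mem hV) (f := ![2, 3, 4, 5]) (by decide)
    (fun b c => ?_) (sumEquiv ![(2 : Fin 6), 3] ![0, 1, 4, 5]) (by decide)
    (sumEquiv ![(4 : Fin 6), 5] ![0, 1, 2, 3]) (by decide) ⟨Rmat n lam, hR⟩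
  · have e := Rmat_VD_left n lam
    have : star (leg ![0, 1, 2, 3] (VD n lam)) * leg ![2, 3, 4, 5] (Rmat n lam) *
        star (star (leg ![0, 1, 2, 3] (VD n lam))) = (leg ![0, 1, 4, 5] (Rmat n lam) *
          leg ![2, 3, 4, 5] (Rmat n lam) : Op n 6) := by
      rw [star_star, mul_assoc, e, mul_assoc, ← mul_assoc, hV.1, one_mul]
    rw [← this]
    exact key
  · have hc := (leg_commute (f := ![(4 : Fin 6), 5]) (g := ![0, 1, 2, 3]) c (VD n lam)
      (by decide) (by decide) (by decide)).eq
    rw [opTensor_eq _ _ (by decide) (by decide), opTensor_eq _ _ (by decide) (by decide), leg_mul,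
      id, DeltaD, leg_mul, leg_mul, leg_star, leg_leg, leg_leg, leg_leg,
      leg_congr (f := ![2, 3, 4, 5] ∘ Fin.castAdd 2) (g := ![2, 3]) _ (by decide) (by decide),
      leg_congr (f := ![2, 3, 4, 5] ∘ Fin.natAdd 2) (g := ![4, 5]) _ (by decide) (by decide),
      leg_congr (f := Fin.castAdd 2 ∘ ![2, 3]) (g := ![2, 3]) _ (by decide) (by decide),
      leg_congr (f := Fin.castAdd 2) (g := ![0, 1, 2, 3]) _ (by decide) (by decide),
      leg_congr (f := Fin.natAdd 4) (g := ![4, 5]) _ (by decide) (by decide), star_star]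
    exact conj_mul_of_comm' hc
    decide

/-- Implemented by U = V₂₃^* on operators on the copies 1, 3; the value is V₂₃^*𝓡₁₃V₂₃, known from
`Rmat_VD_right`. -/
theorem isTensorValue_id_DeltaD
    (hR : Rmat n lam ∈ multiplierAlgebra (cstarTensor (algAD n lam) (algAD n lam))) :
    IsTensorValue (algAD n lam) (algAD n lam) id (DeltaD n lam) ⟨Rmat n lam, hR⟩
        (leg ![0, 1, 4, 5] (Rmat n lam) * leg ![0, 1, 2, 3] (Rmat n lam)) := by
  have hV := leg_mem_unitary (f := ![(2 : Fin 6), 3, 4, 5]) (VD_mem_unitary n lam) (by decide)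
  have key := isTensorValue_conjLeg (k' := 2) (l' := 4) (doubleX_mul_doubleX n lam).1
    (adj_doubleX n lam).1 (doubleX_mul_doubleX n lam).1
    (adj_doubleX n lam).1 (nondeg_doubleX n lam)
    (nondeg_doubleX n lam) (algAD_eq_double n lam) (algAD_eq_double n lam)
    (φ := id) (ψ := DeltaD n lam)
    (Unitary.star_mem hV) (f := ![0, 1, 4, 5]) (by decide)
    (fun b c => ?_) (sumEquiv ![(0 : Fin 6), 1] ![2, 3, 4, 5]) (by decide)
    (sumEquiv ![(4 : Fin 6), 5] ![0, 1, 2, 3]) (by decide) ⟨Rmat n lam, hR⟩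
  · have e := Rmat_VD_right n lam
    have : star (leg ![2, 3, 4, 5] (VD n lam)) * leg ![0, 1, 4, 5] (Rmat n lam) *
        star (star (leg ![2, 3, 4, 5] (VD n lam))) = (leg ![0, 1, 4, 5] (Rmat n lam) *
          leg ![0, 1, 2, 3] (Rmat n lam) : Op n 6) := by
      rw [star_star, mul_assoc, e, mul_assoc, ← mul_assoc, hV.1, one_mul]
    rw [← this]
    exact key
  · have hc := (leg_commute (f := ![(0 : Fin 6), 1]) (g := ![2, 3, 4, 5]) b (star (VD n lam))
      (by decide) (by decide) (by decide)).eq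
    rw [leg_star] at hc
    rw [opTensor_eq _ _ (by decide) (by decide), opTensor_eq _ _ (by decide) (by decide), leg_mul,
      id, DeltaD, leg_mul, leg_mul, leg_star, leg_leg, leg_leg, leg_leg,
      leg_congr (f := ![0, 1, 4, 5] ∘ Fin.castAdd 2) (g := ![0, 1]) _ (by decide) (by decide),
      leg_congr (f := ![0, 1, 4, 5] ∘ Fin.natAdd 2) (g := ![4, 5]) _ (by decide) (by decide),
      leg_congr (f := Fin.natAdd 2 ∘ ![2, 3]) (g := ![4, 5]) _ (by decide) (by decide),
      leg_congr (f := Fin.castAdd 4) (g := ![0, 1]) _ (by decide) (by decide),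
      leg_congr (f := Fin.natAdd 2) (g := ![2, 3, 4, 5]) _ (by decide) (by decide), star_star]
    exact conj_mul_of_comm hc
    decide

end ConjLeg

/-! ## Intertwining the two comultiplications -/

section Intertwine

open InnerProductSpace

variable (n : ℕ) (lam : ℝ)

/-- Conjugation commutes with slicing when the conjugating operator avoids the sliced legs, which
carry the rank one operators κ, k1, k2. -/
theorem mul_conj_of_mul_eq {M : Type*} [Monoid M] {κ k1 k2 v w u us : M}
    (h : κ * v = k1 * w * k2) (h1 : k1 * u = u * k1) (h2 : k2 * us = us * k2)
    (hκ : κ * u = u * κ) : κ * (u * v * us) = k1 * (u * w * us) * k2 := by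
  calc κ * (u * v * us) = (κ * u) * v * us := by simp only [mul_assoc]
    _ = u * (κ * v) * us := by rw [hκ]; simp only [mul_assoc]
    _ = (u * k1) * w * (k2 * us) := by rw [h]; simp only [mul_assoc]
    _ = (k1 * u) * w * (us * k2) := by rw [h1, h2]
    _ = _ := by simp only [mul_assoc]

/-- To be read with r = 𝓡₁₂, v = V₁₂, w = V₁₃, t = V₂₃: the pentagon equation turns v^* t v into w
t, and r reverses that product. -/
theorem conj_conj_eq {M : Type*} [Monoid M] {r rs v vs w t : M} (hv : vs * v = 1)
    (hr : r * rs = 1) (hp : v * w * t = t * v) (hq : r * w * t = t * w * r) :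
    r * vs * t * (v * rs) = t * w := by
  calc r * vs * t * (v * rs) = r * vs * (t * v) * rs := by simp only [mul_assoc]
    _ = r * (vs * v) * w * t * rs := by rw [← hp]; simp only [mul_assoc]
    _ = (r * w * t) * rs := by rw [hv, mul_one]
    _ = t * w * (r * rs) := by rw [hq, mul_assoc]
    _ = t * w := by rw [hr, mul_one]

theorem rankOne_mul_leg_sl (T : Op n 4) (α β γ δ : HT n 2) (f : Fin 4 → Fin 6)
    (hf : Function.Injective f) (h2 : f 2 = 4) (h3 : f 3 = 5) {g : Fin 2 → Fin 6}
    (hg : Function.Injective g) (h0 : g 0 = f 0) (h1 : g 1 = f 1) :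
    leg ![(4 : Fin 6), 5] (rankOne ℂ α δ) * leg g (sl (firstLast 2 2) γ β T) hg =
      leg ![(4 : Fin 6), 5] (rankOne ℂ α β) * leg f T hf * leg ![(4 : Fin 6), 5] (rankOne ℂ γ δ) := by
  have h := congrArg (fun S => leg f S hf) (rankOne_mul_mul_rankOne (firstLast 2 2)
    (f := ![0, 1]) (g := ![2, 3]) (by decide) (by decide) (by decide) (by decide) T α β γ δ)
  simp only [leg_mul, leg_leg] at h
  have e : ∀ i, (f ∘ ![(2 : Fin 4), 3]) i = ![4, 5] i := by
    intro i; fin_cases i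
    exacts [h2, h3]
  have e' : ∀ i, (f ∘ ![(0 : Fin 4), 1]) i = g i := by
    intro i; fin_cases i
    exacts [h0.symm, h1.symm]
  rw [leg_congr _ (by decide) e, leg_congr _ (by decide) e, leg_congr _ (by decide) e,
    leg_congr _ hg e'] at h
  exact h.symm

theorem Rmat_DeltaD_sl (β γ : HT n 2) :
    Rmat n lam * DeltaD n lam (sl (firstLast 2 2) γ β (VD n lam)) * star (Rmat n lam) =
      DeltaDcop n lam (sl (firstLast 2 2) γ β (VD n lam)) := by
  obtain ⟨ζ, hζ⟩ := exists_unit n 2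
  have hV := VD_mem_unitary n lam
  have hR := Rmat_mem_unitary n lam
  have comm : ∀ (S : Op n 2) (T : Op n 4), (leg ![4, 5] S * leg ![0, 1, 2, 3] T : Op n 6) =
      leg ![0, 1, 2, 3] T * leg ![4, 5] S := fun S T =>
    (leg_commute S T (by decide) (by decide) (by decide)).eq
  have comm' : ∀ (S : Op n 2) (T : Op n 4), (leg ![4, 5] S * leg ![2, 3, 0, 1] T : Op n 6) =
      leg ![2, 3, 0, 1] T * leg ![4, 5] S := fun S T =>
    (leg_commute S T (by decide) (by decide) (by decide)).eq
  have p1 := rankOne_mul_leg_sl n (VD n lam) ζ β γ ζ ![2, 3, 4, 5] (by decide) rfl rfl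
    (g := ![2, 3]) (by decide) rfl rfl
  have p2 := rankOne_mul_leg_sl n (VD n lam) ζ β γ ζ ![0, 1, 4, 5] (by decide) rfl rfl
    (g := ![0, 1]) (by decide) rfl rfl
  set x := sl (firstLast 2 2) γ β (VD n lam)
  have q1 := mul_conj_of_mul_eq (u := leg ![0, 1, 2, 3] (Rmat n lam * star (VD n lam)))
    (us := leg ![0, 1, 2, 3] (VD n lam * star (Rmat n lam))) p1 (comm _ _) (comm _ _) (comm _ _)
  have q2 := mul_conj_of_mul_eq (u := leg ![2, 3, 0, 1] (star (VD n lam)))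
    (us := leg ![2, 3, 0, 1] (VD n lam)) p2 (comm' _ _) (comm' _ _) (comm' _ _)
  have e1 : leg ![0, 1, 2, 3] (Rmat n lam * star (VD n lam)) * leg ![2, 3, 4, 5] (VD n lam) *
      leg ![0, 1, 2, 3] (VD n lam * star (Rmat n lam)) =
      (leg ![2, 3, 4, 5] (VD n lam) * leg ![0, 1, 4, 5] (VD n lam) : Op n 6) := by
    rw [leg_mul, leg_mul, leg_star, leg_star]
    exact conj_conj_eq (leg_mem_unitary hV _).1 (leg_mem_unitary hR _).2 (pentagon_VD n lam)
      (Rmat_VD_VD n lam)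
  -- The pentagon equation with the copies 1 and 2 exchanged: V₂₁^*V₁₃V₂₁ = V₂₃V₁₃, the same
  -- operator as in e1.
  have e2 : leg ![2, 3, 0, 1] (star (VD n lam)) * leg ![0, 1, 4, 5] (VD n lam) *
      leg ![2, 3, 0, 1] (VD n lam) =
      (leg ![2, 3, 4, 5] (VD n lam) * leg ![0, 1, 4, 5] (VD n lam) : Op n 6) := by
    have h := congrArg (fun T : Op n 6 =>
      leg ![(2 : Fin 6), 3, 0, 1, 4, 5] T) (pentagon_VD n lam)
    simp only [leg_mul, leg_leg_four] at h
    rw [mul_assoc (leg _ (star _) _), leg_star]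
    refine (congrArg _ h.symm).trans ?_
    simp only [← mul_assoc]
    exact congrArg₂ _ ((congrArg₂ _ (leg_mem_unitary hV _).1 rfl).trans (one_mul _)) rfl
  have q := q1.trans ((congrArg (fun T => leg ![(4 : Fin 6), 5] (rankOne ℂ ζ β) * T *
    leg ![(4 : Fin 6), 5] (rankOne ℂ γ ζ)) (e1.trans e2.symm)).trans q2.symm)
  have s1 : (leg ![0, 1, 2, 3] (Rmat n lam * star (VD n lam)) * leg ![2, 3] x *
      leg ![0, 1, 2, 3] (VD n lam * star (Rmat n lam)) : Op n 6) =
      leg ![0, 1, 2, 3] (Rmat n lam * DeltaD n lam x * star (Rmat n lam)) := by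
    simp only [DeltaD, leg_mul, leg_leg_two, mul_assoc]
    rfl
  have s2 : (leg ![2, 3, 0, 1] (star (VD n lam)) * leg ![0, 1] x *
      leg ![2, 3, 0, 1] (VD n lam) : Op n 6) = leg ![0, 1, 2, 3] (DeltaDcop n lam x) := by
    simp only [DeltaDcop, DeltaD, leg_mul, leg_leg_two, leg_leg_four]
    rfl
  rw [s1, s2] at q
  -- Both sides now agree after tensoring with |ζ⟩⟨ζ| on the third copy, which the slice by the unit
  -- vector ζ removes.
  have h := congrArg (sl (firstLast 4 2) ζ ζ) q
  rw [sl_mul_leg (firstLast 4 2) (f := ![0, 1, 2, 3]) (by decide) (by decide) (by decide)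
    (by decide), sl_mul_leg (firstLast 4 2) (f := ![0, 1, 2, 3]) (by decide) (by decide) (by decide)
    (by decide)] at h
  have hne : inner ℂ ζ (rankOne ℂ ζ ζ ζ) = 1 := by
    rw [rankOne_apply, hζ, one_smul, hζ]
  rwa [hne, one_smul, one_smul] at h

/-- Both sides are linear and continuous in x, and A_D is the closed span of the slices treated in
`Rmat_DeltaD_sl`. -/
theorem Rmat_mul_DeltaD {x : Op n 2} (hx : x ∈ algAD n lam) :
    Rmat n lam * DeltaD n lam x * star (Rmat n lam) = DeltaDcop n lam x := by
  have c1 : Continuous (DeltaD n lam) := by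
    have := continuous_leg (n := n) (f := ![(2 : Fin 4), 3]) (by decide)
    unfold DeltaD
    fun_prop
  have c2 : Continuous (DeltaDcop n lam) :=
    (continuous_leg (n := n) (f := ![(2 : Fin 4), 3, 0, 1]) (by decide)).comp c1
  rw [algAD_eq] at hx
  refine closure_minimal (s := (SL (firstLast 2 2) (VD n lam) : Set (Op n 2)))
    (t := {x | Rmat n lam * DeltaD n lam x * star (Rmat n lam) = DeltaDcop n lam x})
    (fun y hy => ?_) (isClosed_eq ((c1.const_mul _).mul_const _) c2) hx
  have a1 : ∀ y z, DeltaD n lam (y + z) = DeltaD n lam y + DeltaD n lam z := fun y z => by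
    simp only [DeltaD, ← legHom_apply, map_add, mul_add, add_mul]
  have a2 : ∀ (r : ℂ) y, DeltaD n lam (r • y) = r • DeltaD n lam y := fun r y => by
    simp only [DeltaD, ← legHom_apply, map_smul, mul_smul_comm, smul_mul_assoc]
  induction hy using Submodule.span_induction with
  | mem y hy =>
    obtain ⟨γ, β, rfl⟩ := hy
    exact Rmat_DeltaD_sl n lam β γ
  | zero => simp [DeltaDcop, DeltaD, ← legHom_apply]
  | add y z _ _ hy hz =>
    simp only [Set.mem_ofPred_eq, DeltaDcop, ← legHom_apply] at hy hz ⊢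
    rw [a1, mul_add, add_mul, map_add, hy, hz]
  | smul r y _ hy =>
    simp only [Set.mem_ofPred_eq, DeltaDcop, ← legHom_apply] at hy ⊢
    rw [a2, mul_smul_comm, smul_mul_assoc, map_smul, hy]

end Intertwine

end QDouble

end

theorem mainTheorem5 (n : ℕ) (lam : ℝ) :
    -- `𝓡` is unitary, and `𝓡 = (π' ⊗ π)(X)` with `X ∈ M(Â^op ⊗ A)`
    Rmat n lam ∈ unitary (Op n 4) ∧
    (∃ hX : Xop n lam ∈ multiplierAlgebra (cstarTensor (algAhatOp n lam) (algA n lam)),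
      IsTensorValue (algAhatOp n lam) (algA n lam) (piHat n) (piA n lam)
        ⟨Xop n lam, hX⟩ (Rmat n lam)) ∧
    -- `𝓡 ∈ M(A_D ⊗ A_D)`, `(Δ_D ⊗ id)(𝓡) = 𝓡₁₃ 𝓡₂₃`, `(id ⊗ Δ_D)(𝓡) = 𝓡₁₃ 𝓡₁₂`
    (∃ hR : Rmat n lam ∈ multiplierAlgebra (cstarTensor (algAD n lam) (algAD n lam)),
      IsTensorValue (algAD n lam) (algAD n lam) (DeltaD n lam) id ⟨Rmat n lam, hR⟩
        (leg ![0, 1, 4, 5] (Rmat n lam) * leg ![2, 3, 4, 5] (Rmat n lam)) ∧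
      IsTensorValue (algAD n lam) (algAD n lam) id (DeltaD n lam) ⟨Rmat n lam, hR⟩
        (leg ![0, 1, 4, 5] (Rmat n lam) * leg ![0, 1, 2, 3] (Rmat n lam))) ∧
    -- `𝓡 Δ_D(x) 𝓡^* = Δ_D^cop(x)`
    (∀ x ∈ algAD n lam,
      Rmat n lam * DeltaD n lam x * star (Rmat n lam) = DeltaDcop n lam x) ∧
    -- the quantum Yang-Baxter equation `𝓡₁₂ 𝓡₁₃ 𝓡₂₃ = 𝓡₂₃ 𝓡₁₃ 𝓡₁₂`
    (leg ![0, 1, 2, 3] (Rmat n lam) * leg ![0, 1, 4, 5] (Rmat n lam) *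
        leg ![2, 3, 4, 5] (Rmat n lam) : Op n 6) =
      leg ![2, 3, 4, 5] (Rmat n lam) * leg ![0, 1, 4, 5] (Rmat n lam) *
        leg ![0, 1, 2, 3] (Rmat n lam) := by
  exact ⟨Rmat_mem_unitary n lam,
    ⟨X_mem_multiplierAlgebra n lam, isTensorValue_Rmat n lam _⟩,
    ⟨Rmat_mem_multiplierAlgebra n lam, isTensorValue_DeltaD_id n lam _,
      isTensorValue_id_DeltaD n lam _⟩,
    fun _ hx => Rmat_mul_DeltaD n lam hx, yang_baxter n lam⟩
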